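/- **Setting.** Let $\mathbb T=\mathbb R/2\pi\mathbb Z$, $\langle n\rangle=\max(1,|n|)$, and write $\widehat u(n)$, $n\in\mathbb Z$, for the Fourier coefficients of a distribution $u$ on $\mathbb T$. For $\beta\in\mathbb R$ let $H^\beta_c$ be the Sobolev space with norm $\|u\|_\beta=\big(\sum_n\langle n\rangle^{2\beta}|\widehat u(n)|^2\big)^{1/2}$, put $\|\cdot\|=\|\cdot\|_0$ and $L^2_c=H^0_c$, and let $H^{\beta,\sqrt{\log}}_c$ be the space with norm $\|u\|_{\beta,\sqrt{\log}}=\big(\sum_n\langle n\rangle^{2\beta}\log(\langle n\rangle+1)|\widehat u(n)|^2\big)^{1/2}$. The subscript $r,0$ denotes the real subspaces of real-valued $u$ with $\widehat u(0)=0$. Let $H^\beta_+=\{f\in H^\beta_c:\widehat f(n)=0\ \forall n<0\}$, $L^2_+=H^0_+$, and let $\Pi$ be the Szegő projector, which keeps the Fourier coefficients with $n\ge0$. Let $\langle f|g\rangle=\sum_n\widehat f(n)\overline{\widehat g(n)}$, both for the scalar product of $L^2_+$ and for the pairing of $H^{-1/2}_+$ with $H^{1/2}_+$. The product $(u,v)\mapsto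 uv$ is bounded from $H^{-1/2,\sqrt{\log}}_c\times H^{1/2}_c$ to $H^{-1/2}_c$; let $K_0>0$ be any constant with $\|uv\|_{-1/2}\le K_0\|u\|_{-1/2,\sqrt{\log}}\|v\|_{1/2}$ for all such $u,v$. For $u\in H^{-1/2,\sqrt{\log}}_c$ the Lax operator is $L_uf=-i\partial_xf-\Pi(uf)$, $L_u:H^{1/2}_+\to H^{-1/2}_+$, also regarded as an unbounded operator on $H^{-1/2}_+$ with domain $H^{1/2}_+$. For $u\in H^{-1/2,\sqrt{\log}}_{r,0}$ let $L_u^{\rm sym}$ be the restriction of $L_u$ to an unbounded operator on $L^2_+$ with domain $\mathrm{Dom}(L_u^{\rm sym})=\{f\in H^{1/2}_+: L_uf\in L^2_+\}$; this is $(L_u-\lambda)^{-1}(L^2_+)$ for every $\lambda$ for which $L_u-\lambda:H^{1/2}_+\to H^{-1/2}_+$ is bijective. The root space of an operator $A$ at $\mu$ is $\bigcup_k\ker(A-\mu)^k$, and an eigenvalue is simple if its root space is one-dimensional. **Theorem.** For every $u\in H^{-1/2,\sqrt{\log}}_{r,0}$: 1. $L_u^{\rm sym}$ is self-adjoint on $L^2_+$,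 and $\mathrm{Dom}(L_u^{\rm sym})$ is dense in $H^{1/2}_+$ and in $L^2_+$. 2. $L_u^{\rm sym}$ has compact resolvent, and its spectrum is $\{\lambda_n(u):n\ge0\}$, where the $\lambda_n=\lambda_n(u)$ are real simple eigenvalues with $\lambda_n\to\infty$ as $n\to\infty$ and $\lambda_{n+1}\ge1+\lambda_n$ for all $n\ge0$. Any choice of corresponding normalized eigenfunctions $f_n$ ($n\ge0$) lies in $H^{1/2}_+$ and is an orthonormal basis of $L^2_+$. 3. $L_u^{\rm sym}$ and $L_u$ have the same eigenvalues and the same root spaces. In particular the $\lambda_n(u)$ are simple eigenvalues of $L_u$. Moreover, for each $n\ge0$, the function $u\mapsto\lambda_n(u)$ is real-analytic on the real Hilbert space $H^{-1/2,\sqrt{\log}}_{r,0}$. 4. There is an absolute constant $C_0>0$ such that, with $\eta(x)=C_0x(1+x)$, the following holds for every $u_0\in L^2_{r,0}$. There are constants $0<c<C$ such that for all $u\in H^{-1/2,\sqrt{\log}}_{r,0}$ with $\|u-u_0\|_{-1/2,\sqrt{\log}}<1/(4K_0)$ and all real $\lambda_\bullet<-(1+\eta(\|u_0\|))$, the map $L_u-\lambda_\bullet:H^{1/2}_+\to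 H^{-1/2}_+$ is bijective and, for every $f\in H^{1/2}_+$, the number $\langle(L_u-\lambda_\bullet)f|f\rangle$ is real and $$c\,\|f\|_{1/2}^2\le\big\langle(L_u-\lambda_\bullet)f\,\big|\,f\big\rangle\le C(1+|\lambda_\bullet|)\,\|f\|_{1/2}^2 .$$ -/

import Mathlib

open scoped ENNReal ComplexConjugate

namespace LaxLog

noncomputable section

/-! ### Periodic distributions and Sobolev spaces on the circle -/

/-- The Japanese bracket `⟨n⟩ = max (1, |n|)`. -/
def bracket (n : ℤ) : ℝ := max 1 |(n : ℝ)|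

theorem one_le_bracket (n : ℤ) : 1 ≤ bracket n := le_max_left _ _

theorem bracket_pos (n : ℤ) : 0 < bracket n := one_pos.trans_le (one_le_bracket n)

theorem log_bracket_pos (n : ℤ) : 0 < Real.log (bracket n + 1) :=
  Real.log_pos (by linarith [one_le_bracket n])

/-- A positive weight on the frequencies `n ∈ ℤ`. -/
structure FourierWeight where
  /-- The weight of the frequency `n`. -/
  toFun : ℤ → ℝ
  pos : ∀ n, 0 < toFun n

/-- The weight `⟨n⟩ ^ (2 β)`. -/
def sobolevWeight (β : ℝ) : FourierWeight where
  toFun n := bracket n ^ (2 * β)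
  pos n := Real.rpow_pos_of_pos (bracket_pos n) _

/-- The weight `⟨n⟩ ^ (2 β) * log (⟨n⟩ + 1)`. -/
def sobolevLogWeight (β : ℝ) : FourierWeight where
  toFun n := bracket n ^ (2 * β) * Real.log (bracket n + 1)
  pos n := mul_pos (Real.rpow_pos_of_pos (bracket_pos n) _) (log_bracket_pos n)

/-- The Fourier coefficient sequences `a` with `∑ n, w n * |a n| ^ 2 < ∞`. -/
def weightedSubmodule (w : FourierWeight) : Submodule ℂ (ℤ → ℂ) where
  carrier := {a | Summable fun n => w.toFun n * ‖a n‖ ^ 2}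
  zero_mem' := by simp [summable_zero]
  add_mem' {a b} ha hb := by
    refine Summable.of_nonneg_of_le (fun n => by have := w.pos n; positivity) (fun n => ?_)
      ((ha.mul_left 2).add (hb.mul_left 2))
    have h := w.pos n
    have h1 : ‖(a + b) n‖ ^ 2 ≤ 2 * ‖a n‖ ^ 2 + 2 * ‖b n‖ ^ 2 := by
      have h2 : ‖(a + b) n‖ ≤ ‖a n‖ + ‖b n‖ := norm_add_le _ _
      nlinarith [sq_nonneg (‖a n‖ - ‖b n‖), norm_nonneg ((a + b) n)]
    nlinarith [mul_le_mul_of_nonneg_left h1 h.le]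
  smul_mem' c a ha := by
    refine (ha.mul_left (‖c‖ ^ 2)).congr fun n => ?_
    simp only [Pi.smul_apply, norm_smul]
    ring

/-- The space of periodic distributions `u = ∑ n, û(n) e^{inx}` on the torus `ℝ / 2πℤ` with
`∑ n, w n * |û(n)| ^ 2 < ∞`. Periodic distributions correspond exactly to sequences of Fourier
coefficients of polynomial growth, so a distribution is represented by that sequence,
`u n = û(n)`. The norm is `(∑ n, w n * |û(n)| ^ 2) ^ (1/2)`, see `WSobolev.norm_sq_eq`. -/
def WSobolev (w : FourierWeight) : Type := weightedSubmodule w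

variable {w : FourierWeight}

instance : AddCommGroup (WSobolev w) := inferInstanceAs (AddCommGroup (weightedSubmodule w))

instance : Module ℂ (WSobolev w) := inferInstanceAs (Module ℂ (weightedSubmodule w))

instance : FunLike (WSobolev w) ℤ ℂ where
  coe u := (show weightedSubmodule w from u).1
  coe_injective _ _ h := Subtype.ext h

/-- The element with given Fourier coefficients. -/
def WSobolev.mk (a : ℤ → ℂ) (ha : Summable fun n => w.toFun n * ‖a n‖ ^ 2) : WSobolev w :=
  (⟨a, ha⟩ : weightedSubmodule w)

@[simp] theorem WSobolev.mk_apply (a : ℤ → ℂ) (ha : Summable fun n => w.toFun n * ‖a n‖ ^ 2)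
    (n : ℤ) : (WSobolev.mk a ha : WSobolev w) n = a n := rfl

theorem WSobolev.summable (u : WSobolev w) : Summable fun n => w.toFun n * ‖u n‖ ^ 2 :=
  (show weightedSubmodule w from u).2

@[ext] theorem WSobolev.ext {u v : WSobolev w} (h : ∀ n, u n = v n) : u = v :=
  DFunLike.ext _ _ h

@[simp] theorem WSobolev.add_apply (u v : WSobolev w) (n : ℤ) : (u + v) n = u n + v n := rfl

@[simp] theorem WSobolev.sub_apply (u v : WSobolev w) (n : ℤ) : (u - v) n = u n - v n := rfl

@[simp] theorem WSobolev.zero_apply (n : ℤ) : (0 : WSobolev w) n = 0 := rfl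

@[simp] theorem WSobolev.smul_apply (c : ℂ) (u : WSobolev w) (n : ℤ) : (c • u) n = c * u n := rfl

/-- The linear isomorphism `û(n) ↦ (w n)^{1/2} û(n)` onto `ℓ²(ℤ)`, which defines the Hilbert
structure. -/
def WSobolev.toLp (w : FourierWeight) : WSobolev w ≃ₗ[ℂ] lp (fun _ : ℤ => ℂ) 2 where
  toFun u := ⟨fun n => (Real.sqrt (w.toFun n) : ℂ) * u n, by
    refine memℓp_gen (u.summable.congr fun n => ?_)
    have h := (w.pos n).le
    rw [ENNReal.toReal_ofNat, Real.rpow_two, norm_mul, mul_pow, Complex.norm_real,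
      Real.norm_of_nonneg (Real.sqrt_nonneg _), Real.sq_sqrt h]⟩
  map_add' u v := by
    ext n
    exact mul_add _ _ _
  map_smul' c u := by
    ext n
    simp [mul_left_comm]
  invFun x := WSobolev.mk (fun n => (Real.sqrt (w.toFun n) : ℂ)⁻¹ * x n) (by
    have hx : Summable fun n => ‖x n‖ ^ 2 := by
      have := (memℓp_gen_iff (p := 2) (by norm_num)).1 (lp.memℓp x)
      simpa using this
    refine hx.congr fun n => ?_
    have h := w.pos n
    rw [norm_mul, mul_pow, norm_inv, Complex.norm_real,
      Real.norm_of_nonneg (Real.sqrt_nonneg _), inv_pow, Real.sq_sqrt h.le]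
    field_simp)
  left_inv u := by
    ext n
    have h : (Real.sqrt (w.toFun n) : ℂ) ≠ 0 := by
      exact_mod_cast (Real.sqrt_pos.2 (w.pos n)).ne'
    simp [h]
  right_inv x := by
    ext n
    have h : (Real.sqrt (w.toFun n) : ℂ) ≠ 0 := by
      exact_mod_cast (Real.sqrt_pos.2 (w.pos n)).ne'
    simp [h]

instance : NormedAddCommGroup (WSobolev w) :=
  NormedAddCommGroup.induced (WSobolev w) (lp (fun _ : ℤ => ℂ) 2) (WSobolev.toLp w)
    (WSobolev.toLp w).injective

instance : InnerProductSpace ℂ (WSobolev w) where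
  norm_smul_le c u := by
    change ‖WSobolev.toLp w (c • u)‖ ≤ ‖c‖ * ‖WSobolev.toLp w u‖
    rw [map_smul, norm_smul]
  inner u v := inner ℂ (WSobolev.toLp w u) (WSobolev.toLp w v)
  norm_sq_eq_re_inner u := InnerProductSpace.norm_sq_eq_re_inner (𝕜 := ℂ) (WSobolev.toLp w u)
  conj_inner_symm u v := InnerProductSpace.conj_inner_symm (𝕜 := ℂ) _ _
  add_left u v z := by
    simp only [map_add, inner_add_left]
  smul_left u v c := by
    simp only [map_smul, inner_smul_left]

theorem WSobolev.toLp_isometry : Isometry (WSobolev.toLp w) := fun _ _ => rfl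

instance : CompleteSpace (WSobolev w) :=
  ((completeSpace_congr (e := (WSobolev.toLp w).toEquiv)
    (WSobolev.toLp_isometry (w := w)).isUniformEmbedding)).2 inferInstance

theorem WSobolev.norm_sq_eq (u : WSobolev w) : ‖u‖ ^ 2 = ∑' n, w.toFun n * ‖u n‖ ^ 2 := by
  change ‖WSobolev.toLp w u‖ ^ 2 = _
  have := lp.norm_rpow_eq_tsum (p := 2) (by norm_num) (WSobolev.toLp w u)
  simp only [ENNReal.toReal_ofNat, Real.rpow_two] at this
  rw [this]
  refine tsum_congr fun n => ?_
  change ‖(Real.sqrt (w.toFun n) : ℂ) * u n‖ ^ 2 = _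
  rw [norm_mul, mul_pow, Complex.norm_real,
      Real.norm_of_nonneg (Real.sqrt_nonneg _), Real.sq_sqrt (w.pos n).le]

theorem WSobolev.norm_apply_le (u : WSobolev w) (n : ℤ) :
    Real.sqrt (w.toFun n) * ‖u n‖ ≤ ‖u‖ := by
  have := lp.norm_apply_le_norm (p := 2) (by norm_num) (WSobolev.toLp w u) n
  change ‖(Real.sqrt (w.toFun n) : ℂ) * u n‖ ≤ ‖u‖ at this
  rwa [norm_mul, Complex.norm_real, Real.norm_of_nonneg (Real.sqrt_nonneg _)] at this

theorem WSobolev.continuous_apply (n : ℤ) : Continuous fun u : WSobolev w => u n := by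
  have h := w.pos n
  refine LipschitzWith.continuous (K := ⟨(Real.sqrt (w.toFun n))⁻¹, by positivity⟩)
    (LipschitzWith.of_dist_le_mul fun u v => ?_)
  rw [dist_eq_norm, dist_eq_norm, ← WSobolev.sub_apply]
  change _ ≤ (Real.sqrt (w.toFun n))⁻¹ * _
  rw [le_inv_mul_iff₀ (Real.sqrt_pos.2 h)]
  exact WSobolev.norm_apply_le _ _

/-! ### The product estimate -/

theorem tsum_mul_sq_le {ι : Type*} (f g : ι → ℝ≥0∞) :
    (∑' i, f i * g i) ^ 2 ≤ (∑' i, f i ^ 2) * ∑' i, g i ^ 2 := by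
  let _ : MeasurableSpace ι := ⊤
  have h := ENNReal.lintegral_mul_le_Lp_mul_Lq (MeasureTheory.Measure.count : MeasureTheory.Measure ι)
    Real.HolderConjugate.two_two (f := f) (g := g) (measurable_from_top.aemeasurable)
    (measurable_from_top.aemeasurable)
  simp only [MeasureTheory.lintegral_count, Pi.mul_apply, ENNReal.rpow_two] at h
  calc _ ≤ _ := pow_le_pow_left' h 2
    _ = _ := by
      rw [mul_pow]
      simp only [← ENNReal.rpow_two, ← ENNReal.rpow_mul]
      norm_num

theorem add_sq_le_four (a b : ℝ≥0∞) : (a + b) ^ 2 ≤ 4 * (a ^ 2 + b ^ 2) := by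
  wlog h : a ≤ b generalizing a b
  · rw [add_comm a b, add_comm (a ^ 2)]
    exact this b a (le_of_not_ge h)
  calc (a + b) ^ 2 ≤ (b + b) ^ 2 := by gcongr
    _ = 4 * b ^ 2 := by ring
    _ ≤ _ := by gcongr; exact le_add_self

/-- `⟨n⟩` as an extended nonnegative number. -/
def eb (n : ℤ) : ℝ≥0∞ := ENNReal.ofReal (bracket n)

/-- `⟨n⟩ ^ (1/2)` as an extended nonnegative number. -/
def es (n : ℤ) : ℝ≥0∞ := ENNReal.ofReal (Real.sqrt (bracket n))

/-- `log (⟨n⟩ + 1)` as an extended nonnegative number. -/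
def el (n : ℤ) : ℝ≥0∞ := ENNReal.ofReal (Real.log (bracket n + 1))

theorem eb_ne_zero (n : ℤ) : eb n ≠ 0 := (ENNReal.ofReal_pos.2 (bracket_pos n)).ne'
theorem eb_ne_top (n : ℤ) : eb n ≠ ⊤ := ENNReal.ofReal_ne_top
theorem el_ne_zero (n : ℤ) : el n ≠ 0 := (ENNReal.ofReal_pos.2 (log_bracket_pos n)).ne'
theorem el_ne_top (n : ℤ) : el n ≠ ⊤ := ENNReal.ofReal_ne_top
theorem es_ne_zero (n : ℤ) : es n ≠ 0 :=
  (ENNReal.ofReal_pos.2 (Real.sqrt_pos.2 (bracket_pos n))).ne'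
theorem es_ne_top (n : ℤ) : es n ≠ ⊤ := ENNReal.ofReal_ne_top

theorem es_sq (n : ℤ) : es n ^ 2 = eb n := by
  rw [es, eb, ← ENNReal.ofReal_pow (Real.sqrt_nonneg _), Real.sq_sqrt (bracket_pos n).le]

theorem bracket_neg (n : ℤ) : bracket (-n) = bracket n := by simp [bracket]

theorem eb_neg (n : ℤ) : eb (-n) = eb n := by simp [eb, bracket_neg]

theorem bracket_add_le (m n : ℤ) : bracket (m + n) ≤ bracket m + bracket n := by
  refine max_le ?_ ?_
  · linarith [one_le_bracket m, one_le_bracket n]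
  · push_cast
    exact (abs_add_le _ _).trans (add_le_add (le_max_right _ _) (le_max_right _ _))

theorem es_le (m j : ℤ) : es m ≤ es (m - j) + es j := by
  rw [es, es, es, ← ENNReal.ofReal_add (Real.sqrt_nonneg _) (Real.sqrt_nonneg _)]
  refine ENNReal.ofReal_le_ofReal ?_
  have h := bracket_add_le (m - j) j
  rw [sub_add_cancel] at h
  exact (Real.sqrt_le_sqrt h).trans (Real.sqrt_le_iff.2 ⟨by positivity, by
    nlinarith [Real.sq_sqrt (bracket_pos (m - j)).le, Real.sq_sqrt (bracket_pos j).le,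
      mul_nonneg (Real.sqrt_nonneg (bracket (m - j))) (Real.sqrt_nonneg (bracket j))]⟩)

theorem sum_inv_bracket_le (N : ℕ) :
    ∑ j ∈ Finset.Icc (-(N : ℤ)) N, (bracket j)⁻¹ ≤ 1 + 2 * (harmonic N : ℝ) := by
  induction N with
  | zero => simp [bracket]
  | succ N ih =>
    have hsub : Finset.Icc (-((N + 1 : ℕ) : ℤ)) ((N + 1 : ℕ) : ℤ) ⊆
        insert ((N : ℤ) + 1) (insert (-((N : ℤ) + 1)) (Finset.Icc (-(N : ℤ)) N)) := by
      intro j hj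
      simp only [Finset.mem_insert, Finset.mem_Icc] at hj ⊢
      push_cast at hj
      omega
    have h1 : bracket ((N : ℤ) + 1) = N + 1 := by
      rw [bracket]
      push_cast
      rw [abs_of_nonneg (by positivity), max_eq_right]
      linarith [(Nat.cast_nonneg N : (0 : ℝ) ≤ N)]
    refine (Finset.sum_le_sum_of_subset_of_nonneg hsub
      fun j _ _ => (inv_pos.2 (bracket_pos j)).le).trans ?_
    rw [Finset.sum_insert (by simp; omega), Finset.sum_insert (by simp), bracket_neg, h1,
      harmonic_succ]
    push_cast
    linarith

theorem tsum_inv_eb_le (m : ℤ) :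
    ∑' j, (if bracket j ≤ bracket m ^ 2 then (eb j)⁻¹ else 0) ≤ 9 * el m := by
  set N : ℕ := (max 1 m.natAbs) ^ 2 with hN
  have hbm : bracket m = ((max 1 m.natAbs : ℕ) : ℝ) := by
    rw [bracket]
    push_cast
    rw [Nat.cast_natAbs, Int.cast_abs]
  have hbN : bracket m ^ 2 = (N : ℝ) := by rw [hbm, hN]; push_cast; rfl
  have hz : ∀ j ∉ Finset.Icc (-(N : ℤ)) N,
      (if bracket j ≤ bracket m ^ 2 then (eb j)⁻¹ else 0) = 0 := by
    intro j hj
    refine if_neg fun h => hj ?_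
    rw [hbN] at h
    have h2 : |(j : ℝ)| ≤ N := (le_max_right _ _).trans h
    rw [Finset.mem_Icc, ← abs_le]
    exact_mod_cast h2
  rw [tsum_eq_sum hz]
  calc _ ≤ ∑ j ∈ Finset.Icc (-(N : ℤ)) N, ENNReal.ofReal (bracket j)⁻¹ := by
        refine Finset.sum_le_sum fun j _ => ?_
        rw [ENNReal.ofReal_inv_of_pos (bracket_pos j)]
        split_ifs
        · exact le_rfl
        · exact zero_le
    _ = ENNReal.ofReal (∑ j ∈ Finset.Icc (-(N : ℤ)) N, (bracket j)⁻¹) :=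
        (ENNReal.ofReal_sum_of_nonneg fun j _ => (inv_pos.2 (bracket_pos j)).le).symm
    _ ≤ ENNReal.ofReal (9 * Real.log (bracket m + 1)) := by
        refine ENNReal.ofReal_le_ofReal ((sum_inv_bracket_le N).trans ?_)
        have h1 := harmonic_le_one_add_log N
        rw [← hbN, Real.log_pow] at h1
        have h2 : Real.log (bracket m) ≤ Real.log (bracket m + 1) :=
          Real.log_le_log (bracket_pos m) (by linarith)
        have h3 : Real.log 2 ≤ Real.log (bracket m + 1) :=
          Real.log_le_log (by norm_num) (by linarith [one_le_bracket m])
        have h4 := Real.log_two_gt_d9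
        push_cast at h1
        linarith
    _ = 9 * el m := by
        rw [ENNReal.ofReal_mul (by norm_num), el]
        norm_num

theorem summable_inv_bracket_sq : Summable fun n : ℤ => (bracket n ^ 2)⁻¹ := by
  have h : Summable fun n : ℤ => 1 / |(n : ℝ)| ^ (2 : ℝ) :=
    Real.summable_one_div_int_add_rpow 0 2 |>.2 (by norm_num) |>.congr (by simp)
  refine (((summable_of_hasFiniteSupport (f := fun n : ℤ => if n = 0 then (1 : ℝ) else 0)
    ((Set.finite_singleton 0).subset (by intro n; simp))).add h)).of_nonneg_of_le
    (fun n => by have := bracket_pos n; positivity) fun n => ?_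
  rcases eq_or_ne n 0 with rfl | hn
  · simp [bracket]
  · have h1 : (1 : ℝ) ≤ |(n : ℝ)| := by exact_mod_cast Int.one_le_abs hn
    simp only [hn, if_false, zero_add, bracket, max_eq_right h1, Real.rpow_two, one_div, le_refl]

theorem exists_tsum_el_inv_le : ∃ K : ℝ≥0∞, K ≠ ⊤ ∧
    ∑' m, (el m)⁻¹ * ((eb m) ^ 2)⁻¹ ≤ K := by
  refine ⟨∑' m, 2 * ENNReal.ofReal ((bracket m ^ 2)⁻¹), ?_, ?_⟩
  · rw [ENNReal.tsum_mul_left]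
    exact ENNReal.mul_ne_top (by norm_num) summable_inv_bracket_sq.tsum_ofReal_ne_top
  · refine ENNReal.tsum_le_tsum fun m => ?_
    rw [ENNReal.ofReal_inv_of_pos (by have := bracket_pos m; positivity),
      ENNReal.ofReal_pow (bracket_pos m).le, ← eb]
    gcongr
    rw [el, ← ENNReal.ofReal_inv_of_pos (log_bracket_pos m)]
    refine ENNReal.ofReal_le_of_le_toReal ?_
    have h3 : Real.log 2 ≤ Real.log (bracket m + 1) :=
      Real.log_le_log (by norm_num) (by linarith [one_le_bracket m])
    have h4 := Real.log_two_gt_d9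
    rw [ENNReal.toReal_ofNat, inv_le_comm₀ (log_bracket_pos m) (by norm_num)]
    linarith

theorem exists_conv_sq_le : ∃ K : ℝ≥0∞, K ≠ ⊤ ∧ ∀ A W : ℤ → ℝ≥0∞,
    ∑' m, (el m)⁻¹ * (∑' j, A (m - j) * W j) ^ 2 ≤
      K * (∑' j, A j ^ 2) * ∑' j, eb j * W j ^ 2 := by
  obtain ⟨K, hK, hKle⟩ := exists_tsum_el_inv_le
  refine ⟨4 * (9 + K), ENNReal.mul_ne_top (by norm_num) (by simp [hK]), fun A W => ?_⟩
  set a := ∑' j, A j ^ 2 with ha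
  set b := ∑' j, eb j * W j ^ 2 with hb
  have hshift : ∀ m : ℤ, ∑' j, A (m - j) ^ 2 = a := fun m =>
    (Equiv.subLeft m).tsum_eq fun j => A j ^ 2
  have key : ∀ m, (el m)⁻¹ * (∑' j, A (m - j) * W j) ^ 2 ≤
      4 * (9 * (∑' j, A (m - j) ^ 2 * (eb j * W j ^ 2)) +
        (el m)⁻¹ * ((eb m) ^ 2)⁻¹ * (a * b)) := by
    intro m
    have h1 : (∑' j, A (m - j) * W j) =
        (∑' j, (A (m - j) * (es j * W j)) *
          (if bracket j ≤ bracket m ^ 2 then (es j)⁻¹ else 0)) +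
        ∑' j, A (m - j) * (if bracket j ≤ bracket m ^ 2 then 0 else W j) := by
      rw [← ENNReal.tsum_add]
      refine tsum_congr fun j => ?_
      split_ifs
      · rw [mul_zero, add_zero]
        calc A (m - j) * W j = A (m - j) * W j * (es j * (es j)⁻¹) := by
              rw [ENNReal.mul_inv_cancel (es_ne_zero j) (es_ne_top j), mul_one]
          _ = _ := by ring
      · simp
    have h2 : (∑' j, (A (m - j) * (es j * W j)) *
          (if bracket j ≤ bracket m ^ 2 then (es j)⁻¹ else 0)) ^ 2 ≤
        (∑' j, A (m - j) ^ 2 * (eb j * W j ^ 2)) * (9 * el m) := by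
      refine (tsum_mul_sq_le _ _).trans ?_
      refine mul_le_mul' (le_of_eq (tsum_congr fun j => ?_)) (le_trans (le_of_eq
        (tsum_congr fun j => ?_)) (tsum_inv_eb_le m))
      · rw [mul_pow, mul_pow, es_sq]
      · split_ifs
        · rw [← ENNReal.inv_pow, es_sq]
        · simp
    have h3 : (∑' j, A (m - j) * (if bracket j ≤ bracket m ^ 2 then 0 else W j)) ^ 2 ≤
        a * (((eb m) ^ 2)⁻¹ * b) := by
      refine (tsum_mul_sq_le _ _).trans ?_
      refine mul_le_mul' (hshift m).le ?_
      rw [hb, ← ENNReal.tsum_mul_left]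
      refine ENNReal.tsum_le_tsum fun j => ?_
      split_ifs with h
      · simp
      · rw [← mul_assoc]
        refine le_mul_of_one_le_left' ?_
        have h4 : eb m ^ 2 ≤ eb j := by
          rw [eb, eb, ← ENNReal.ofReal_pow (bracket_pos m).le]
          exact ENNReal.ofReal_le_ofReal (not_le.1 h).le
        calc (1 : ℝ≥0∞) = (eb m ^ 2)⁻¹ * eb m ^ 2 :=
              (ENNReal.inv_mul_cancel (pow_ne_zero _ (eb_ne_zero m))
                (ENNReal.pow_ne_top (eb_ne_top m))).symm
          _ ≤ _ := by gcongr
    rw [h1]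
    calc _ ≤ (el m)⁻¹ * (4 * ((∑' j, A (m - j) ^ 2 * (eb j * W j ^ 2)) * (9 * el m) +
            a * (((eb m) ^ 2)⁻¹ * b))) := by
          gcongr
          exact (add_sq_le_four _ _).trans (by gcongr)
      _ = 4 * (9 * (∑' j, A (m - j) ^ 2 * (eb j * W j ^ 2)) * ((el m)⁻¹ * el m) +
            (el m)⁻¹ * ((eb m) ^ 2)⁻¹ * (a * b)) := by ring
      _ = _ := by rw [ENNReal.inv_mul_cancel (el_ne_zero m) (el_ne_top m), mul_one]
  refine (ENNReal.tsum_le_tsum key).trans ?_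
  rw [ENNReal.tsum_mul_left, ENNReal.tsum_add, ENNReal.tsum_mul_left, ENNReal.tsum_mul_right,
    ENNReal.tsum_comm]
  have h5 : ∑' j, ∑' m, A (m - j) ^ 2 * (eb j * W j ^ 2) = a * b := by
    rw [hb, ← ENNReal.tsum_mul_left]
    refine tsum_congr fun j => ?_
    rw [ENNReal.tsum_mul_right]
    congr 1
    exact (Equiv.subRight j).tsum_eq fun j => A j ^ 2
  rw [h5]
  calc _ ≤ 4 * (9 * (a * b) + K * (a * b)) := by gcongr
    _ = _ := by ring

theorem exists_conv_half_le : ∃ K : ℝ≥0∞, K ≠ ⊤ ∧ ∀ V W : ℤ → ℝ≥0∞,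
    ∑' m, eb m * (el m)⁻¹ * (∑' j, V (m - j) * W j) ^ 2 ≤
      K * (∑' j, eb j * V j ^ 2) * ∑' j, eb j * W j ^ 2 := by
  obtain ⟨K, hK, hKle⟩ := exists_conv_sq_le
  refine ⟨8 * K, ENNReal.mul_ne_top (by norm_num) hK, fun V W => ?_⟩
  have hsq : ∀ V : ℤ → ℝ≥0∞, ∑' j, (es j * V j) ^ 2 = ∑' j, eb j * V j ^ 2 := fun V =>
    tsum_congr fun j => by rw [mul_pow, es_sq]
  have key : ∀ m, eb m * (el m)⁻¹ * (∑' j, V (m - j) * W j) ^ 2 ≤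
      4 * ((el m)⁻¹ * (∑' j, (es (m - j) * V (m - j)) * W j) ^ 2 +
        (el m)⁻¹ * (∑' j, (es (m - j) * W (m - j)) * V j) ^ 2) := by
    intro m
    have h1 : ∑' j, (es (m - j) * W (m - j)) * V j = ∑' j, V (m - j) * (es j * W j) := by
      rw [← (Equiv.subLeft m).tsum_eq]
      refine tsum_congr fun j => ?_
      simp only [Equiv.subLeft_apply, sub_sub_cancel]
      ring
    have h2 : es m * (∑' j, V (m - j) * W j) ≤
        (∑' j, (es (m - j) * V (m - j)) * W j) + ∑' j, V (m - j) * (es j * W j) := by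
      rw [← ENNReal.tsum_mul_left, ← ENNReal.tsum_add]
      refine ENNReal.tsum_le_tsum fun j => ?_
      calc _ ≤ (es (m - j) + es j) * (V (m - j) * W j) := by gcongr; exact es_le m j
        _ = _ := by ring
    rw [h1]
    calc _ = (el m)⁻¹ * (es m * (∑' j, V (m - j) * W j)) ^ 2 := by rw [mul_pow, es_sq]; ring
      _ ≤ (el m)⁻¹ * (4 * (_ ^ 2 + _ ^ 2)) := by
        gcongr
        exact (pow_le_pow_left' h2 2).trans (add_sq_le_four _ _)
      _ = _ := by ring
  refine (ENNReal.tsum_le_tsum key).trans ?_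
  rw [ENNReal.tsum_mul_left, ENNReal.tsum_add]
  have h1 := hKle (fun j => es j * V j) W
  have h2 := hKle (fun j => es j * W j) V
  rw [hsq] at h1 h2
  calc _ ≤ 4 * (K * (∑' j, eb j * V j ^ 2) * (∑' j, eb j * W j ^ 2) +
        K * (∑' j, eb j * W j ^ 2) * ∑' j, eb j * V j ^ 2) := by gcongr
    _ = _ := by ring

/-- Pairing estimate for the product. -/
theorem exists_pairing_le : ∃ K : ℝ≥0∞, K ≠ ⊤ ∧ ∀ U V W : ℤ → ℝ≥0∞,
    (∑' n, (∑' k, U (n - k) * V k) * W n) ^ 2 ≤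
      K * (∑' j, (eb j)⁻¹ * el j * U j ^ 2) * (∑' j, eb j * V j ^ 2) *
        ∑' j, eb j * W j ^ 2 := by
  obtain ⟨K, hK, hKle⟩ := exists_conv_half_le
  refine ⟨K, hK, fun U V W => ?_⟩
  have h1 : (∑' n, (∑' k, U (n - k) * V k) * W n) =
      ∑' m, U m * ∑' j, V (-(m - j)) * W j := by
    have h2 : ∀ n, (∑' k, U (n - k) * V k) = ∑' m, U m * V (n - m) := fun n => by
      rw [← (Equiv.subLeft n).tsum_eq]
      simp only [Equiv.subLeft_apply, sub_sub_cancel]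
    simp only [h2, ← ENNReal.tsum_mul_right, ← ENNReal.tsum_mul_left]
    rw [ENNReal.tsum_comm]
    refine tsum_congr fun m => tsum_congr fun j => ?_
    rw [neg_sub, mul_assoc]
  have hr : ∀ x : ℝ≥0∞, x ≠ 0 → x ≠ ⊤ → x ^ (1/2 : ℝ) * (x⁻¹) ^ (1/2 : ℝ) = 1 := by
    intro x h0 ht
    rw [← ENNReal.mul_rpow_of_nonneg _ _ (by norm_num), ENNReal.mul_inv_cancel h0 ht,
      ENNReal.one_rpow]
  have hr2 : ∀ x : ℝ≥0∞, (x ^ (1/2 : ℝ)) ^ 2 = x := by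
    intro x
    rw [← ENNReal.rpow_two, ← ENNReal.rpow_mul]
    norm_num
  have h3 : (∑' m, U m * ∑' j, V (-(m - j)) * W j) =
      ∑' m, (((eb m)⁻¹ * el m) ^ (1/2 : ℝ) * U m) *
        ((eb m * (el m)⁻¹) ^ (1/2 : ℝ) * ∑' j, V (-(m - j)) * W j) := by
    refine tsum_congr fun m => ?_
    have h4 : ((eb m)⁻¹ * el m) ^ (1/2 : ℝ) * (eb m * (el m)⁻¹) ^ (1/2 : ℝ) = 1 := by
      have := hr ((eb m)⁻¹ * el m)
        (mul_ne_zero (ENNReal.inv_ne_zero.2 (eb_ne_top m)) (el_ne_zero m))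
        (ENNReal.mul_ne_top (ENNReal.inv_ne_top.2 (eb_ne_zero m)) (el_ne_top m))
      rwa [ENNReal.mul_inv (Or.inr (el_ne_top m)) (Or.inr (el_ne_zero m)), inv_inv] at this
    calc _ = (1 : ℝ≥0∞) * (U m * ∑' j, V (-(m - j)) * W j) := (one_mul _).symm
      _ = _ := by rw [← h4]; ring
  rw [h1, h3]
  refine (tsum_mul_sq_le _ _).trans ?_
  simp only [mul_pow, hr2]
  have h5 := hKle (fun j => V (-j)) W
  have h6 : ∑' j, eb j * V (-j) ^ 2 = ∑' j, eb j * V j ^ 2 := by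
    rw [← (Equiv.neg ℤ).tsum_eq fun j => eb j * V j ^ 2]
    simp [eb_neg]
  rw [h6] at h5
  calc _ ≤ _ := mul_le_mul_right h5 _
    _ = _ := by ring

/-- The product estimate `‖u v‖_{-1/2} ≤ K ‖u‖_{-1/2,√log} ‖v‖_{1/2}` for nonnegative
coefficients. -/
theorem exists_product_le : ∃ K : ℝ≥0∞, K ≠ ⊤ ∧ ∀ U V : ℤ → ℝ≥0∞,
    (∑' j, (eb j)⁻¹ * el j * U j ^ 2) ≠ ⊤ → (∑' j, eb j * V j ^ 2) ≠ ⊤ →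
    ∑' n, (eb n)⁻¹ * (∑' k, U (n - k) * V k) ^ 2 ≤
      K * (∑' j, (eb j)⁻¹ * el j * U j ^ 2) * ∑' j, eb j * V j ^ 2 := by
  obtain ⟨K, hK, hKle⟩ := exists_pairing_le
  refine ⟨K, hK, fun U V hU hV => ?_⟩
  set P : ℤ → ℝ≥0∞ := fun n => ∑' k, U (n - k) * V k with hP
  set B := K * (∑' j, (eb j)⁻¹ * el j * U j ^ 2) * ∑' j, eb j * V j ^ 2 with hB
  have hBtop : B ≠ ⊤ := ENNReal.mul_ne_top (ENNReal.mul_ne_top hK hU) hV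
  have hPtop : ∀ n, P n ≠ ⊤ := by
    intro n hn
    have h := hKle U V (Pi.single n 1)
    have e1 : ∑' j, eb j * (Pi.single n 1 : ℤ → ℝ≥0∞) j ^ 2 = eb n := by
      rw [tsum_eq_single n (fun j hj => by simp [hj])]
      simp
    rw [tsum_eq_single n (fun j hj => by simp [hj]), e1, Pi.single_eq_same, mul_one,
      show ∑' k, U (n - k) * V k = ⊤ from hn] at h
    exact (ENNReal.mul_ne_top hBtop (eb_ne_top n)) (by simpa using h)
  rw [ENNReal.tsum_eq_iSup_sum]
  refine iSup_le fun F => ?_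
  set X := ∑ n ∈ F, (eb n)⁻¹ * P n ^ 2 with hX
  have hXtop : X ≠ ⊤ := (ENNReal.sum_lt_top.2 fun n _ => (ENNReal.mul_ne_top
    (ENNReal.inv_ne_top.2 (eb_ne_zero n)) (ENNReal.pow_ne_top (hPtop n))).lt_top).ne
  have h := hKle U V (fun n => if n ∈ F then (eb n)⁻¹ * P n else 0)
  have e1 : ∑ n ∈ F, (∑' k, U (n - k) * V k) * (if n ∈ F then (eb n)⁻¹ * P n else 0) = X :=
    Finset.sum_congr rfl fun n hn => by
      rw [if_pos hn]
      change P n * _ = _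
      ring
  have e2 : ∑' n, eb n * (if n ∈ F then (eb n)⁻¹ * P n else 0) ^ 2 = X := by
    rw [tsum_eq_sum (s := F) (fun j hj => by simp [hj])]
    exact Finset.sum_congr rfl fun n hn => by
      rw [if_pos hn]
      calc _ = (eb n * (eb n)⁻¹) * ((eb n)⁻¹ * P n ^ 2) := by ring
        _ = _ := by rw [ENNReal.mul_inv_cancel (eb_ne_zero n) (eb_ne_top n), one_mul]
  rw [tsum_eq_sum (s := F) (fun j hj => by simp [hj]), e1, e2] at h
  rcases eq_or_ne X 0 with h0 | h0
  · rw [h0]; exact zero_le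
  · rw [sq] at h
    exact (ENNReal.mul_le_mul_iff_left h0 hXtop).1 h

/-! ### Embeddings, product, Szegő projector and Toeplitz operators -/

/-- The Sobolev space `H^β_c`. -/
abbrev Sobolev (β : ℝ) : Type := WSobolev (sobolevWeight β)

/-- The space `H^{β,√log}_c`. (Since `log (⟨n⟩ + 1) ≥ log 2 > 0`, the membership in `H^β_c` is
automatic.) -/
abbrev SobolevLog (β : ℝ) : Type := WSobolev (sobolevLogWeight β)

/-- The inclusion of weighted spaces, for `w' ≤ w`. -/
def inclusion {w w' : FourierWeight} (h : ∀ n, w'.toFun n ≤ w.toFun n) :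
    WSobolev w →ₗ[ℂ] WSobolev w' where
  toFun u := WSobolev.mk u (u.summable.of_nonneg_of_le
    (fun n => mul_nonneg (w'.pos n).le (sq_nonneg _))
    fun n => mul_le_mul_of_nonneg_right (h n) (sq_nonneg _))
  map_add' _ _ := rfl
  map_smul' _ _ := rfl

theorem sobolevWeight_mono {β β' : ℝ} (h : β' ≤ β) (n : ℤ) :
    (sobolevWeight β').toFun n ≤ (sobolevWeight β).toFun n :=
  Real.rpow_le_rpow_of_exponent_le (one_le_bracket n) (by linarith)

theorem sobolevWeight_half (n : ℤ) : (sobolevWeight (1 / 2)).toFun n = bracket n := by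
  simp [sobolevWeight]

theorem sobolevWeight_neg_half (n : ℤ) : (sobolevWeight (-1 / 2)).toFun n = (bracket n)⁻¹ := by
  simp only [sobolevWeight]
  rw [show (2 : ℝ) * (-1 / 2) = -1 by norm_num, Real.rpow_neg_one]

theorem sobolevLogWeight_le (n : ℤ) :
    (sobolevLogWeight (-1 / 2)).toFun n ≤ (sobolevWeight 0).toFun n := by
  have h := bracket_pos n
  have h1 := Real.log_le_sub_one_of_pos (show 0 < bracket n + 1 by linarith)
  simp only [sobolevLogWeight, sobolevWeight, mul_zero, Real.rpow_zero]
  rw [show (2 : ℝ) * (-1 / 2) = -1 by norm_num, Real.rpow_neg_one, inv_mul_le_iff₀ h]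
  linarith

/-- The inclusion `L²_c ⊆ H^{-1/2,√log}_c`. -/
def l2ToLog : Sobolev 0 →ₗ[ℂ] SobolevLog (-1 / 2) := inclusion sobolevLogWeight_le

/-- The Fourier coefficients of the product `u v`; for `u ∈ H^{-1/2,√log}_c` and
`v ∈ H^{1/2}_c` the series converges absolutely. -/
def mulCoeff (u v : ℤ → ℂ) (n : ℤ) : ℂ := ∑' k, u (n - k) * v k

theorem tsum_enorm_sq (u : WSobolev w) :
    ∑' n, ENNReal.ofReal (w.toFun n) * ‖u n‖ₑ ^ 2 = ENNReal.ofReal (‖u‖ ^ 2) := by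
  rw [WSobolev.norm_sq_eq, ENNReal.ofReal_tsum_of_nonneg
    (fun n => mul_nonneg (w.pos n).le (sq_nonneg _)) u.summable]
  refine tsum_congr fun n => ?_
  rw [ENNReal.ofReal_mul (w.pos n).le, ENNReal.ofReal_pow (norm_nonneg _), ofReal_norm]

theorem ofReal_weight_half (n : ℤ) :
    ENNReal.ofReal ((sobolevWeight (1 / 2)).toFun n) = eb n := by
  simp [sobolevWeight, eb]

theorem ofReal_weight_neg_half (n : ℤ) :
    ENNReal.ofReal ((sobolevWeight (-1 / 2)).toFun n) = (eb n)⁻¹ := by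
  simp only [sobolevWeight]
  rw [show (2 : ℝ) * (-1 / 2) = -1 by norm_num, Real.rpow_neg_one,
    ENNReal.ofReal_inv_of_pos (bracket_pos n), eb]

theorem ofReal_weight_log (n : ℤ) :
    ENNReal.ofReal ((sobolevLogWeight (-1 / 2)).toFun n) = (eb n)⁻¹ * el n := by
  rw [← ofReal_weight_neg_half, el,
    ← ENNReal.ofReal_mul ((sobolevWeight (-1 / 2)).pos n).le]
  rfl

theorem exists_mulCoeff_le : ∃ K : ℝ, 0 < K ∧
    ∀ (u : SobolevLog (-1 / 2)) (v : Sobolev (1 / 2)),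
      (∀ n, Summable fun k => u (n - k) * v k) ∧
      ∑' n, ENNReal.ofReal ((sobolevWeight (-1 / 2)).toFun n) * ‖mulCoeff u v n‖ₑ ^ 2 ≤
        ENNReal.ofReal ((K * ‖u‖ * ‖v‖) ^ 2) := by
  obtain ⟨K, hK, hKle⟩ := exists_product_le
  refine ⟨Real.sqrt (K.toReal + 1), Real.sqrt_pos.2 (by positivity), fun u v => ?_⟩
  have hu : ∑' j, (eb j)⁻¹ * el j * ‖u j‖ₑ ^ 2 = ENNReal.ofReal (‖u‖ ^ 2) := by
    simp only [← ofReal_weight_log, tsum_enorm_sq]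
  have hv : ∑' j, eb j * ‖v j‖ₑ ^ 2 = ENNReal.ofReal (‖v‖ ^ 2) := by
    simp only [← ofReal_weight_half, tsum_enorm_sq]
  have h := hKle (fun n => ‖u n‖ₑ) (fun n => ‖v n‖ₑ) (by rw [hu]; exact ENNReal.ofReal_ne_top)
    (by rw [hv]; exact ENNReal.ofReal_ne_top)
  rw [hu, hv] at h
  have hsum : ∀ n, Summable fun k => u (n - k) * v k := by
    intro n
    have h1 : (∑' k, ‖u (n - k)‖ₑ * ‖v k‖ₑ) ≠ ⊤ := by
      intro h2
      have h3 := (ENNReal.le_tsum n).trans h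
      rw [h2] at h3
      refine ENNReal.mul_ne_top (ENNReal.mul_ne_top hK ENNReal.ofReal_ne_top)
        ENNReal.ofReal_ne_top (top_le_iff.1 (le_trans ?_ h3))
      rw [ENNReal.top_pow (by norm_num), ENNReal.mul_top (ENNReal.inv_ne_zero.2 (eb_ne_top n))]
    refine Summable.of_norm ?_
    have h4 := ENNReal.summable_toReal h1
    refine h4.congr fun k => ?_
    rw [ENNReal.toReal_mul, toReal_enorm, toReal_enorm, norm_mul]
  refine ⟨hsum, ?_⟩
  calc _ ≤ ∑' n, (eb n)⁻¹ * (∑' k, ‖u (n - k)‖ₑ * ‖v k‖ₑ) ^ 2 := by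
        refine ENNReal.tsum_le_tsum fun n => ?_
        rw [ofReal_weight_neg_half]
        gcongr
        refine (enorm_tsum_le_tsum_enorm).trans (le_of_eq (tsum_congr fun k => ?_))
        rw [enorm_mul]
    _ ≤ _ := h
    _ ≤ _ := by
        rw [mul_pow, mul_pow, Real.sq_sqrt (by positivity),
          ENNReal.ofReal_mul (by positivity), ENNReal.ofReal_mul (by positivity)]
        gcongr
        exact (ENNReal.ofReal_toReal hK).symm.le.trans (ENNReal.ofReal_le_ofReal (by linarith))

theorem summable_of_tsum_enorm_ne_top {a : ℤ → ℂ}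
    (h : ∑' n, ENNReal.ofReal (w.toFun n) * ‖a n‖ₑ ^ 2 ≠ ⊤) :
    Summable fun n => w.toFun n * ‖a n‖ ^ 2 := by
  refine (ENNReal.summable_toReal h).congr fun n => ?_
  rw [ENNReal.toReal_mul, ENNReal.toReal_ofReal (w.pos n).le, ENNReal.toReal_pow, toReal_enorm]

/-- The pointwise product `v ↦ u v`, as a map from `H^{1/2}_c` to `H^{-1/2}_c`, for
`u ∈ H^{-1/2,√log}_c`. -/
def mulOp (u : SobolevLog (-1 / 2)) : Sobolev (1 / 2) →ₗ[ℂ] Sobolev (-1 / 2) where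
  toFun v := WSobolev.mk (mulCoeff u v) (by
    obtain ⟨K, _, hK⟩ := exists_mulCoeff_le
    exact summable_of_tsum_enorm_ne_top (ne_top_of_le_ne_top ENNReal.ofReal_ne_top (hK u v).2))
  map_add' v v' := by
    obtain ⟨K, _, hK⟩ := exists_mulCoeff_le
    ext n
    simp only [WSobolev.mk_apply, WSobolev.add_apply, mulCoeff, mul_add]
    exact ((hK u v).1 n).tsum_add ((hK u v').1 n)
  map_smul' c v := by
    ext n
    simp only [WSobolev.mk_apply, WSobolev.smul_apply, mulCoeff, RingHom.id_apply,
      mul_left_comm _ c, tsum_mul_left]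

@[simp] theorem mulOp_apply (u : SobolevLog (-1 / 2)) (v : Sobolev (1 / 2)) (n : ℤ) :
    mulOp u v n = ∑' k, u (n - k) * v k := rfl

/-- `K` is a constant for the product estimate
`‖u v‖_{-1/2} ≤ K ‖u‖_{-1/2,√log} ‖v‖_{1/2}`. -/
def IsProductConstant (K : ℝ) : Prop :=
  0 < K ∧ ∀ (u : SobolevLog (-1 / 2)) (v : Sobolev (1 / 2)), ‖mulOp u v‖ ≤ K * ‖u‖ * ‖v‖

theorem exists_isProductConstant : ∃ K, IsProductConstant K := by
  obtain ⟨K, hK0, hK⟩ := exists_mulCoeff_le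
  refine ⟨K, hK0, fun u v => ?_⟩
  have h := (hK u v).2
  have h1 := tsum_enorm_sq (mulOp u v)
  change ∑' n, ENNReal.ofReal ((sobolevWeight (-1 / 2)).toFun n) * ‖mulCoeff u v n‖ₑ ^ 2 = _ at h1
  rw [h1, ENNReal.ofReal_le_ofReal_iff (by positivity)] at h
  exact (abs_le_of_sq_le_sq' h (by positivity)).2

/-- The Hardy space `H^β_+`, as a subspace of `H^β_c`. -/
def hardySubmodule (β : ℝ) : Submodule ℂ (Sobolev β) where
  carrier := {f | ∀ n < 0, f n = 0}
  zero_mem' _ _ := rfl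
  add_mem' {f g} hf hg n hn := by rw [WSobolev.add_apply, hf n hn, hg n hn, add_zero]
  smul_mem' c f hf n hn := by rw [WSobolev.smul_apply, hf n hn, mul_zero]

/-- The Hardy space `H^β_+`; `Hardy 0` is the Hilbert space `L²_+`. -/
abbrev Hardy (β : ℝ) : Type := hardySubmodule β

instance (β : ℝ) : CompleteSpace (Hardy β) := by
  refine IsClosed.completeSpace_coe (hs := ?_)
  have h : ((hardySubmodule β : Submodule ℂ (Sobolev β)) : Set (Sobolev β)) =
      ⋂ n : ℤ, ⋂ _ : n < 0, {f | f n = 0} := by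
    ext f
    simp only [Set.mem_iInter]
    rfl
  rw [h]
  exact isClosed_iInter fun n => isClosed_iInter fun _ =>
    isClosed_eq (WSobolev.continuous_apply n) continuous_const

/-- The inclusion `H^β_+ ⊆ H^β'_+` for `β' ≤ β`. -/
def hardyInclusion {β β' : ℝ} (h : β' ≤ β) : Hardy β →ₗ[ℂ] Hardy β' where
  toFun f := ⟨inclusion (sobolevWeight_mono h) f.1, fun n hn => f.2 n hn⟩
  map_add' _ _ := rfl
  map_smul' _ _ := rfl

theorem hardyInclusion_injective {β β' : ℝ} (h : β' ≤ β) :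
    Function.Injective (hardyInclusion h) := by
  intro f g hfg
  refine Subtype.ext (WSobolev.ext fun n => ?_)
  exact congrArg (fun F : Hardy β' => F.1 n) hfg

/-- The inclusion `H^{1/2}_+ ⊆ L²_+`. -/
def halfToL2 : Hardy (1 / 2) →ₗ[ℂ] Hardy 0 := hardyInclusion (by norm_num)

/-- The inclusion `L²_+ ⊆ H^{-1/2}_+`. -/
def l2ToNegHalf : Hardy 0 →ₗ[ℂ] Hardy (-1 / 2) := hardyInclusion (by norm_num)

/-- The inclusion `H^{1/2}_+ ⊆ H^{-1/2}_+`. -/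
def halfToNegHalf : Hardy (1 / 2) →ₗ[ℂ] Hardy (-1 / 2) := hardyInclusion (by norm_num)

theorem halfToL2_injective : Function.Injective halfToL2 := hardyInclusion_injective _

theorem l2ToNegHalf_injective : Function.Injective l2ToNegHalf := hardyInclusion_injective _

theorem halfToNegHalf_injective : Function.Injective halfToNegHalf := hardyInclusion_injective _

/-- The Szegő projector `Π : H^β_c → H^β_+`. -/
def szego (β : ℝ) : Sobolev β →ₗ[ℂ] Hardy β where
  toFun v := ⟨WSobolev.mk (fun n => if 0 ≤ n then v n else 0) (by
    refine v.summable.of_nonneg_of_le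
      (fun n => mul_nonneg ((sobolevWeight β).pos n).le (sq_nonneg _)) fun n => ?_
    refine mul_le_mul_of_nonneg_left ?_ ((sobolevWeight β).pos n).le
    split_ifs
    · exact le_rfl
    · simp), fun n hn => if_neg (not_le.2 hn)⟩
  map_add' u v := by
    refine Subtype.ext (WSobolev.ext fun n => ?_)
    by_cases hn : 0 ≤ n <;> simp [hn]
  map_smul' c v := by
    refine Subtype.ext (WSobolev.ext fun n => ?_)
    by_cases hn : 0 ≤ n <;> simp [hn]

/-- The operator `D = -i ∂_x`, as a map from `H^{1/2}_+` to `H^{-1/2}_+`. -/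
def derivOp : Hardy (1 / 2) →ₗ[ℂ] Hardy (-1 / 2) where
  toFun f := ⟨WSobolev.mk (fun n => (n : ℂ) * f.1 n) (by
    refine f.1.summable.of_nonneg_of_le
      (fun n => mul_nonneg ((sobolevWeight _).pos n).le (sq_nonneg _)) fun n => ?_
    have hb := bracket_pos n
    have h1 : ‖(n : ℂ)‖ ≤ bracket n := by
      rw [Complex.norm_intCast]
      exact le_max_right _ _
    rw [sobolevWeight_half, sobolevWeight_neg_half, norm_mul, mul_pow,
      inv_mul_le_iff₀ hb, ← mul_assoc]
    refine mul_le_mul_of_nonneg_right ?_ (sq_nonneg _)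
    nlinarith [norm_nonneg (n : ℂ)]), fun n hn => by
      rw [WSobolev.mk_apply, f.2 n hn, mul_zero]⟩
  map_add' f g := by
    refine Subtype.ext (WSobolev.ext fun n => ?_)
    simp [mul_add]
  map_smul' c f := by
    refine Subtype.ext (WSobolev.ext fun n => ?_)
    simp [mul_left_comm]

/-- The Toeplitz operator `T_u f = Π (u f)`, as a map from `H^{1/2}_+` to `H^{-1/2}_+`. -/
def toeplitz (u : SobolevLog (-1 / 2)) : Hardy (1 / 2) →ₗ[ℂ] Hardy (-1 / 2) :=
  (szego (-1 / 2)).comp ((mulOp u).comp (hardySubmodule (1 / 2)).subtype)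

/-- The Lax operator `L_u = D - T_u`, as a map from `H^{1/2}_+` to `H^{-1/2}_+`. -/
def laxMap (u : SobolevLog (-1 / 2)) : Hardy (1 / 2) →ₗ[ℂ] Hardy (-1 / 2) :=
  derivOp - toeplitz u

theorem laxMap_apply (u : SobolevLog (-1 / 2)) (f : Hardy (1 / 2)) {n : ℤ} (hn : 0 ≤ n) :
    (laxMap u f).1 n = n * f.1 n - ∑' k, u (n - k) * f.1 k := by
  change (n : ℂ) * f.1 n - (if 0 ≤ n then _ else _) = _
  rw [if_pos hn]
  rfl

/-- The Lax operator `L_u` as an unbounded operator on `H^{-1/2}_+` with domain `H^{1/2}_+`. -/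
def laxOp (u : SobolevLog (-1 / 2)) : Hardy (-1 / 2) →ₗ.[ℂ] Hardy (-1 / 2) where
  domain := LinearMap.range halfToNegHalf
  toFun := (laxMap u).comp
    (LinearEquiv.ofInjective halfToNegHalf halfToNegHalf_injective).symm.toLinearMap

theorem laxOp_apply (u : SobolevLog (-1 / 2)) (f : Hardy (1 / 2)) :
    laxOp u ⟨halfToNegHalf f, LinearMap.mem_range_self _ f⟩ = laxMap u f :=
  congrArg (laxMap u)
    ((LinearEquiv.ofInjective halfToNegHalf halfToNegHalf_injective).symm_apply_apply f)

/-- The functions `f ∈ H^{1/2}_+` with `L_u f ∈ L²_+`. -/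
def symDomain (u : SobolevLog (-1 / 2)) : Submodule ℂ (Hardy (1 / 2)) :=
  (LinearMap.range l2ToNegHalf).comap (laxMap u)

/-- Whenever `L_u - μ : H^{1/2}_+ → H^{-1/2}_+` is invertible, `symDomain u` is the image
`(L_u - μ)⁻¹ (L²_+)` of `L²_+` under the inverse. -/
theorem mem_symDomain_iff (u : SobolevLog (-1 / 2)) (μ : ℂ) (f : Hardy (1 / 2)) :
    f ∈ symDomain u ↔ ∃ g : Hardy 0, (laxMap u - μ • halfToNegHalf) f = l2ToNegHalf g := by
  have hf : μ • halfToNegHalf f = l2ToNegHalf (μ • halfToL2 f) := rfl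
  constructor
  · rintro ⟨g, hg⟩
    refine ⟨g - μ • halfToL2 f, ?_⟩
    rw [map_sub, hg, ← hf]
    rfl
  · rintro ⟨g, hg⟩
    refine ⟨g + μ • halfToL2 f, ?_⟩
    rw [map_add, ← hg, ← hf]
    exact sub_add_cancel _ _

theorem symDomain_summable (u : SobolevLog (-1 / 2)) {f : Hardy (1 / 2)} (hf : f ∈ symDomain u) :
    Summable fun n => (sobolevWeight 0).toFun n * ‖(laxMap u f).1 n‖ ^ 2 := by
  obtain ⟨g, hg⟩ := hf
  rw [← hg]
  exact g.1.summable

/-- The restriction of `L_u` to `symDomain u`, with values in `L²_+`. -/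
def symMap (u : SobolevLog (-1 / 2)) : symDomain u →ₗ[ℂ] Hardy 0 where
  toFun f := ⟨WSobolev.mk (fun n => (laxMap u f.1).1 n) (symDomain_summable u f.2),
    fun n hn => (laxMap u f.1).2 n hn⟩
  map_add' f g := by
    refine Subtype.ext (WSobolev.ext fun n => ?_)
    simp only [Submodule.coe_add, map_add, WSobolev.add_apply, WSobolev.mk_apply]
  map_smul' c f := by
    refine Subtype.ext (WSobolev.ext fun n => ?_)
    simp only [Submodule.coe_smul, map_smul, WSobolev.smul_apply, WSobolev.mk_apply,
      RingHom.id_apply]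

theorem symMap_apply (u : SobolevLog (-1 / 2)) (f : symDomain u) :
    l2ToNegHalf (symMap u f) = laxMap u f :=
  Subtype.ext (WSobolev.ext fun _ => rfl)

/-- The operator `L_u^sym`: the restriction of `L_u` to an unbounded operator on `L²_+`, with
domain `{f ∈ H^{1/2}_+ | L_u f ∈ L²_+}`, which is `(L_u - μ)⁻¹ (L²_+)`. -/
def laxSym (u : SobolevLog (-1 / 2)) : Hardy 0 →ₗ.[ℂ] Hardy 0 where
  domain := (symDomain u).map halfToL2
  toFun := (symMap u).comp
    (Submodule.equivMapOfInjective halfToL2 halfToL2_injective (symDomain u)).symm.toLinearMap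

theorem laxSym_apply (u : SobolevLog (-1 / 2)) (f : Hardy (1 / 2)) (hf : f ∈ symDomain u) :
    l2ToNegHalf (laxSym u ⟨halfToL2 f, Submodule.mem_map_of_mem hf⟩) = laxMap u f :=
  (congrArg (fun g => l2ToNegHalf (symMap u g))
    ((Submodule.equivMapOfInjective halfToL2 halfToL2_injective
      (symDomain u)).symm_apply_apply ⟨f, hf⟩)).trans (symMap_apply u ⟨f, hf⟩)

/-! ### Real-valued potentials of zero mean -/

/-- The real-valued elements of zero mean in a weighted space: `û(0) = 0` and
`û(-n) = conj û(n)`. -/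
def realZeroMean (w : FourierWeight) : Submodule ℝ (WSobolev w) where
  carrier := {u | u 0 = 0 ∧ ∀ n, u (-n) = conj (u n)}
  zero_mem' := ⟨rfl, fun n => by simp⟩
  add_mem' {u v} hu hv := ⟨by rw [WSobolev.add_apply, hu.1, hv.1, add_zero], fun n => by
    rw [WSobolev.add_apply, WSobolev.add_apply, hu.2, hv.2, map_add]⟩
  smul_mem' c u hu := by
    have h : ∀ n, (c • u) n = (c : ℂ) * u n := fun n => rfl
    exact ⟨by rw [h, hu.1, mul_zero], fun n => by
      rw [h, h, hu.2, map_mul, Complex.conj_ofReal]⟩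

/-- The space `L²_{r,0}`. -/
abbrev L2Real : Type := realZeroMean (sobolevWeight 0)

/-- The space `H^{-1/2,√log}_{r,0}`, a real Hilbert space. -/
abbrev LogReal : Type := realZeroMean (sobolevLogWeight (-1 / 2))

/-- The pairing `⟨f | g⟩ = (1/2π) ∫ f conj g` between `H^{-1/2}_+` and `H^{1/2}_+`. -/
def pairing (f : Hardy (-1 / 2)) (g : Hardy (1 / 2)) : ℂ := ∑' n, f.1 n * conj (g.1 n)

/-- The function `η(x) = C₀ x (1 + x)`. -/
def eta (C₀ x : ℝ) : ℝ := C₀ * x * (1 + x)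

/-! ### Spectral notions for unbounded operators -/

variable {E : Type*} [NormedAddCommGroup E] [NormedSpace ℂ E]

/-- `R` is the (bounded, everywhere defined) resolvent `(A - μ)⁻¹`. -/
def IsResolvent (A : E →ₗ.[ℂ] E) (μ : ℂ) (R : E →L[ℂ] E) : Prop :=
  (∀ x, ∃ h : R x ∈ A.domain, A ⟨R x, h⟩ - μ • R x = x) ∧
    ∀ x : A.domain, R (A x - μ • (x : E)) = x

/-- The spectrum of an unbounded operator: the complement of its resolvent set. -/
def opSpectrum (A : E →ₗ.[ℂ] E) : Set ℂ := {μ | ¬ ∃ R, IsResolvent A μ R}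

/-- The resolvent set is non-empty and every resolvent is a compact operator. -/
def HasCompactResolvent (A : E →ₗ.[ℂ] E) : Prop :=
  (∃ μ R, IsResolvent A μ R) ∧ ∀ μ R, IsResolvent A μ R → IsCompactOperator R

/-- `μ` is an eigenvalue of `A`. -/
def IsEigenvalue (A : E →ₗ.[ℂ] E) (μ : ℂ) : Prop :=
  ∃ x : A.domain, (x : E) ≠ 0 ∧ A x = μ • (x : E)

/-- The kernel of `(A - μ) ^ k`, on its natural domain. -/
def kerPow (A : E →ₗ.[ℂ] E) (μ : ℂ) : ℕ → Submodule ℂ E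
  | 0 => ⊥
  | k + 1 => ((kerPow A μ k).comap (A.toFun - μ • A.domain.subtype)).map A.domain.subtype

/-- The root space (generalized eigenspace) of `A` at `μ`: the span (equivalently, as the kernels
increase, the union) of the kernels of `(A - μ) ^ k`. -/
def rootSpace (A : E →ₗ.[ℂ] E) (μ : ℂ) : Submodule ℂ E := ⨆ k, kerPow A μ k

/-- `μ` is a simple eigenvalue of `A`: an eigenvalue of algebraic multiplicity one. -/
def IsSimpleEigenvalue (A : E →ₗ.[ℂ] E) (μ : ℂ) : Prop :=
  IsEigenvalue A μ ∧ Module.finrank ℂ (rootSpace A μ) = 1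

end

end LaxLog

open LaxLog

namespace LaxLog

noncomputable section

/-! ### Weighted spaces: scalar products, inclusions, Riesz map -/

section Weighted

variable {w : FourierWeight}

/-! Everything rests on the quadratic form q_u(f) = ⟨L_u f | f⟩ on H^{1/2}_+, which is Hermitian
because u is real-valued (`pairing_laxMap_symm`). For coercivity, split u = (u - u₀) + u₀ with u₀ in
L² close to u. The product estimate bounds the form of T_{u-u₀} by a quarter of ‖f‖²_{1/2}. For u₀
in L², `norm_pairing_toeplitz_le` trades a small multiple of ‖f‖²_{1/2} against a large multiple of
‖f‖², which a very negative λ absorbs. Truncations of u to finitely many frequencies can serve as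
u₀, so for each u some shift L_u - λ is coercive (`exists_coercive`) and, by Lax-Milgram, an
isomorphism of H^{1/2}_+ onto H^{-1/2}_+.

The inverse, restricted to L²_+, factors through the compact embedding of H^{1/2}_+ in L²_+: it is a
compact symmetric resolvent of L_u^sym. Self-adjointness, a spectrum made of eigenvalues, and
completeness of the eigenfunctions follow abstractly. If f is in H^{1/2}_+ and (L_u - μ)f is in
L²_+, then L_u f is in L²_+, so both operators have the same root spaces.

The gaps come from the shift. If f̂(0) = 0 and g = Π(e^{-ix} f), then q_u(f) = q_u(g) + ‖g‖²
(`laxForm_backShift`). Let f₁, f₂ be orthogonal eigenfunctions for μ ≤ ν, and let N be the dimension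
of the spectral subspace below μ. That subspace together with f₁, f₂ has dimension N + 2, so it
contains some h ≠ 0 with ĥ(0) = 0 whose shift is orthogonal to the spectral subspace. The two halves
of the min-max principle then give ν‖h‖² ≥ q_u(h) ≥ (μ + 1)‖h‖². This single argument
(`gap_of_orthogonal`) yields simplicity, when μ = ν, as well as the gap.

For analyticity, the implicit function theorem applied to the eigenvalue equation with a
normalization (`exists_contDiffAt_eigenvalue`) produces an analytic branch of eigenvalues. Comparing
forms by min-max (`laxEigenvalue_le_of_laxForm_le`) shows that each λ_n is continuous, and since the
gaps are at least 1 the branch must coincide with λ_n. -/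

theorem WSobolev.hasSum_inner (u v : WSobolev w) :
    HasSum (fun n => (w.toFun n : ℂ) * (v n * conj (u n))) (inner ℂ u v) := by
  have h := lp.hasSum_inner (𝕜 := ℂ) (WSobolev.toLp w u) (WSobolev.toLp w v)
  refine HasSum.congr_fun h fun n => ?_
  change _ = inner ℂ ((Real.sqrt (w.toFun n) : ℂ) * u n) ((Real.sqrt (w.toFun n) : ℂ) * v n)
  have h2 : (Real.sqrt (w.toFun n) : ℂ) * Real.sqrt (w.toFun n) = w.toFun n := by
    rw [← Complex.ofReal_mul, Real.mul_self_sqrt (w.pos n).le]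
  rw [RCLike.inner_apply, map_mul, Complex.conj_ofReal, ← h2]
  ring

theorem WSobolev.hasSum_norm_sq (u : WSobolev w) :
    HasSum (fun n => w.toFun n * ‖u n‖ ^ 2) (‖u‖ ^ 2) := by
  rw [WSobolev.norm_sq_eq]
  exact u.summable.hasSum

theorem WSobolev.norm_le_of_forall {w' : FourierWeight} (u : WSobolev w) (v : WSobolev w') {C : ℝ}
    (hC : 0 ≤ C) (h : ∀ n, w.toFun n * ‖u n‖ ^ 2 ≤ C ^ 2 * (w'.toFun n * ‖v n‖ ^ 2)) :
    ‖u‖ ≤ C * ‖v‖ := by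
  refine abs_le_of_sq_le_sq' ?_ (by positivity) |>.2
  rw [mul_pow]
  exact hasSum_le h u.hasSum_norm_sq (v.hasSum_norm_sq.mul_left _)

/-- The exponential `e^{ikx}`. -/
def WSobolev.single (w : FourierWeight) (k : ℤ) : WSobolev w :=
  WSobolev.mk (Pi.single k 1) (summable_of_hasFiniteSupport ((Set.finite_singleton k).subset (by
    intro n hn
    by_contra h
    exact hn (by simp [Pi.single_eq_of_ne h]))))

theorem WSobolev.single_apply (k n : ℤ) :
    WSobolev.single w k n = (Pi.single k 1 : ℤ → ℂ) n := rfl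

theorem WSobolev.inner_single (k : ℤ) (v : WSobolev w) :
    inner ℂ (WSobolev.single w k) v = (w.toFun k : ℂ) * v k := by
  refine (WSobolev.hasSum_inner _ _).unique ?_
  convert hasSum_single k fun n hn => ?_ using 1
  · simp [WSobolev.single_apply]
  · simp [WSobolev.single_apply, hn]

end Weighted

/-! ### Hardy spaces, the Riesz map and the duality pairing -/

instance hardyInner (β : ℝ) : Inner ℂ (Hardy β) :=
  (Submodule.innerProductSpace (hardySubmodule β)).toInner

/-- The exponential `e^{ikx}`, `k ≥ 0`, in the Hardy space. -/
def hardySingle (β : ℝ) (k : ℕ) : Hardy β :=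
  ⟨WSobolev.single _ k, fun n hn => by
    rw [WSobolev.single_apply, Pi.single_eq_of_ne (by omega)]⟩

theorem inner_hardySingle {β : ℝ} (k : ℕ) (f : Hardy β) :
    inner ℂ (hardySingle β k) f = ((sobolevWeight β).toFun k : ℂ) * f.1 k :=
  WSobolev.inner_single _ _

theorem hardy_ext {β : ℝ} {f g : Hardy β} (h : ∀ k : ℕ, f.1 k = g.1 k) : f = g := by
  refine Subtype.ext (WSobolev.ext fun n => ?_)
  rcases lt_or_ge n 0 with hn | hn
  · rw [f.2 n hn, g.2 n hn]
  · lift n to ℕ using hn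
    exact h n

theorem sobolevWeight_zero (n : ℤ) : (sobolevWeight 0).toFun n = 1 := by
  simp [sobolevWeight]

theorem hardyInclusion_norm_le {β β' : ℝ} (h : β' ≤ β) (f : Hardy β) :
    ‖hardyInclusion h f‖ ≤ 1 * ‖f‖ :=
  WSobolev.norm_le_of_forall _ _ zero_le_one fun n => by
    rw [one_pow, one_mul]
    exact mul_le_mul_of_nonneg_right (sobolevWeight_mono h n) (sq_nonneg _)

/-- The inclusion `H^{1/2}_+ ⊆ L²_+` as a bounded operator. -/
def halfToL2L : Hardy (1 / 2) →L[ℂ] Hardy 0 :=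
  halfToL2.mkContinuous 1 (hardyInclusion_norm_le _)

/-- The inclusion `L²_+ ⊆ H^{-1/2}_+` as a bounded operator. -/
def l2ToNegHalfL : Hardy 0 →L[ℂ] Hardy (-1 / 2) :=
  l2ToNegHalf.mkContinuous 1 (hardyInclusion_norm_le _)

/-- The inclusion `H^{1/2}_+ ⊆ H^{-1/2}_+` as a bounded operator. -/
def halfToNegHalfL : Hardy (1 / 2) →L[ℂ] Hardy (-1 / 2) :=
  halfToNegHalf.mkContinuous 1 (hardyInclusion_norm_le _)

@[simp] theorem halfToL2L_apply (f : Hardy (1 / 2)) : halfToL2L f = halfToL2 f := rfl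

theorem l2ToNegHalf_halfToL2 (f : Hardy (1 / 2)) :
    l2ToNegHalf (halfToL2 f) = halfToNegHalf f := rfl

theorem halfToL2_apply (f : Hardy (1 / 2)) (n : ℤ) : (halfToL2 f).1 n = f.1 n := rfl

theorem norm_halfToNegHalf_le (f : Hardy (1 / 2)) : ‖halfToNegHalf f‖ ≤ ‖f‖ :=
  (hardyInclusion_norm_le _ f).trans_eq (one_mul _)

/-- The Riesz isomorphism of `H^{-1/2}_+`, the antidual of `H^{1/2}_+`, onto `H^{1/2}_+`. -/
def riesz : Hardy (-1 / 2) ≃ₗᵢ[ℂ] Hardy (1 / 2) where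
  toFun y := ⟨WSobolev.mk (fun n => (bracket n : ℂ)⁻¹ * y.1 n) (y.1.summable.congr fun n => by
      have h := bracket_pos n
      rw [sobolevWeight_half, sobolevWeight_neg_half, norm_mul, norm_inv, Complex.norm_real,
        Real.norm_of_nonneg h.le, mul_pow]
      field_simp), fun n hn => by
      rw [WSobolev.mk_apply, y.2 n hn, mul_zero]⟩
  map_add' x y := Subtype.ext (WSobolev.ext fun n => by simp [mul_add])
  map_smul' c x := Subtype.ext (WSobolev.ext fun n => by simp [mul_left_comm])
  invFun y := ⟨WSobolev.mk (fun n => (bracket n : ℂ) * y.1 n) (y.1.summable.congr fun n => by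
      have h := bracket_pos n
      rw [sobolevWeight_half, sobolevWeight_neg_half, norm_mul, Complex.norm_real,
        Real.norm_of_nonneg h.le, mul_pow]
      field_simp), fun n hn => by
      rw [WSobolev.mk_apply, y.2 n hn, mul_zero]⟩
  left_inv y := Subtype.ext (WSobolev.ext fun n => by
    have h : (bracket n : ℂ) ≠ 0 := by exact_mod_cast (bracket_pos n).ne'
    simp [h])
  right_inv y := Subtype.ext (WSobolev.ext fun n => by
    have h : (bracket n : ℂ) ≠ 0 := by exact_mod_cast (bracket_pos n).ne'
    simp [h])
  norm_map' y := by
    have key : ‖(WSobolev.mk (fun n => (bracket n : ℂ)⁻¹ * y.1 n) (y.1.summable.congr fun n => by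
      have h := bracket_pos n
      rw [sobolevWeight_half, sobolevWeight_neg_half, norm_mul, norm_inv, Complex.norm_real,
        Real.norm_of_nonneg h.le, mul_pow]
      field_simp) : Sobolev (1 / 2))‖ ^ 2 = ‖y.1‖ ^ 2 := by
      rw [WSobolev.norm_sq_eq, WSobolev.norm_sq_eq]
      refine tsum_congr fun n => ?_
      have h := bracket_pos n
      rw [sobolevWeight_half, sobolevWeight_neg_half, WSobolev.mk_apply, norm_mul, norm_inv,
        Complex.norm_real, Real.norm_of_nonneg h.le, mul_pow]
      field_simp
    exact (sq_eq_sq₀ (norm_nonneg _) (norm_nonneg _)).1 key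

theorem riesz_apply (y : Hardy (-1 / 2)) (n : ℤ) :
    (riesz y).1 n = (bracket n : ℂ)⁻¹ * y.1 n := rfl

/-- The weight ⟨n⟩ of H^{1/2} cancels the factor ⟨n⟩⁻¹ of the Riesz map. The pairing thereby
inherits convergence, sesquilinearity and Cauchy-Schwarz from a scalar product. -/
theorem hasSum_pairing (y : Hardy (-1 / 2)) (g : Hardy (1 / 2)) :
    HasSum (fun n => y.1 n * conj (g.1 n)) (inner ℂ g (riesz y)) := by
  refine (WSobolev.hasSum_inner g.1 (riesz y).1).congr_fun fun n => ?_
  have h : (bracket n : ℂ) ≠ 0 := by exact_mod_cast (bracket_pos n).ne'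
  rw [sobolevWeight_half, riesz_apply]
  field_simp

theorem pairing_eq_inner (y : Hardy (-1 / 2)) (g : Hardy (1 / 2)) :
    pairing y g = inner ℂ g (riesz y) :=
  (hasSum_pairing y g).tsum_eq

theorem norm_pairing_le (y : Hardy (-1 / 2)) (g : Hardy (1 / 2)) :
    ‖pairing y g‖ ≤ ‖y‖ * ‖g‖ := by
  rw [pairing_eq_inner, mul_comm, ← riesz.norm_map y]
  exact norm_inner_le_norm (𝕜 := ℂ) g (riesz y)

theorem pairing_add_left (y z : Hardy (-1 / 2)) (g : Hardy (1 / 2)) :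
    pairing (y + z) g = pairing y g + pairing z g := by
  simp only [pairing_eq_inner, map_add, inner_add_right]

theorem pairing_sub_left (y z : Hardy (-1 / 2)) (g : Hardy (1 / 2)) :
    pairing (y - z) g = pairing y g - pairing z g := by
  simp only [pairing_eq_inner, map_sub, inner_sub_right]

theorem pairing_smul_left (c : ℂ) (y : Hardy (-1 / 2)) (g : Hardy (1 / 2)) :
    pairing (c • y) g = c * pairing y g := by
  rw [pairing_eq_inner, pairing_eq_inner, map_smul]
  exact inner_smul_right (𝕜 := ℂ) g (riesz y) c

theorem pairing_add_right (y : Hardy (-1 / 2)) (f g : Hardy (1 / 2)) :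
    pairing y (f + g) = pairing y f + pairing y g := by
  simp only [pairing_eq_inner, inner_add_left]

theorem pairing_smul_right (c : ℂ) (y : Hardy (-1 / 2)) (g : Hardy (1 / 2)) :
    pairing y (c • g) = conj c * pairing y g := by
  rw [pairing_eq_inner, pairing_eq_inner]
  exact inner_smul_left (𝕜 := ℂ) g (riesz y) c

theorem hasSum_inner_l2 (f g : Hardy 0) :
    HasSum (fun n => g.1 n * conj (f.1 n)) (inner ℂ f g) :=
  (WSobolev.hasSum_inner f.1 g.1).congr_fun fun n => by simp [sobolevWeight_zero]

/-- The arguments swap because `pairing` is linear in its first slot, while `inner` is linear in its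
second. -/
theorem pairing_l2ToNegHalf (h : Hardy 0) (g : Hardy (1 / 2)) :
    pairing (l2ToNegHalf h) g = inner ℂ (halfToL2 g) h :=
  (hasSum_inner_l2 (halfToL2 g) h).tsum_eq

theorem pairing_halfToNegHalf (f g : Hardy (1 / 2)) :
    pairing (halfToNegHalf f) g = inner ℂ (halfToL2 g) (halfToL2 f) :=
  pairing_l2ToNegHalf (halfToL2 f) g

/-! ### The operators `D`, `T_u` and `L_u` as bounded operators -/

theorem norm_derivOp_le (f : Hardy (1 / 2)) : ‖derivOp f‖ ≤ 1 * ‖f‖ :=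
  WSobolev.norm_le_of_forall (derivOp f).1 f.1 zero_le_one fun n => by
    have hb := bracket_pos n
    have h1 : ‖(n : ℂ)‖ ≤ bracket n := by
      rw [Complex.norm_intCast]
      exact le_max_right _ _
    change _ * ‖(n : ℂ) * f.1 n‖ ^ 2 ≤ _
    rw [sobolevWeight_half, sobolevWeight_neg_half, norm_mul, mul_pow, one_pow, one_mul,
      inv_mul_le_iff₀ hb, ← mul_assoc]
    refine mul_le_mul_of_nonneg_right ?_ (sq_nonneg _)
    nlinarith [norm_nonneg (n : ℂ)]

theorem norm_szego_le {β : ℝ} (v : Sobolev β) : ‖szego β v‖ ≤ 1 * ‖v‖ :=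
  WSobolev.norm_le_of_forall (szego β v).1 v zero_le_one fun n => by
    rw [one_pow, one_mul]
    refine mul_le_mul_of_nonneg_left ?_ ((sobolevWeight β).pos n).le
    change ‖if 0 ≤ n then v n else 0‖ ^ 2 ≤ _
    split_ifs
    · exact le_rfl
    · simp

theorem norm_toeplitz_le {K : ℝ} (hK : IsProductConstant K) (u : SobolevLog (-1 / 2))
    (f : Hardy (1 / 2)) : ‖toeplitz u f‖ ≤ K * ‖u‖ * ‖f‖ := by
  refine (norm_szego_le _).trans ?_
  rw [one_mul]
  exact hK.2 u f.1

theorem summable_mulCoeff (u : SobolevLog (-1 / 2)) (v : Sobolev (1 / 2)) (n : ℤ) :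
    Summable fun k => u (n - k) * v k :=
  (exists_mulCoeff_le.choose_spec.2 u v).1 n

theorem toeplitz_apply (u : SobolevLog (-1 / 2)) (f : Hardy (1 / 2)) (n : ℤ) :
    (toeplitz u f).1 n = if 0 ≤ n then ∑' k, u (n - k) * f.1 k else 0 := rfl

/-- The map `u ↦ T_u`, bounded from `H^{-1/2,√log}_c` to the bounded operators from `H^{1/2}_+` to
`H^{-1/2}_+`. -/
def toeplitzL : SobolevLog (-1 / 2) →L[ℂ] Hardy (1 / 2) →L[ℂ] Hardy (-1 / 2) :=
  LinearMap.mkContinuous₂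
    (LinearMap.mk₂ ℂ (fun u f => toeplitz u f)
      (fun u v f => Subtype.ext (WSobolev.ext fun n => by
        have h := (summable_mulCoeff u f.1 n).tsum_add (summable_mulCoeff v f.1 n)
        change (toeplitz _ _).1 n = (toeplitz _ _).1 n + (toeplitz _ _).1 n
        simp only [toeplitz_apply, WSobolev.add_apply, add_mul, h]
        split_ifs <;> simp))
      (fun c u f => Subtype.ext (WSobolev.ext fun n => by
        change (toeplitz _ _).1 n = c * (toeplitz _ _).1 n
        simp only [toeplitz_apply, WSobolev.smul_apply, mul_assoc, tsum_mul_left]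
        split_ifs <;> simp))
      (fun u f g => map_add _ f g) (fun c u f => map_smul _ c f))
    exists_isProductConstant.choose
    (fun u f => norm_toeplitz_le exists_isProductConstant.choose_spec u f)

theorem toeplitzL_apply (u : SobolevLog (-1 / 2)) (f : Hardy (1 / 2)) :
    toeplitzL u f = toeplitz u f := rfl

/-- The operator `D` as a bounded operator. -/
def derivL : Hardy (1 / 2) →L[ℂ] Hardy (-1 / 2) := derivOp.mkContinuous 1 norm_derivOp_le

/-- The Lax operator as a bounded operator from `H^{1/2}_+` to `H^{-1/2}_+`. -/
def laxL (u : SobolevLog (-1 / 2)) : Hardy (1 / 2) →L[ℂ] Hardy (-1 / 2) := derivL - toeplitzL u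

theorem laxL_apply (u : SobolevLog (-1 / 2)) (f : Hardy (1 / 2)) : laxL u f = laxMap u f := rfl

theorem laxMap_sub_laxMap (u v : SobolevLog (-1 / 2)) (f : Hardy (1 / 2)) :
    laxMap u f - laxMap v f = toeplitz (v - u) f := by
  rw [← laxL_apply, ← laxL_apply, ← toeplitzL_apply, map_sub]
  simp [laxL]

/-! ### Compactness and density of the inclusions -/

/-- The truncation to the frequencies below `N`. -/
def truncL (N : ℕ) : Hardy (1 / 2) →L[ℂ] Hardy 0 :=
  ∑ k ∈ Finset.range N, (ContinuousLinearMap.toSpanSingleton ℂ (hardySingle 0 k)).comp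
    ((innerSL ℂ (hardySingle 0 k)).comp halfToL2L)

theorem truncL_apply (N : ℕ) (f : Hardy (1 / 2)) (k : ℕ) :
    (truncL N f).1 k = if k < N then f.1 k else 0 := by
  have h : ∀ j : ℕ, inner ℂ (hardySingle 0 j) (halfToL2 f) = f.1 j := fun j => by
    rw [inner_hardySingle, sobolevWeight_zero, halfToL2_apply]
    simp
  have h2 : truncL N f = ∑ j ∈ Finset.range N, f.1 j • hardySingle 0 j := by
    simp [truncL, h]
  have h3 : ∀ s : Finset ℕ, (∑ j ∈ s, f.1 (j : ℤ) • hardySingle 0 j).1 (k : ℤ) =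
      if k ∈ s then f.1 k else 0 := by
    intro s
    induction s using Finset.induction_on with
    | empty => rfl
    | insert a s ha ih =>
      rw [Finset.sum_insert ha, Submodule.coe_add, WSobolev.add_apply, ih, Submodule.coe_smul,
        WSobolev.smul_apply]
      change f.1 a * (Pi.single (a : ℤ) 1 : ℤ → ℂ) k + _ = _
      rcases eq_or_ne k a with rfl | hk
      · simp [ha]
      · simp [hk]
  rw [h2, h3]
  simp

theorem isCompactOperator_truncL (N : ℕ) : IsCompactOperator (truncL N) := by
  have h : truncL N ∈ compactOperator (RingHom.id ℂ) (Hardy (1 / 2)) (Hardy 0) :=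
    Submodule.sum_mem _ fun k _ =>
      (isCompactOperator_of_locallyCompactSpace_rng
        (ContinuousLinearMap.toSpanSingleton ℂ (hardySingle 0 k))).comp_clm _
  exact h

/-- Only frequencies n ≥ N + 1 survive, and there ⟨n⟩ ≥ N + 1. The shift from N to N + 1 keeps the
bound finite at N = 0. -/
theorem norm_halfToL2L_sub_truncL_le (N : ℕ) :
    ‖halfToL2L - truncL (N + 1)‖ ≤ Real.sqrt (1 / ((N : ℝ) + 1)) := by
  refine ContinuousLinearMap.opNorm_le_bound _ (Real.sqrt_nonneg _) fun f => ?_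
  refine WSobolev.norm_le_of_forall ((halfToL2L - truncL (N + 1)) f).1 f.1 (Real.sqrt_nonneg _)
    fun n => ?_
  rw [sobolevWeight_zero, sobolevWeight_half, Real.sq_sqrt (by positivity)]
  rcases lt_or_ge n 0 with hn | hn
  · rw [((halfToL2L - truncL (N + 1)) f).2 n hn, f.2 n hn]
    simp
  lift n to ℕ using hn
  have h : ((halfToL2L - truncL (N + 1)) f).1 n = f.1 n - (truncL (N + 1) f).1 n := rfl
  rw [h, truncL_apply]
  split_ifs with hk
  · rw [sub_self]
    have := bracket_pos n
    rw [norm_zero, zero_pow two_ne_zero, mul_zero]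
    positivity
  · rw [sub_zero, ← mul_assoc]
    refine mul_le_mul_of_nonneg_right ?_ (sq_nonneg _)
    rw [one_div, ← div_eq_inv_mul, le_div_iff₀ (by positivity), one_mul]
    refine le_trans ?_ (le_max_right _ _)
    rw [Int.cast_natCast, Nat.abs_cast]
    exact_mod_cast not_lt.1 hk

/-- A norm limit of finite-rank truncations. This embedding is the source of all compactness in the
proof. -/
theorem isCompactOperator_halfToL2L : IsCompactOperator halfToL2L := by
  refine isCompactOperator_of_tendsto (l := Filter.atTop) (F := fun N : ℕ => truncL (N + 1)) ?_
    (Filter.Eventually.of_forall fun N => isCompactOperator_truncL _)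
  refine (tendsto_iff_norm_sub_tendsto_zero (E := Hardy (1 / 2) →L[ℂ] Hardy 0)).2 ?_
  have h : Filter.Tendsto (fun N : ℕ => Real.sqrt (1 / ((N : ℝ) + 1))) Filter.atTop (nhds 0) := by
    simpa using (tendsto_one_div_add_atTop_nhds_zero_nat (𝕜 := ℝ)).sqrt
  refine squeeze_zero (fun N => norm_nonneg (truncL (N + 1) - halfToL2L)) (fun N => ?_) h
  exact (norm_sub_rev (truncL (N + 1)) halfToL2L).trans_le (norm_halfToL2L_sub_truncL_le N)

theorem dense_range_l2ToNegHalf :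
    Dense (LinearMap.range l2ToNegHalf : Set (Hardy (-1 / 2))) := by
  rw [Submodule.dense_iff_topologicalClosure_eq_top, Submodule.topologicalClosure_eq_top_iff,
    Submodule.eq_bot_iff]
  intro y hy
  refine hardy_ext fun k => ?_
  have h := hy (hardySingle (-1 / 2) k) ⟨hardySingle 0 k, rfl⟩
  rw [inner_hardySingle] at h
  exact (mul_eq_zero.1 h).resolve_left (by exact_mod_cast ((sobolevWeight _).pos _).ne')

/-- Needed to see that there are infinitely many eigenvalues. -/
theorem not_finiteDimensional_l2 : ¬ FiniteDimensional ℂ (Hardy 0) := by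
  intro h
  have hl : LinearIndependent ℂ (fun k : ℕ => hardySingle 0 k) := by
    refine (Orthonormal.linearIndependent (𝕜 := ℂ) ?_)
    rw [orthonormal_iff_ite]
    intro i j
    rw [inner_hardySingle, sobolevWeight_zero]
    change ((1 : ℝ) : ℂ) * (Pi.single (j : ℤ) 1 : ℤ → ℂ) i = _
    rcases eq_or_ne i j with rfl | hij
    · simp
    · simp [hij]
  exact Infinite.not_finite (α := ℕ) hl.finite

end

end LaxLog

namespace LaxLog

noncomputable section

/-! ### Estimates of the quadratic form -/

/-- A telescoping bound: each of the two new terms ±(M + 1) is at most 1/(a + M) - 1/(a + M + 1).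
The subtracted 2/(a + M) is what lets the induction close; what matters later is the decay 3/a. -/
theorem sum_inv_add_bracket_sq_le {a : ℝ} (ha : 1 ≤ a) (M : ℕ) :
    ∑ j ∈ Finset.Icc (-(M : ℤ)) M, ((a + bracket j) ^ 2)⁻¹ ≤ 3 / a - 2 / (a + M) := by
  induction M with
  | zero =>
    have h1 : 3 / a - 2 / a = a⁻¹ := by field_simp; norm_num
    simp only [bracket, Nat.cast_zero, neg_zero, Finset.Icc_self, Finset.sum_singleton,
      Int.cast_zero, abs_zero, add_zero, max_eq_left zero_le_one, h1]
    gcongr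
    nlinarith
  | succ M ih =>
    have hsub : Finset.Icc (-((M + 1 : ℕ) : ℤ)) ((M + 1 : ℕ) : ℤ) ⊆
        insert ((M : ℤ) + 1) (insert (-((M : ℤ) + 1)) (Finset.Icc (-(M : ℤ)) M)) := by
      intro j hj
      simp only [Finset.mem_insert, Finset.mem_Icc] at hj ⊢
      push_cast at hj
      omega
    have h1 : bracket ((M : ℤ) + 1) = M + 1 := by
      rw [bracket]
      push_cast
      rw [abs_of_nonneg (by positivity), max_eq_right]
      linarith [(Nat.cast_nonneg M : (0 : ℝ) ≤ M)]
    refine (Finset.sum_le_sum_of_subset_of_nonneg hsub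
      fun j _ _ => by positivity).trans ?_
    rw [Finset.sum_insert (by simp; omega), Finset.sum_insert (by simp), bracket_neg, h1]
    have h2 : ((a + (M + 1)) ^ 2)⁻¹ ≤ 1 / (a + M) - 1 / (a + (M + 1)) := by
      have hM : (0 : ℝ) < a + M := by positivity
      rw [div_sub_div _ _ hM.ne' (by positivity), inv_eq_one_div,
        div_le_div_iff₀ (by positivity) (by positivity)]
      nlinarith
    push_cast
    have h3 : 2 / (a + M) = 2 * (1 / (a + M)) := by ring
    have h4 : 2 / (a + (M + 1)) = 2 * (1 / (a + (M + 1))) := by ring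
    rw [h3] at ih
    rw [h4]
    linarith

theorem tsum_inv_add_bracket_sq_le {a : ℝ} (ha : 1 ≤ a) :
    ∑' j, ((ENNReal.ofReal (a + bracket j))⁻¹) ^ 2 ≤ ENNReal.ofReal (3 / a) := by
  have hpos : ∀ j, 0 < a + bracket j := fun j => by linarith [bracket_pos j]
  have h : ∀ j, ((ENNReal.ofReal (a + bracket j))⁻¹) ^ 2 =
      ENNReal.ofReal (((a + bracket j) ^ 2)⁻¹) := fun j => by
    rw [← ENNReal.ofReal_inv_of_pos (hpos j), ← ENNReal.ofReal_pow (inv_pos.2 (hpos j)).le,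
      inv_pow]
  simp only [h]
  rw [ENNReal.tsum_eq_iSup_sum]
  refine iSup_le fun F => ?_
  rw [← ENNReal.ofReal_sum_of_nonneg fun j _ => by have := hpos j; positivity]
  refine ENNReal.ofReal_le_ofReal ?_
  set M := F.sup Int.natAbs
  refine (Finset.sum_le_sum_of_subset_of_nonneg (t := Finset.Icc (-(M : ℤ)) M) (fun j hj => ?_)
    fun j _ _ => by have := hpos j; positivity).trans
    ((sum_inv_add_bracket_sq_le ha M).trans (sub_le_self _ (by positivity)))
  have : j.natAbs ≤ M := Finset.le_sup (f := Int.natAbs) hj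
  rw [Finset.mem_Icc]
  omega

/-- The sum is U tested against the autocorrelation of V. Cauchy-Schwarz in the lag m isolates U in
ℓ²; a second Cauchy-Schwarz, with weights r, bounds the autocorrelation, and xy ≤ x² + y² makes the
weight sum uniform in m. -/
theorem trilinear_sq_le (r : ℤ → ℝ≥0∞) (h0 : ∀ j, r j ≠ 0) (ht : ∀ j, r j ≠ ⊤) (U V : ℤ → ℝ≥0∞) :
    (∑' n, (∑' k, U (n - k) * V k) * V n) ^ 2 ≤
      (∑' j, U j ^ 2) * ((2 * ∑' j, ((r j ^ 2)⁻¹) ^ 2) * (∑' j, r j ^ 2 * V j ^ 2) ^ 2) := by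
  set B := ∑' j, ((r j ^ 2)⁻¹) ^ 2
  have h1 : (∑' n, (∑' k, U (n - k) * V k) * V n) = ∑' m, U m * ∑' j, V (j - m) * V j := by
    have h2 : ∀ n, (∑' k, U (n - k) * V k) = ∑' m, U m * V (n - m) := fun n => by
      rw [← (Equiv.subLeft n).tsum_eq]
      simp only [Equiv.subLeft_apply, sub_sub_cancel]
    simp only [h2, ← ENNReal.tsum_mul_right, ← ENNReal.tsum_mul_left]
    rw [ENNReal.tsum_comm]
    exact tsum_congr fun m => tsum_congr fun j => mul_assoc _ _ _
  have hxy : ∀ x y : ℝ≥0∞, x * y ≤ x ^ 2 + y ^ 2 := by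
    intro x y
    rcases le_total x y with h | h
    · calc x * y ≤ y * y := by gcongr
        _ = y ^ 2 := (sq y).symm
        _ ≤ _ := le_add_self
    · calc x * y ≤ x * x := by gcongr
        _ = x ^ 2 := (sq x).symm
        _ ≤ _ := le_self_add
  have h3 : ∀ m, (∑' j, V (j - m) * V j) ^ 2 ≤
      (∑' j, (r (j - m) ^ 2 * V (j - m) ^ 2) * (r j ^ 2 * V j ^ 2)) * (2 * B) := by
    intro m
    have h4 : ∀ j, V (j - m) * V j =
        (r (j - m) * V (j - m) * (r j * V j)) * ((r (j - m))⁻¹ * (r j)⁻¹) := by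
      intro j
      calc V (j - m) * V j = (r (j - m) * (r (j - m))⁻¹) * (r j * (r j)⁻¹) *
            (V (j - m) * V j) := by
            rw [ENNReal.mul_inv_cancel (h0 _) (ht _), ENNReal.mul_inv_cancel (h0 _) (ht _)]
            simp
        _ = _ := by ring
    simp only [h4]
    refine (tsum_mul_sq_le _ _).trans (mul_le_mul' (le_of_eq (tsum_congr fun j => by ring)) ?_)
    calc ∑' j, ((r (j - m))⁻¹ * (r j)⁻¹) ^ 2
        ≤ ∑' j, (((r (j - m) ^ 2)⁻¹) ^ 2 + ((r j ^ 2)⁻¹) ^ 2) := by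
          refine ENNReal.tsum_le_tsum fun j => ?_
          rw [mul_pow, ENNReal.inv_pow, ENNReal.inv_pow]
          exact hxy _ _
      _ = B + B := by
          rw [ENNReal.tsum_add]
          congr 1
          exact (Equiv.subRight m).tsum_eq fun j => ((r j ^ 2)⁻¹) ^ 2
      _ = 2 * B := (two_mul B).symm
  rw [h1]
  refine (tsum_mul_sq_le _ _).trans (mul_le_mul_right ?_ _)
  refine (ENNReal.tsum_le_tsum h3).trans ?_
  rw [ENNReal.tsum_mul_right, ENNReal.tsum_comm, mul_comm]
  refine mul_le_mul_right (le_of_eq ?_) _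
  rw [sq, ← ENNReal.tsum_mul_left]
  refine tsum_congr fun j => ?_
  rw [ENNReal.tsum_mul_right]
  congr 1
  exact (Equiv.subLeft j).tsum_eq fun j => r j ^ 2 * V j ^ 2

/-- The Szegő projector disappears when tested against a function in the Hardy space. -/
theorem pairing_toeplitz_term (u : SobolevLog (-1 / 2)) (f g : Hardy (1 / 2)) (n : ℤ) :
    (toeplitz u f).1 n * conj (g.1 n) = (∑' k, u (n - k) * f.1 k) * conj (g.1 n) := by
  rw [toeplitz_apply]
  split_ifs with hn
  · rfl
  · rw [g.2 n (not_le.1 hn), map_zero, mul_zero, mul_zero]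

theorem enorm_pairing_toeplitz_le (u : SobolevLog (-1 / 2)) (f g : Hardy (1 / 2)) :
    ‖pairing (toeplitz u f) g‖ₑ ≤ ∑' n, (∑' k, ‖u (n - k)‖ₑ * ‖f.1 k‖ₑ) * ‖g.1 n‖ₑ := by
  refine enorm_tsum_le_tsum_enorm.trans (ENNReal.tsum_le_tsum fun n => ?_)
  rw [pairing_toeplitz_term, enorm_mul, RCLike.enorm_conj]
  gcongr
  exact enorm_tsum_le_tsum_enorm.trans_eq (tsum_congr fun k => enorm_mul _ _)

/-- The weight r(j)² = s² + ⟨j⟩ in `trilinear_sq_le` turns the V-sum into s²‖f‖² + ‖f‖²_{1/2}, and ∑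
r⁻⁴ ≤ 3/s². A large s makes the H^{1/2} contribution as small as desired. -/
theorem norm_pairing_toeplitz_le (u : Sobolev 0) (f : Hardy (1 / 2)) {s : ℝ} (hs : 1 ≤ s) :
    ‖pairing (toeplitz (l2ToLog u) f) f‖ ≤
      3 * ‖u‖ * (s * ‖halfToL2 f‖ ^ 2 + s⁻¹ * ‖f‖ ^ 2) := by
  have hpos : ∀ j, 0 < s ^ 2 + bracket j := fun j => by
    have := bracket_pos j
    positivity
  set r : ℤ → ℝ≥0∞ := fun j => ENNReal.ofReal (Real.sqrt (s ^ 2 + bracket j)) with hr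
  have hr2 : ∀ j, r j ^ 2 = ENNReal.ofReal (s ^ 2 + bracket j) := fun j => by
    rw [hr, ← ENNReal.ofReal_pow (Real.sqrt_nonneg _), Real.sq_sqrt (hpos j).le]
  have h := trilinear_sq_le r (fun j => (ENNReal.ofReal_pos.2 (Real.sqrt_pos.2 (hpos j))).ne')
    (fun j => ENNReal.ofReal_ne_top) (fun n => ‖u n‖ₑ) (fun n => ‖f.1 n‖ₑ)
  have hU : ∑' j, ‖u j‖ₑ ^ 2 = ENNReal.ofReal (‖u‖ ^ 2) := by
    rw [← tsum_enorm_sq]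
    simp [sobolevWeight_zero]
  have hV : ∑' j, r j ^ 2 * ‖f.1 j‖ₑ ^ 2 =
      ENNReal.ofReal (s ^ 2 * ‖halfToL2 f‖ ^ 2 + ‖f‖ ^ 2) := by
    have h1 : ∀ j, r j ^ 2 * ‖f.1 j‖ₑ ^ 2 = ENNReal.ofReal (s ^ 2) *
        (ENNReal.ofReal ((sobolevWeight 0).toFun j) * ‖(halfToL2 f).1 j‖ₑ ^ 2) +
        ENNReal.ofReal ((sobolevWeight (1 / 2)).toFun j) * ‖f.1 j‖ₑ ^ 2 := fun j => by
      rw [hr2, ENNReal.ofReal_add (sq_nonneg _) (bracket_pos j).le, sobolevWeight_zero,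
        sobolevWeight_half, halfToL2_apply]
      simp [add_mul]
    simp only [h1]
    rw [ENNReal.tsum_add, ENNReal.tsum_mul_left, tsum_enorm_sq, tsum_enorm_sq,
      ← ENNReal.ofReal_mul (sq_nonneg _), ← ENNReal.ofReal_add (by positivity) (by positivity)]
    rfl
  have hB : ∑' j, ((r j ^ 2)⁻¹) ^ 2 ≤ ENNReal.ofReal (3 / s ^ 2) := by
    simp only [hr2]
    exact tsum_inv_add_bracket_sq_le (by nlinarith)
  have h2 := (pow_le_pow_left' (enorm_pairing_toeplitz_le (l2ToLog u) f f) 2).trans h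
  rw [hU, hV] at h2
  have h3 : ENNReal.ofReal (‖pairing (toeplitz (l2ToLog u) f) f‖ ^ 2) ≤
      ENNReal.ofReal (‖u‖ ^ 2 * ((2 * (3 / s ^ 2)) *
        (s ^ 2 * ‖halfToL2 f‖ ^ 2 + ‖f‖ ^ 2) ^ 2)) := by
    rw [ENNReal.ofReal_pow (norm_nonneg _), ofReal_norm]
    refine h2.trans ?_
    rw [ENNReal.ofReal_mul (by positivity), ENNReal.ofReal_mul (by positivity),
      ENNReal.ofReal_mul (by positivity) (q := 3 / s ^ 2),
      ENNReal.ofReal_pow (by positivity) (p := s ^ 2 * _ + _)]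
    gcongr
    simp
  rw [ENNReal.ofReal_le_ofReal_iff (by positivity)] at h3
  have hs0 : 0 < s := by linarith
  refine (abs_le_of_sq_le_sq' (h3.trans ?_) (by positivity)).2
  have h4 : s * ‖halfToL2 f‖ ^ 2 + s⁻¹ * ‖f‖ ^ 2 =
      s⁻¹ * (s ^ 2 * ‖halfToL2 f‖ ^ 2 + ‖f‖ ^ 2) := by
    field_simp
  rw [h4]
  have h5 : 0 ≤ ‖u‖ ^ 2 * ((s⁻¹) ^ 2 * (s ^ 2 * ‖halfToL2 f‖ ^ 2 + ‖f‖ ^ 2) ^ 2) := by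
    positivity
  have h6 : 2 * (3 / s ^ 2) = 6 * (s⁻¹) ^ 2 := by
    field_simp
    norm_num
  -- The factor obtained is 6; the factor 3² = 9 of the claim leaves room.
  rw [h6, mul_pow, mul_pow, mul_pow]
  linarith

/-- On nonnegative frequencies ⟨n⟩ ≤ n + 1; this is where D is used as a positive operator on the
Hardy space. -/
theorem norm_sq_le_re_pairing_derivOp (f : Hardy (1 / 2)) :
    ‖f‖ ^ 2 ≤ (pairing (derivOp f) f).re + ‖halfToL2 f‖ ^ 2 := by
  have h1 := (Complex.hasSum_re (hasSum_pairing (derivOp f) f)).add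
    (halfToL2 f).1.hasSum_norm_sq
  rw [pairing_eq_inner]
  refine hasSum_le (fun n => ?_) f.1.hasSum_norm_sq h1
  change _ ≤ ((n : ℂ) * f.1 n * conj (f.1 n)).re + _ * ‖f.1 n‖ ^ 2
  rcases lt_or_ge n 0 with hn | hn
  · simp [f.2 n hn]
  · have h2 : ((n : ℂ) * f.1 n * conj (f.1 n)).re = n * ‖f.1 n‖ ^ 2 := by
      rw [mul_assoc, Complex.mul_conj, Complex.normSq_eq_norm_sq, ← Complex.ofReal_intCast,
        ← Complex.ofReal_mul, Complex.ofReal_re]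
    rw [h2, ← add_mul, sobolevWeight_half, sobolevWeight_zero]
    refine mul_le_mul_of_nonneg_right ?_ (sq_nonneg _)
    have hn' : (0 : ℝ) ≤ n := by exact_mod_cast hn
    rw [bracket, abs_of_nonneg hn']
    exact max_le (by linarith) (by linarith)

/-- Coercivity of the form of `L_u - λ`. -/
theorem half_norm_sq_le_re_pairing {K₀ : ℝ} (hK : IsProductConstant K₀) {u : SobolevLog (-1 / 2)}
    {u₀ : Sobolev 0} (hu : ‖u - l2ToLog u₀‖ < 1 / (4 * K₀)) {lamb : ℝ}
    (hl : lamb < -(1 + eta 39 ‖u₀‖)) (f : Hardy (1 / 2)) :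
    1 / 2 * ‖f‖ ^ 2 ≤ (pairing ((laxMap u - (lamb : ℂ) • halfToNegHalf) f) f).re := by
  have h1 : (laxMap u - (lamb : ℂ) • halfToNegHalf) f =
      derivOp f - (toeplitz (u - l2ToLog u₀) f + toeplitz (l2ToLog u₀) f) -
        (lamb : ℂ) • halfToNegHalf f := by
    rw [← toeplitzL_apply (u - _), map_sub]
    simp [toeplitzL_apply, laxMap]
  rw [h1, pairing_sub_left, pairing_sub_left, pairing_add_left, pairing_smul_left,
    pairing_halfToNegHalf, inner_self_eq_norm_sq_to_K]
  have h2 : ((lamb : ℂ) * ((‖halfToL2 f‖ : ℝ) : ℂ) ^ 2).re = lamb * ‖halfToL2 f‖ ^ 2 := by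
    rw [← Complex.ofReal_pow, ← Complex.ofReal_mul, Complex.ofReal_re]
  have h3 := norm_sq_le_re_pairing_derivOp f
  have h4 : ‖pairing (toeplitz (u - l2ToLog u₀) f) f‖ ≤ 1 / 4 * ‖f‖ ^ 2 := by
    have hK0 := hK.1
    have h5 := norm_toeplitz_le hK (u - l2ToLog u₀) f
    have h6 : K₀ * ‖u - l2ToLog u₀‖ ≤ 1 / 4 := by
      rw [lt_div_iff₀ (by positivity)] at hu
      linarith
    calc _ ≤ _ := norm_pairing_le _ _
      _ ≤ (1 / 4 * ‖f‖) * ‖f‖ := by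
        refine mul_le_mul_of_nonneg_right (h5.trans ?_) (norm_nonneg _)
        exact mul_le_mul_of_nonneg_right h6 (norm_nonneg _)
      _ = _ := by ring
  have hx := norm_nonneg u₀
  set x := ‖u₀‖
  -- This s gives 3x/s ≤ 1/4 and 3xs = 3x + 36x² ≤ 39x(1 + x), hence the constant 39. The two
  -- perturbations use up a quarter each, leaving 1/2.
  have h7 := norm_pairing_toeplitz_le u₀ f (s := 1 + 12 * x) (by linarith)
  have h8 : 3 * x * ((1 + 12 * x) * ‖halfToL2 f‖ ^ 2 + (1 + 12 * x)⁻¹ * ‖f‖ ^ 2) ≤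
      eta 39 x * ‖halfToL2 f‖ ^ 2 + 1 / 4 * ‖f‖ ^ 2 := by
    have h9 : 3 * x * (1 + 12 * x)⁻¹ ≤ 1 / 4 := by
      rw [← div_eq_mul_inv, div_le_iff₀ (by positivity)]
      linarith
    have h10 : 3 * x * (1 + 12 * x) ≤ eta 39 x := by
      rw [eta]
      nlinarith
    nlinarith [mul_le_mul_of_nonneg_right h9 (sq_nonneg ‖f‖),
      mul_le_mul_of_nonneg_right h10 (sq_nonneg ‖halfToL2 f‖)]
  have h11 := (abs_le.1 (Complex.abs_re_le_norm (pairing (toeplitz (u - l2ToLog u₀) f) f))).2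
  have h12 := (abs_le.1 (Complex.abs_re_le_norm (pairing (toeplitz (l2ToLog u₀) f) f))).2
  have h13 : (1 + eta 39 x) * ‖halfToL2 f‖ ^ 2 ≤ -lamb * ‖halfToL2 f‖ ^ 2 :=
    mul_le_mul_of_nonneg_right (by linarith) (sq_nonneg _)
  simp only [Complex.sub_re, Complex.add_re, Complex.coe_algebraMap, h2]
  nlinarith

theorem re_pairing_le {K₀ : ℝ} (hK : IsProductConstant K₀) (u : SobolevLog (-1 / 2)) (lamb : ℝ)
    (f : Hardy (1 / 2)) :
    (pairing ((laxMap u - (lamb : ℂ) • halfToNegHalf) f) f).re ≤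
      (1 + K₀ * ‖u‖ + |lamb|) * ‖f‖ ^ 2 := by
  refine (Complex.re_le_norm _).trans ((norm_pairing_le _ _).trans ?_)
  rw [sq, ← mul_assoc]
  refine mul_le_mul_of_nonneg_right ?_ (norm_nonneg _)
  have h1 : (laxMap u - (lamb : ℂ) • halfToNegHalf) f =
      derivOp f - toeplitz u f - (lamb : ℂ) • halfToNegHalf f := rfl
  rw [h1]
  refine (norm_sub_le _ _).trans ?_
  have h2 := norm_sub_le (derivOp f) (toeplitz u f)
  have h3 := norm_derivOp_le f
  have h4 := norm_toeplitz_le hK u f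
  have h5 : ‖(lamb : ℂ) • halfToNegHalf f‖ ≤ |lamb| * ‖f‖ := by
    rw [norm_smul, Complex.norm_real, Real.norm_eq_abs]
    exact mul_le_mul_of_nonneg_left (norm_halfToNegHalf_le f) (abs_nonneg _)
  linarith

/-! ### Hermitian symmetry -/

/-- Reality of u makes the matrix û(n - k) Hermitian; the rest is an exchange of the two summations.
-/
theorem pairing_toeplitz_symm (u : LogReal) (f g : Hardy (1 / 2)) :
    pairing (toeplitz (u : SobolevLog (-1 / 2)) f) g =
      conj (pairing (toeplitz (u : SobolevLog (-1 / 2)) g) f) := by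
  set v : SobolevLog (-1 / 2) := (u : SobolevLog (-1 / 2)) with hv
  -- Absolute convergence of the double series, from the trilinear estimate for the moduli of the
  -- coefficients.
  have hs : Summable fun p : ℤ × ℤ => v (p.1 - p.2) * f.1 p.2 * conj (g.1 p.1) := by
    obtain ⟨K, hK, hKle⟩ := exists_pairing_le
    have h := hKle (fun n => ‖v n‖ₑ) (fun n => ‖f.1 n‖ₑ) (fun n => ‖g.1 n‖ₑ)
    simp only [← ofReal_weight_log, tsum_enorm_sq] at h
    simp only [← ofReal_weight_half, tsum_enorm_sq] at h
    have h2 : ∑' n, (∑' k, ‖v (n - k)‖ₑ * ‖f.1 k‖ₑ) * ‖g.1 n‖ₑ ≠ ⊤ := by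
      intro h3
      rw [h3] at h
      rw [ENNReal.top_pow two_ne_zero] at h
      exact ENNReal.mul_ne_top (ENNReal.mul_ne_top (ENNReal.mul_ne_top hK ENNReal.ofReal_ne_top)
        ENNReal.ofReal_ne_top) ENNReal.ofReal_ne_top (top_le_iff.1 h)
    refine Summable.of_norm ?_
    have h4 : ∑' p : ℤ × ℤ, ‖v (p.1 - p.2) * f.1 p.2 * conj (g.1 p.1)‖ₑ ≠ ⊤ := by
      rw [ENNReal.tsum_prod']
      simpa only [enorm_mul, RCLike.enorm_conj, ENNReal.tsum_mul_right] using h2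
    exact (ENNReal.summable_toReal h4).congr fun p => toReal_enorm _
  have e1 : pairing (toeplitz v f) g = ∑' n, ∑' k, v (n - k) * f.1 k * conj (g.1 n) := by
    refine tsum_congr fun n => ?_
    rw [pairing_toeplitz_term, tsum_mul_right]
  have e2 : conj (pairing (toeplitz v g) f) =
      ∑' n, ∑' k, v (k - n) * f.1 n * conj (g.1 k) := by
    rw [pairing, Complex.conj_tsum]
    refine tsum_congr fun n => ?_
    rw [pairing_toeplitz_term, map_mul, Complex.conj_tsum, Complex.conj_conj, ← tsum_mul_right]
    refine tsum_congr fun k => ?_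
    rw [map_mul, ← u.2.2, neg_sub]
    ring
  rw [e1, e2]
  exact (Summable.tsum_comm (f := fun n k => v (n - k) * f.1 k * conj (g.1 n)) hs).symm

theorem pairing_laxMap_symm (u : LogReal) (f g : Hardy (1 / 2)) :
    pairing (laxMap (u : SobolevLog (-1 / 2)) f) g =
      conj (pairing (laxMap (u : SobolevLog (-1 / 2)) g) f) := by
  have h : pairing (derivOp f) g = conj (pairing (derivOp g) f) := by
    rw [pairing, pairing, Complex.conj_tsum]
    refine tsum_congr fun n => ?_
    change (n : ℂ) * f.1 n * conj (g.1 n) = conj ((n : ℂ) * g.1 n * conj (f.1 n))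
    simp only [map_mul, Complex.conj_conj, map_intCast]
    ring
  change pairing (derivOp f - toeplitz _ f) g = conj (pairing (derivOp g - toeplitz _ g) f)
  rw [pairing_sub_left, pairing_sub_left, map_sub, h, pairing_toeplitz_symm]

theorem pairing_shift_im (u : LogReal) (lamb : ℝ) (f : Hardy (1 / 2)) :
    (pairing ((laxMap (u : SobolevLog (-1 / 2)) - (lamb : ℂ) • halfToNegHalf) f) f).im = 0 := by
  refine Complex.conj_eq_iff_im.1 ?_
  change conj (pairing (laxMap _ f - (lamb : ℂ) • halfToNegHalf f) f) =
    pairing (laxMap _ f - (lamb : ℂ) • halfToNegHalf f) f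
  rw [pairing_sub_left, map_sub, ← pairing_laxMap_symm, pairing_smul_left, map_mul,
    Complex.conj_ofReal, pairing_halfToNegHalf, inner_conj_symm]

/-! ### The Lax-Milgram lemma -/

/-- Composition with the Riesz isometry gives an operator of the Hilbert space H^{1/2}_+ into itself
with the same coercive form, hence an invertible one. -/
theorem bijective_of_coercive (A : Hardy (1 / 2) →L[ℂ] Hardy (-1 / 2)) {c : ℝ} (hc : 0 < c)
    (h : ∀ f, c * ‖f‖ ^ 2 ≤ (pairing (A f) f).re) : Function.Bijective A := by
  let B : Hardy (1 / 2) →L[ℂ] Hardy (1 / 2) :=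
    (riesz.toContinuousLinearEquiv : Hardy (-1 / 2) →L[ℂ] Hardy (1 / 2)).comp A
  have hB : IsUnit B := by
    refine ContinuousLinearMap.isUnit_of_forall_le_norm_inner_map B (c := ⟨c, hc.le⟩) hc
      fun f => ?_
    have h1 := (h f).trans (Complex.re_le_norm _)
    rw [pairing_eq_inner, norm_inner_symm] at h1
    rw [mul_comm]
    exact h1
  rw [ContinuousLinearMap.isUnit_iff_bijective] at hB
  have h2 : (A : Hardy (1 / 2) → Hardy (-1 / 2)) = riesz.symm ∘ B := by
    ext1 f
    exact (riesz.symm_apply_apply (A f)).symm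
  rw [h2]
  exact riesz.symm.bijective.comp hB

/-! ### Approximation of potentials -/

/-- Truncation to a large finite set of frequencies, symmetrized under n ↦ -n so that the truncated
potential is still real-valued. -/
theorem exists_l2Real_near (u : LogReal) {ε : ℝ} (hε : 0 < ε) :
    ∃ u₀ : L2Real, ‖(u : SobolevLog (-1 / 2)) - l2ToLog u₀‖ < ε := by
  set v : SobolevLog (-1 / 2) := (u : SobolevLog (-1 / 2))
  set W := (sobolevLogWeight (-1 / 2)).toFun
  have h1 : ∀ᶠ s : Finset ℤ in Filter.atTop,
      ‖v‖ ^ 2 - ε ^ 2 < ∑ n ∈ s, W n * ‖v n‖ ^ 2 :=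
    v.hasSum_norm_sq.eventually (lt_mem_nhds (by linarith [sq_pos_of_pos hε]))
  obtain ⟨s, hs⟩ := Filter.eventually_atTop.1 h1
  set t : Finset ℤ := s ∪ s.image (fun n => -n) with ht
  have hsym : ∀ n, -n ∈ t ↔ n ∈ t := by
    intro n
    simp only [ht, Finset.mem_union, Finset.mem_image]
    constructor
    · rintro (h | ⟨m, hm, hmn⟩)
      · exact Or.inr ⟨-n, h, neg_neg n⟩
      · exact Or.inl (neg_injective hmn ▸ hm)
    · rintro (h | ⟨m, hm, rfl⟩)
      · exact Or.inr ⟨n, h, rfl⟩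
      · exact Or.inl (by rwa [neg_neg])
  have h2 := hs t Finset.subset_union_left
  let w₀ : Sobolev 0 := WSobolev.mk (fun n => if n ∈ t then v n else 0)
    (summable_of_hasFiniteSupport (t.finite_toSet.subset (by
      intro n hn
      by_contra h
      exact hn (by simp [show n ∉ t from h]))))
  have hw : ∀ n, w₀ n = if n ∈ t then v n else 0 := fun n => rfl
  refine ⟨⟨w₀, ?_, fun n => ?_⟩, ?_⟩
  · rw [hw, u.2.1]
    simp
  · simp only [hw, hsym]
    split_ifs
    · exact u.2.2 n
    · simp
  · have h3 : ∀ n, (v - l2ToLog w₀) n = if n ∈ t then 0 else v n := fun n => by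
      rw [WSobolev.sub_apply]
      change v n - (if n ∈ t then v n else 0) = _
      split_ifs <;> simp
    have h4 : HasSum (fun n => W n * ‖(v - l2ToLog w₀) n‖ ^ 2)
        (‖v‖ ^ 2 - ∑ n ∈ t, W n * ‖v n‖ ^ 2) := by
      have h5 := v.hasSum_norm_sq.sub
        (hasSum_sum_of_ne_finset_zero (s := t)
          (f := fun n => if n ∈ t then W n * ‖v n‖ ^ 2 else 0) (fun n hn => if_neg hn))
      rw [Finset.sum_congr rfl fun n hn => if_pos hn] at h5
      refine h5.congr_fun fun n => ?_
      rw [h3]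
      split_ifs <;> simp [W]
    have h6 := h4.unique (v - l2ToLog w₀).hasSum_norm_sq
    refine (abs_lt_of_sq_lt_sq' ?_ hε.le).2
    rw [← h6]
    linarith

/-- The form of `L_u - λ` is coercive. -/
theorem exists_coercive (u : LogReal) : ∃ lamb : ℝ, ∀ f : Hardy (1 / 2),
    1 / 2 * ‖f‖ ^ 2 ≤
      (pairing ((laxMap (u : SobolevLog (-1 / 2)) - (lamb : ℂ) • halfToNegHalf) f) f).re := by
  obtain ⟨K, hK⟩ := exists_isProductConstant
  have hK0 := hK.1
  obtain ⟨u₀, hu₀⟩ := exists_l2Real_near u (ε := 1 / (4 * K)) (by positivity)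
  exact ⟨-(1 + eta 39 ‖(u₀ : Sobolev 0)‖) - 1,
    half_norm_sq_le_re_pairing hK hu₀ (by linarith)⟩

end

end LaxLog

namespace LaxLog

noncomputable section

/-! ### Symmetric operators with compact resolvent -/

section Abstract

variable {E : Type*} [NormedAddCommGroup E] [InnerProductSpace ℂ E]

theorem mem_kerPow_succ {A : E →ₗ.[ℂ] E} {μ : ℂ} {k : ℕ} {x : E} :
    x ∈ kerPow A μ (k + 1) ↔ ∃ h : x ∈ A.domain, A ⟨x, h⟩ - μ • x ∈ kerPow A μ k := by
  constructor
  · rintro ⟨y, hy, rfl⟩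
    exact ⟨y.2, hy⟩
  · rintro ⟨h, hx⟩
    exact ⟨⟨x, h⟩, hx, rfl⟩

theorem mem_kerPow_one {A : E →ₗ.[ℂ] E} {μ : ℂ} {x : E} :
    x ∈ kerPow A μ 1 ↔ ∃ h : x ∈ A.domain, A ⟨x, h⟩ = μ • x := by
  rw [mem_kerPow_succ]
  exact exists_congr fun h => sub_eq_zero

theorem isEigenvalue_iff {A : E →ₗ.[ℂ] E} {μ : ℂ} :
    IsEigenvalue A μ ↔ ∃ x ≠ 0, x ∈ kerPow A μ 1 := by
  constructor
  · rintro ⟨x, hx, h⟩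
    exact ⟨x, hx, mem_kerPow_one.2 ⟨x.2, h⟩⟩
  · rintro ⟨x, hx, h⟩
    obtain ⟨h1, h2⟩ := mem_kerPow_one.1 h
    exact ⟨⟨x, h1⟩, hx, h2⟩

/-- Symmetry excludes Jordan chains: if y = (A - μ)x and (A - μ)y = 0, then ⟨y, y⟩ = ⟨x, (A - μ)y⟩ =
0. -/
theorem kerPow_succ_le_kerPow_one {A : E →ₗ.[ℂ] E} (hA : A.IsFormalAdjoint A) (μ : ℝ) (k : ℕ) :
    kerPow A μ (k + 1) ≤ kerPow A μ 1 := by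
  induction k with
  | zero => exact le_rfl
  | succ k ih =>
    intro x hx
    obtain ⟨h, hx⟩ := mem_kerPow_succ.1 hx
    obtain ⟨h', hy⟩ := mem_kerPow_one.1 (ih hx)
    refine mem_kerPow_one.2 ⟨h, ?_⟩
    rw [← sub_eq_zero]
    set y := A ⟨x, h⟩ - (μ : ℂ) • x with hydef
    have h1 := hA ⟨x, h⟩ ⟨y, h'⟩
    have h2 : inner ℂ y y = 0 := by
      calc inner ℂ y y = inner ℂ (A ⟨x, h⟩) y - inner ℂ ((μ : ℂ) • x) y := by
            rw [← inner_sub_left]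
        _ = 0 := by
            rw [h1, hy, inner_smul_left, inner_smul_right, Complex.conj_ofReal, sub_self]
    exact inner_self_eq_zero.1 h2

theorem rootSpace_eq_kerPow_one {A : E →ₗ.[ℂ] E} (hA : A.IsFormalAdjoint A) (μ : ℝ) :
    rootSpace A μ = kerPow A μ 1 := by
  refine le_antisymm (iSup_le fun k => ?_) (le_iSup (kerPow A (μ : ℂ)) 1)
  cases k with
  | zero => exact bot_le
  | succ k => exact kerPow_succ_le_kerPow_one hA μ k

theorem im_eq_zero_of_isEigenvalue {A : E →ₗ.[ℂ] E} (hA : A.IsFormalAdjoint A) {μ : ℂ}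
    (h : IsEigenvalue A μ) : (μ.re : ℂ) = μ := by
  obtain ⟨x, hx, hAx⟩ := h
  have h1 := hA x x
  rw [hAx, inner_smul_left, inner_smul_right] at h1
  exact Complex.conj_eq_iff_re.1 (mul_right_cancel₀ (inner_self_ne_zero.2 hx) h1)

theorem opSpectrum_of_isEigenvalue {A : E →ₗ.[ℂ] E} {μ : ℂ} (h : IsEigenvalue A μ) :
    μ ∈ opSpectrum A := by
  rintro ⟨R, hR⟩
  obtain ⟨x, hx, hAx⟩ := h
  have h1 := hR.2 x
  rw [hAx, sub_self, map_zero] at h1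
  exact hx h1.symm

theorem IsResolvent.injective {A : E →ₗ.[ℂ] E} {μ : ℂ} {R : E →L[ℂ] E} (hR : IsResolvent A μ R)
    {x : E} (hx : R x = 0) : x = 0 := by
  obtain ⟨h, h1⟩ := hR.1 x
  have h2 : (⟨R x, h⟩ : A.domain) = 0 := Subtype.ext hx
  rw [h2, LinearPMap.map_zero, hx, smul_zero, sub_zero] at h1
  exact h1.symm

theorem IsResolvent.isSymmetric {A : E →ₗ.[ℂ] E} (hA : A.IsFormalAdjoint A) {μ : ℝ}
    {R : E →L[ℂ] E} (hR : IsResolvent A μ R) : (R : E →ₗ[ℂ] E).IsSymmetric := by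
  intro x y
  obtain ⟨hx, hx'⟩ := hR.1 x
  obtain ⟨hy, hy'⟩ := hR.1 y
  have h1 := hA ⟨R x, hx⟩ ⟨R y, hy⟩
  change inner ℂ (R x) y = inner ℂ x (R y)
  calc inner ℂ (R x) y = inner ℂ (R x) (A ⟨R y, hy⟩ - (μ : ℂ) • R y) := by rw [hy']
    _ = inner ℂ (A ⟨R x, hx⟩ - (μ : ℂ) • R x) (R y) := by
      rw [inner_sub_right, inner_sub_left, ← h1, inner_smul_left, inner_smul_right,
        Complex.conj_ofReal]
    _ = _ := by rw [hx']

/-- Spectral mapping under ν ↦ (ν - μ)⁻¹; it carries questions about A over to the bounded operator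
R. -/
theorem IsResolvent.eigen_iff {A : E →ₗ.[ℂ] E} {μ ν : ℂ} (hν : ν ≠ μ) {R : E →L[ℂ] E}
    (hR : IsResolvent A μ R) (x : E) :
    x ∈ kerPow A ν 1 ↔ R x = (ν - μ)⁻¹ • x := by
  have h0 : ν - μ ≠ 0 := sub_ne_zero.2 hν
  rw [mem_kerPow_one]
  constructor
  · rintro ⟨h, hx⟩
    have h1 := hR.2 ⟨x, h⟩
    rw [hx, ← sub_smul, map_smul] at h1
    rw [eq_inv_smul_iff₀ h0]
    exact h1
  · intro hx
    obtain ⟨h, h1⟩ := hR.1 ((ν - μ) • x)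
    have h2 : R ((ν - μ) • x) = x := by rw [map_smul, hx, smul_inv_smul₀ h0]
    have hxd : x ∈ A.domain := by rwa [h2] at h
    have h3 : (⟨R ((ν - μ) • x), h⟩ : A.domain) = ⟨x, hxd⟩ := Subtype.ext h2
    rw [h3, h2, sub_smul] at h1
    exact ⟨hxd, sub_left_injective h1⟩

/-- If x is orthogonal to the domain, then 0 = ⟨R(Rx), x⟩ = ‖Rx‖², and R is injective. -/
theorem IsResolvent.dense_domain [CompleteSpace E] {A : E →ₗ.[ℂ] E} (hA : A.IsFormalAdjoint A)
    {μ : ℝ} {R : E →L[ℂ] E} (hR : IsResolvent A μ R) : Dense (A.domain : Set E) := by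
  rw [Submodule.dense_iff_topologicalClosure_eq_top, Submodule.topologicalClosure_eq_top_iff,
    Submodule.eq_bot_iff]
  intro x hx
  refine hR.injective ((inner_self_eq_zero (𝕜 := ℂ)).1 ?_)
  have h1 := hx (R (R x)) (hR.1 (R x)).1
  rwa [show inner ℂ (R (R x)) x = inner ℂ (R x) (R x) from hR.isSymmetric hA (R x) x] at h1

/-- A real point in the resolvent set leaves the adjoint no room: symmetry of R gives R(A*y - μy) =
y, so y already lies in the range of R, which is contained in the domain of A. -/
theorem IsResolvent.isSelfAdjoint [CompleteSpace E] {A : E →ₗ.[ℂ] E} (hA : A.IsFormalAdjoint A)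
    {μ : ℝ} {R : E →L[ℂ] E} (hR : IsResolvent A μ R) : IsSelfAdjoint A := by
  have hd := hR.dense_domain hA
  rw [LinearPMap.isSelfAdjoint_def]
  refine le_antisymm ?_ (hA.le_adjoint hd)
  have key : ∀ y : A.adjoint.domain, R (A.adjoint y - (μ : ℂ) • (y : E)) = y := by
    intro y
    refine ext_inner_right ℂ fun w => ?_
    obtain ⟨h, hw⟩ := hR.1 w
    have h1 := LinearPMap.adjoint_isFormalAdjoint hd y ⟨R w, h⟩
    calc inner ℂ (R (A.adjoint y - (μ : ℂ) • (y : E))) w =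
          inner ℂ (A.adjoint y - (μ : ℂ) • (y : E)) (R w) := hR.isSymmetric hA _ _
      _ = inner ℂ (y : E) (A ⟨R w, h⟩ - (μ : ℂ) • R w) := by
        rw [inner_sub_left, h1, inner_sub_right, inner_smul_left, inner_smul_right,
          Complex.conj_ofReal]
      _ = _ := by rw [hw]
  refine ⟨fun y hy => ?_, fun y x hyx => ?_⟩
  · have h1 := (hR.1 (A.adjoint ⟨y, hy⟩ - (μ : ℂ) • y)).1
    rwa [key ⟨y, hy⟩] at h1
  · obtain ⟨h1, h2⟩ := hR.1 (A.adjoint y - (μ : ℂ) • (y : E))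
    have h3 : (⟨R (A.adjoint y - (μ : ℂ) • (y : E)), h1⟩ : A.domain) = x :=
      Subtype.ext ((key y).trans hyx)
    rw [h3, key y] at h2
    exact (sub_left_injective h2).symm

/-- In this form, with R outermost, compactness of one resolvent passes to every other. -/
theorem IsResolvent.identity {A : E →ₗ.[ℂ] E} {μ ν : ℂ} {R S : E →L[ℂ] E}
    (hR : IsResolvent A μ R) (hS : IsResolvent A ν S) (x : E) :
    S x = R (x + (ν - μ) • S x) := by
  obtain ⟨h, hx⟩ := hS.1 x
  refine (hR.2 ⟨S x, h⟩).symm.trans (congrArg R ?_)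
  change A ⟨S x, h⟩ - μ • S x = x + (ν - μ) • S x
  nth_rewrite 3 [← hx]
  module

theorem IsResolvent.hasCompactResolvent {A : E →ₗ.[ℂ] E} {μ : ℂ} {R : E →L[ℂ] E}
    (hR : IsResolvent A μ R) (hc : IsCompactOperator R) : HasCompactResolvent A := by
  refine ⟨⟨μ, R, hR⟩, fun ν S hS => ?_⟩
  have h : (S : E → E) = R ∘ (ContinuousLinearMap.id ℂ E + (ν - μ) • S : E →L[ℂ] E) := by
    ext1 x
    exact hR.identity hS x
  rw [h]
  exact hc.comp_clm _

/-- Fredholm alternative for R at c = (ν - μ)⁻¹: either c is an eigenvalue of R and ν one of A, or c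
- R is invertible and (A - ν)⁻¹ = c R (c - R)⁻¹. -/
theorem IsResolvent.exists_of_not_isEigenvalue [CompleteSpace E] {A : E →ₗ.[ℂ] E} {μ ν : ℂ}
    {R : E →L[ℂ] E} (hR : IsResolvent A μ R) (hc : IsCompactOperator R)
    (hν : ¬ IsEigenvalue A ν) : ∃ S, IsResolvent A ν S := by
  rcases eq_or_ne ν μ with rfl | hne
  · exact ⟨R, hR⟩
  have h0 : ν - μ ≠ 0 := sub_ne_zero.2 hne
  have hc0 := inv_ne_zero h0
  rcases hc.hasEigenvalue_or_mem_resolventSet hc0 with h | h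
  · obtain ⟨x, hx⟩ := h.exists_hasEigenvector
    exact absurd (isEigenvalue_iff.2 ⟨x, hx.2, (hR.eigen_iff hne x).2 hx.apply_eq_smul⟩) hν
  obtain ⟨U, hU⟩ := spectrum.mem_resolventSet_iff.1 h
  set S : E →L[ℂ] E := ↑U⁻¹ with hS
  have hU1 : ∀ x, (ν - μ)⁻¹ • S x - R (S x) = x := fun x => by
    have h1 := U.mul_inv
    rw [hU] at h1
    exact congrArg (fun T : E →L[ℂ] E => T x) h1
  have hU2 : ∀ x, S ((ν - μ)⁻¹ • x - R x) = x := fun x => by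
    have h1 := U.inv_mul
    rw [hU] at h1
    exact congrArg (fun T : E →L[ℂ] E => T x) h1
  refine ⟨(ν - μ)⁻¹ • R.comp S, fun x => ?_, fun x => ?_⟩
  · obtain ⟨h1, h2⟩ := hR.1 ((ν - μ)⁻¹ • S x)
    have h3 : ((ν - μ)⁻¹ • R.comp S) x = R ((ν - μ)⁻¹ • S x) := by simp
    simp only [h3]
    refine ⟨h1, ?_⟩
    have h4 : A ⟨R ((ν - μ)⁻¹ • S x), h1⟩ = (ν - μ)⁻¹ • S x + μ • R ((ν - μ)⁻¹ • S x) :=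
      sub_eq_iff_eq_add.1 h2
    rw [h4]
    calc _ = (ν - μ)⁻¹ • S x - (ν - μ) • R ((ν - μ)⁻¹ • S x) := by module
      _ = (ν - μ)⁻¹ • S x - R (S x) := by rw [map_smul, smul_inv_smul₀ h0]
      _ = x := hU1 x
  · have h1 := hR.2 x
    have h3 : A x - ν • (x : E) =
        (ν - μ) • ((ν - μ)⁻¹ • (A x - μ • (x : E)) - R (A x - μ • (x : E))) := by
      rw [h1, smul_sub, smul_inv_smul₀ h0]
      module
    rw [h3]
    change (ν - μ)⁻¹ • R (S _) = _
    rw [map_smul, hU2, map_smul, h1, inv_smul_smul₀ h0]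

theorem IsResolvent.opSpectrum_eq [CompleteSpace E] {A : E →ₗ.[ℂ] E} {μ : ℂ}
    {R : E →L[ℂ] E} (hR : IsResolvent A μ R) (hc : IsCompactOperator R) :
    opSpectrum A = {ν | IsEigenvalue A ν} := by
  ext ν
  refine ⟨fun h => ?_, opSpectrum_of_isEigenvalue⟩
  by_contra h1
  exact h (hR.exists_of_not_isEigenvalue hc h1)

/-- The eigenspaces of the compact symmetric R span a dense subspace. Since R is injective, an
eigenvalue t is nonzero and corresponds to the eigenvalue μ + 1/t of A, which is real. -/
theorem IsResolvent.eq_zero_of_orthogonal [CompleteSpace E] {A : E →ₗ.[ℂ] E}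
    (hA : A.IsFormalAdjoint A) {μ : ℝ} {R : E →L[ℂ] E} (hR : IsResolvent A μ R)
    (hc : IsCompactOperator R) {x : E}
    (hx : ∀ (ν : ℝ) (y : E), y ∈ kerPow A ν 1 → inner ℂ y x = 0) : x = 0 := by
  have hs := hR.isSymmetric hA
  have h1 := ContinuousLinearMap.orthogonalComplement_iSup_eigenspaces_eq_bot hc hs
  rw [Submodule.eq_bot_iff] at h1
  refine h1 x ?_
  rw [← Submodule.iInf_orthogonal, Submodule.mem_iInf]
  intro t y hy
  rw [Module.End.mem_eigenspace_iff] at hy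
  have hy' : R y = t • y := hy
  by_cases hy0 : y = 0
  · rw [hy0, inner_zero_left]
  have ht : t ≠ 0 := by
    rintro rfl
    rw [zero_smul] at hy'
    exact hy0 (hR.injective hy')
  have hne : μ + t⁻¹ ≠ (μ : ℂ) := by simpa using ht
  have h2 : y ∈ kerPow A (μ + t⁻¹) 1 := (hR.eigen_iff hne y).2 (by simpa using hy')
  have h3 := im_eq_zero_of_isEigenvalue hA (isEigenvalue_iff.2 ⟨y, hy0, h2⟩)
  rw [← h3] at h2
  exact hx _ y h2

/-! ### Sums of eigenspaces of compact symmetric operators -/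

theorem inner_self_eq_ofReal (x : E) : inner ℂ x x = ((‖x‖ ^ 2 : ℝ) : ℂ) := by
  rw [inner_self_eq_norm_sq_to_K]
  push_cast
  rfl

theorem inner_sum_smul_of_orthogonal {ι : Type*} (s : Finset ι) (f : ι → E) (a : ι → ℝ)
    (h : ∀ i j, i ≠ j → inner ℂ (f i) (f j) = 0) :
    inner ℂ (∑ i ∈ s, f i) (∑ i ∈ s, (a i : ℂ) • f i) = ((∑ i ∈ s, a i * ‖f i‖ ^ 2 : ℝ) : ℂ) := by
  rw [sum_inner, Complex.ofReal_sum]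
  refine Finset.sum_congr rfl fun i hi => ?_
  rw [inner_sum, Finset.sum_eq_single i (fun j _ hj => by rw [inner_smul_right, h i j hj.symm,
    mul_zero]) (fun h => absurd hi h), inner_smul_right, inner_self_eq_ofReal, Complex.ofReal_mul]

theorem norm_sum_sq_of_orthogonal {ι : Type*} (s : Finset ι) (f : ι → E)
    (h : ∀ i j, i ≠ j → inner ℂ (f i) (f j) = 0) :
    ‖∑ i ∈ s, f i‖ ^ 2 = ∑ i ∈ s, ‖f i‖ ^ 2 := by
  have h1 := inner_sum_smul_of_orthogonal s f 1 h
  simp only [Pi.one_apply, Complex.ofReal_one, one_smul, one_mul] at h1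
  rw [inner_self_eq_ofReal] at h1
  exact Complex.ofReal_injective h1

/-- The sum of the eigenspaces of `T` for the real eigenvalues in `S`. -/
def eigenSum (T : E →L[ℂ] E) (S : Set ℝ) : Submodule ℂ E :=
  ⨆ s : S, Module.End.eigenspace (T : E →ₗ[ℂ] E) ((s : ℝ) : ℂ)

theorem apply_mem_eigenSum {T : E →L[ℂ] E} {S : Set ℝ} {x : E} (hx : x ∈ eigenSum T S) :
    T x ∈ eigenSum T S := by
  induction hx using Submodule.iSup_induction' with
  | mem s x hx =>
    rw [Module.End.mem_eigenspace_iff] at hx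
    have hx' : T x = (s : ℂ) • x := hx
    rw [hx']
    refine Submodule.smul_mem _ _ (Submodule.mem_iSup_of_mem s ?_)
    rwa [Module.End.mem_eigenspace_iff]
  | zero => simp
  | add x y _ _ hx hy =>
    rw [map_add]
    exact add_mem hx hy

theorem mul_norm_sq_le_of_mem_eigenSum {T : E →L[ℂ] E} (hT : (T : E →ₗ[ℂ] E).IsSymmetric)
    {S : Set ℝ} {t : ℝ} (hS : ∀ s ∈ S, t ≤ s) {x : E} (hx : x ∈ eigenSum T S) :
    t * ‖x‖ ^ 2 ≤ (inner ℂ x (T x)).re := by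
  obtain ⟨f, hf, rfl⟩ := (Submodule.mem_iSup_iff_exists_finsupp _ _).1 hx
  have hT' : T (f.sum fun _ x => x) = ∑ s ∈ f.support, ((s : ℝ) : ℂ) • f s := by
    rw [Finsupp.sum, map_sum]
    exact Finset.sum_congr rfl fun s _ => Module.End.mem_eigenspace_iff.1 (hf s)
  have horth : ∀ i j, i ≠ j → inner ℂ (f i) (f j) = 0 := fun i j hij =>
    hT.orthogonalFamily_eigenspaces (by simpa [Subtype.ext_iff] using hij) ⟨f i, hf i⟩ ⟨f j, hf j⟩
  rw [hT', Finsupp.sum, inner_sum_smul_of_orthogonal _ _ _ horth,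
    norm_sum_sq_of_orthogonal _ _ horth, Complex.ofReal_re, Finset.mul_sum]
  exact Finset.sum_le_sum fun s _ => mul_le_mul_of_nonneg_right (hS s s.2) (sq_nonneg _)

/-- On the closure of the sum, T is bounded below by t > 0, hence invertible as well as compact. The
identity there is then compact, which forces finite dimension. -/
theorem finiteDimensional_eigenSum [CompleteSpace E] {T : E →L[ℂ] E}
    (hT : (T : E →ₗ[ℂ] E).IsSymmetric) (hc : IsCompactOperator T) {S : Set ℝ} {t : ℝ} (ht : 0 < t)
    (hS : ∀ s ∈ S, t ≤ s) : FiniteDimensional ℂ (eigenSum T S) := by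
  set K := (eigenSum T S).topologicalClosure with hK
  have hKc : IsClosed (K : Set E) := Submodule.isClosed_topologicalClosure _
  have : CompleteSpace K := hKc.completeSpace_coe
  have hinv : ∀ x ∈ K, (T : E →ₗ[ℂ] E) x ∈ K := by
    intro x hx
    have h1 : Set.MapsTo T (eigenSum T S : Set E) (eigenSum T S : Set E) :=
      fun x hx => apply_mem_eigenSum hx
    exact h1.closure T.continuous hx
  have hlow : ∀ x ∈ K, t * ‖x‖ ^ 2 ≤ (inner ℂ x (T x)).re := by
    intro x hx
    have hcl : IsClosed {x : E | t * ‖x‖ ^ 2 ≤ (inner ℂ x (T x)).re} :=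
      isClosed_le (by fun_prop) (by fun_prop)
    exact closure_minimal (fun x hx => mul_norm_sq_le_of_mem_eigenSum hT hS hx) hcl hx
  let T' : K →L[ℂ] K := T.restrict hinv
  have hc' : IsCompactOperator T' := hc.restrict' hinv
  have hu : IsUnit T' := by
    refine ContinuousLinearMap.isUnit_of_forall_le_norm_inner_map T' (c := ⟨t, ht.le⟩) ht
      fun x => ?_
    rw [norm_inner_symm, mul_comm]
    exact (hlow x x.2).trans (Complex.re_le_norm _)
  obtain ⟨U, hU⟩ := hu
  have hid : IsCompactOperator (id : K → K) := by
    have h1 := hc'.clm_comp (↑U⁻¹ : K →L[ℂ] K)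
    have h2 : ((↑U⁻¹ : K →L[ℂ] K) : K → K) ∘ T' = id := by
      ext1 x
      have h3 := U.inv_mul
      rw [hU] at h3
      exact congrArg (fun T : K →L[ℂ] K => T x) h3
    rwa [h2] at h1
  have : FiniteDimensional ℂ K := (isCompactOperator_id_iff_finiteDimensional (𝕜 := ℂ)).1 hid
  exact Submodule.finiteDimensional_of_le (Submodule.le_topologicalClosure _)

/-- On the orthogonal complement, which T preserves, the norm of T is its spectral radius. A nonzero
spectral value there is an eigenvalue of T, nonnegative by `hpos`; if it exceeded t, its eigenvector
would lie in the sum and be orthogonal to it. -/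
theorem inner_le_of_orthogonal_eigenSum [CompleteSpace E] {T : E →L[ℂ] E}
    (hT : (T : E →ₗ[ℂ] E).IsSymmetric) (hc : IsCompactOperator T)
    (hpos : ∀ x, 0 ≤ (inner ℂ x (T x)).re) {t : ℝ} (ht : 0 ≤ t) {x : E}
    (hx : x ∈ (eigenSum T (Set.Ioi t))ᗮ) : (inner ℂ x (T x)).re ≤ t * ‖x‖ ^ 2 := by
  set K := (eigenSum T (Set.Ioi t))ᗮ with hK
  have hinv : ∀ x ∈ K, (T : E →ₗ[ℂ] E) x ∈ K := by
    intro x hx y hy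
    have h1 := hx (T y) (apply_mem_eigenSum hy)
    rwa [show inner ℂ (T y) x = inner ℂ y (T x) from hT y x] at h1
  let T' : K →L[ℂ] K := T.restrict hinv
  have hc' : IsCompactOperator T' := hc.restrict' hinv
  have hs' : (T' : K →ₗ[ℂ] K).IsSymmetric := hT.restrict_invariant hinv
  lift t to NNReal using ht
  have hn : ‖T'‖₊ ≤ t := by
    rw [← ENNReal.coe_le_coe, ← T'.spectralRadius_eq_nnnorm hs'.isSelfAdjoint, spectralRadius]
    refine iSup₂_le fun k hk => ?_
    rw [ENNReal.coe_le_coe]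
    change ‖k‖ ≤ t
    rcases eq_or_ne k 0 with rfl | hk0
    · simp
    have hev := (hc'.hasEigenvalue_iff_mem_spectrum hk0).2 hk
    obtain ⟨y, hy⟩ := hev.exists_hasEigenvector
    have hk1 : (k.re : ℂ) = k := Complex.conj_eq_iff_re.1 (hs'.conj_eigenvalue_eq_self hev)
    have hy1 : T (y : E) = (k.re : ℂ) • (y : E) := by
      rw [hk1]
      exact congrArg Subtype.val hy.apply_eq_smul
    have hy0 : (y : E) ≠ 0 := fun h => hy.2 (Subtype.ext h)
    have hyp : 0 < ‖(y : E)‖ ^ 2 := by positivity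
    have hk2 : 0 ≤ k.re := by
      have h1 := hpos y
      rw [hy1, inner_smul_right, inner_self_eq_ofReal, ← Complex.ofReal_mul, Complex.ofReal_re] at h1
      exact nonneg_of_mul_nonneg_left h1 hyp
    rw [← hk1, Complex.norm_real, Real.norm_of_nonneg hk2]
    by_contra h
    have h2 : (y : E) ∈ eigenSum T (Set.Ioi t) :=
      Submodule.mem_iSup_of_mem (⟨k.re, not_le.1 h⟩ : Set.Ioi (t : ℝ))
        (Module.End.mem_eigenspace_iff.2 hy1)
    exact hy0 (inner_self_eq_zero.1 (y.2 y h2))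
  have h1 : ‖T x‖ ≤ t * ‖x‖ := T'.le_of_opNorm_le hn ⟨x, hx⟩
  calc _ ≤ _ := Complex.re_le_norm _
    _ ≤ ‖x‖ * ‖T x‖ := norm_inner_le_norm _ _
    _ ≤ ‖x‖ * (t * ‖x‖) := mul_le_mul_of_nonneg_left h1 (norm_nonneg _)
    _ = _ := by ring

end Abstract

end

end LaxLog

namespace LaxLog

noncomputable section

/-! ### The operators `L_u^sym` and `L_u` and their eigenfunctions -/

theorem laxSym_spec (u : SobolevLog (-1 / 2)) (x : (laxSym u).domain) :
    ∃ f : Hardy (1 / 2), halfToL2 f = x ∧ laxMap u f = l2ToNegHalf (laxSym u x) := by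
  obtain ⟨_, f, hf, rfl⟩ := x
  exact ⟨f, rfl, (laxSym_apply u f hf).symm⟩

theorem laxSym_of_laxMap_eq {u : SobolevLog (-1 / 2)} {f : Hardy (1 / 2)} {g : Hardy 0}
    (h : laxMap u f = l2ToNegHalf g) :
    ∃ hf : halfToL2 f ∈ (laxSym u).domain, laxSym u ⟨halfToL2 f, hf⟩ = g :=
  ⟨Submodule.mem_map_of_mem ⟨g, h.symm⟩,
    l2ToNegHalf_injective ((laxSym_apply u f ⟨g, h.symm⟩).trans h)⟩

theorem laxOp_spec (u : SobolevLog (-1 / 2)) (x : (laxOp u).domain) :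
    ∃ f : Hardy (1 / 2), halfToNegHalf f = x ∧ laxMap u f = laxOp u x := by
  obtain ⟨_, f, rfl⟩ := x
  exact ⟨f, rfl, (laxOp_apply u f).symm⟩

/-- The eigenfunctions of `L_u`, in `H^{1/2}_+`. -/
def eigenHalf (u : SobolevLog (-1 / 2)) (μ : ℂ) : Submodule ℂ (Hardy (1 / 2)) :=
  LinearMap.ker (laxMap u - μ • halfToNegHalf)

theorem mem_eigenHalf {u : SobolevLog (-1 / 2)} {μ : ℂ} {f : Hardy (1 / 2)} :
    f ∈ eigenHalf u μ ↔ laxMap u f = μ • halfToNegHalf f := by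
  rw [eigenHalf, LinearMap.mem_ker, LinearMap.sub_apply, LinearMap.smul_apply, sub_eq_zero]

theorem mem_kerPow_laxSym {u : SobolevLog (-1 / 2)} {μ : ℂ} {x : Hardy 0} :
    x ∈ kerPow (laxSym u) μ 1 ↔ ∃ f ∈ eigenHalf u μ, halfToL2 f = x := by
  rw [mem_kerPow_one]
  constructor
  · rintro ⟨h, hx⟩
    obtain ⟨f, hf, hf'⟩ := laxSym_spec u ⟨x, h⟩
    refine ⟨f, mem_eigenHalf.2 ?_, hf⟩
    rw [hf', hx, map_smul, ← l2ToNegHalf_halfToL2, hf]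
  · rintro ⟨f, hf, rfl⟩
    refine laxSym_of_laxMap_eq ?_
    rw [mem_eigenHalf.1 hf, map_smul, l2ToNegHalf_halfToL2]

/-- Regularity along root vectors: if y is in H^{1/2}_+ and (L_u - μ)y is in L²_+, then L_u y is in
L²_+, so y belongs to the smaller domain. -/
theorem map_kerPow_laxSym (u : SobolevLog (-1 / 2)) (μ : ℂ) (k : ℕ) :
    (kerPow (laxSym u) μ k).map l2ToNegHalf = kerPow (laxOp u) μ k := by
  induction k with
  | zero => exact Submodule.map_bot _
  | succ k ih =>
    ext y
    constructor
    · rintro ⟨x, hx, rfl⟩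
      obtain ⟨h, hx⟩ := mem_kerPow_succ.1 hx
      obtain ⟨f, hf, hf'⟩ := laxSym_spec u ⟨x, h⟩
      have hx' : halfToL2 f = x := hf
      refine mem_kerPow_succ.2 ⟨⟨f, congrArg l2ToNegHalf hx'⟩, ?_⟩
      have h1 : (⟨l2ToNegHalf x, ⟨f, congrArg l2ToNegHalf hx'⟩⟩ : (laxOp u).domain) =
          ⟨halfToNegHalf f, LinearMap.mem_range_self _ f⟩ :=
        Subtype.ext (congrArg l2ToNegHalf hx').symm
      rw [h1, laxOp_apply, hf', ← map_smul, ← map_sub, ← ih]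
      exact Submodule.mem_map_of_mem hx
    · intro hy
      obtain ⟨h, hy⟩ := mem_kerPow_succ.1 hy
      rw [← ih] at hy
      obtain ⟨f, hf, hf'⟩ := laxOp_spec u ⟨y, h⟩
      obtain ⟨z, hz, hz'⟩ := hy
      have hf2 : halfToNegHalf f = y := hf
      have h1 : laxMap u f = l2ToNegHalf (z + μ • halfToL2 f) := by
        rw [map_add, map_smul, l2ToNegHalf_halfToL2, hz', hf', hf2, sub_add_cancel]
      obtain ⟨hd, h2⟩ := laxSym_of_laxMap_eq h1
      refine ⟨halfToL2 f, mem_kerPow_succ.2 ⟨hd, ?_⟩, hf⟩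
      rw [h2, add_sub_cancel_right]
      exact hz

theorem map_rootSpace_laxSym (u : SobolevLog (-1 / 2)) (μ : ℂ) :
    (rootSpace (laxSym u) μ).map l2ToNegHalf = rootSpace (laxOp u) μ := by
  rw [rootSpace, rootSpace, Submodule.map_iSup]
  exact iSup_congr fun k => map_kerPow_laxSym u μ k

theorem isEigenvalue_laxSym_iff (u : SobolevLog (-1 / 2)) (μ : ℂ) :
    IsEigenvalue (laxSym u) μ ↔ IsEigenvalue (laxOp u) μ := by
  rw [isEigenvalue_iff, isEigenvalue_iff, ← map_kerPow_laxSym]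
  constructor
  · rintro ⟨x, hx, h⟩
    exact ⟨l2ToNegHalf x, (map_ne_zero_iff _ l2ToNegHalf_injective).2 hx,
      Submodule.mem_map_of_mem h⟩
  · rintro ⟨_, hx, x, h, rfl⟩
    exact ⟨x, (map_ne_zero_iff _ l2ToNegHalf_injective).1 hx, h⟩

theorem isEigenvalue_laxSym_iff_eigenHalf {u : SobolevLog (-1 / 2)} {μ : ℂ} :
    IsEigenvalue (laxSym u) μ ↔ ∃ f ∈ eigenHalf u μ, f ≠ 0 := by
  rw [isEigenvalue_iff]
  constructor
  · rintro ⟨x, hx, h⟩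
    obtain ⟨f, hf, rfl⟩ := mem_kerPow_laxSym.1 h
    exact ⟨f, hf, (map_ne_zero_iff _ halfToL2_injective).1 hx⟩
  · rintro ⟨f, hf, h0⟩
    exact ⟨halfToL2 f, (map_ne_zero_iff _ halfToL2_injective).2 h0,
      mem_kerPow_laxSym.2 ⟨f, hf, rfl⟩⟩

theorem laxSym_isFormalAdjoint (u : LogReal) :
    (laxSym (u : SobolevLog (-1 / 2))).IsFormalAdjoint (laxSym (u : SobolevLog (-1 / 2))) := by
  intro x y
  obtain ⟨f, hf, hf'⟩ := laxSym_spec _ x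
  obtain ⟨g, hg, hg'⟩ := laxSym_spec _ y
  have h := pairing_laxMap_symm u f g
  rw [hf', hg', pairing_l2ToNegHalf, pairing_l2ToNegHalf, hf, hg] at h
  rw [← inner_conj_symm, h, Complex.conj_conj]

theorem inner_eq_zero_of_mem_eigenHalf (u : LogReal) {μ ν : ℝ} (hne : μ ≠ ν) {f g : Hardy (1 / 2)}
    (hf : f ∈ eigenHalf (u : SobolevLog (-1 / 2)) μ)
    (hg : g ∈ eigenHalf (u : SobolevLog (-1 / 2)) ν) :
    inner ℂ (halfToL2 f) (halfToL2 g) = 0 := by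
  have h := pairing_laxMap_symm u g f
  rw [mem_eigenHalf.1 hf, mem_eigenHalf.1 hg, pairing_smul_left, pairing_smul_left, map_mul,
    pairing_halfToNegHalf, pairing_halfToNegHalf, Complex.conj_ofReal, inner_conj_symm] at h
  by_contra h0
  exact hne (Complex.ofReal_injective (mul_right_cancel₀ h0 h)).symm

/-! ### The resolvent -/

/-- The form of `L_u - l` is coercive on `H^{1/2}_+`, with constant `1/2`. -/
def FormCoercive (u : SobolevLog (-1 / 2)) (l : ℝ) : Prop :=
  ∀ f : Hardy (1 / 2),
    1 / 2 * ‖f‖ ^ 2 ≤ (pairing ((laxMap u - (l : ℂ) • halfToNegHalf) f) f).re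

/-- The bounded operator `L_u - μ` from `H^{1/2}_+` to `H^{-1/2}_+`. -/
def laxShift (u : SobolevLog (-1 / 2)) (μ : ℂ) : Hardy (1 / 2) →L[ℂ] Hardy (-1 / 2) :=
  laxL u - μ • halfToNegHalfL

theorem FormCoercive.bijective {u : SobolevLog (-1 / 2)} {l : ℝ} (h : FormCoercive u l) :
    Function.Bijective (laxShift u l) :=
  bijective_of_coercive (laxShift u l) one_half_pos h

/-- The isomorphism `L_u - l` from `H^{1/2}_+` to `H^{-1/2}_+`. -/
def FormCoercive.equiv {u : SobolevLog (-1 / 2)} {l : ℝ} (h : FormCoercive u l) :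
    Hardy (1 / 2) ≃L[ℂ] Hardy (-1 / 2) :=
  ContinuousLinearEquiv.ofBijective (laxShift u l) (LinearMap.ker_eq_bot.2 h.bijective.1)
    (LinearMap.range_eq_top.2 h.bijective.2)

theorem FormCoercive.equiv_apply {u : SobolevLog (-1 / 2)} {l : ℝ} (h : FormCoercive u l)
    (f : Hardy (1 / 2)) : h.equiv f = laxMap u f - (l : ℂ) • halfToNegHalf f := rfl

/-- The resolvent `(L_u - l)⁻¹` on `L²_+`. -/
def FormCoercive.res {u : SobolevLog (-1 / 2)} {l : ℝ} (h : FormCoercive u l) :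
    Hardy 0 →L[ℂ] Hardy 0 :=
  halfToL2L.comp ((h.equiv.symm : Hardy (-1 / 2) →L[ℂ] Hardy (1 / 2)).comp l2ToNegHalfL)

theorem FormCoercive.res_apply {u : SobolevLog (-1 / 2)} {l : ℝ} (h : FormCoercive u l)
    (g : Hardy 0) : h.res g = halfToL2 (h.equiv.symm (l2ToNegHalf g)) := rfl

theorem FormCoercive.laxMap_equiv_symm {u : SobolevLog (-1 / 2)} {l : ℝ} (h : FormCoercive u l)
    (y : Hardy (-1 / 2)) :
    laxMap u (h.equiv.symm y) = y + (l : ℂ) • halfToNegHalf (h.equiv.symm y) := by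
  rw [← sub_eq_iff_eq_add, ← h.equiv_apply, ContinuousLinearEquiv.apply_symm_apply]

theorem FormCoercive.isResolvent {u : SobolevLog (-1 / 2)} {l : ℝ} (h : FormCoercive u l) :
    IsResolvent (laxSym u) l h.res := by
  refine ⟨fun x => ?_, fun x => ?_⟩
  · have h1 : laxMap u (h.equiv.symm (l2ToNegHalf x)) = l2ToNegHalf (x + (l : ℂ) • h.res x) := by
      rw [h.laxMap_equiv_symm, map_add, map_smul, h.res_apply, l2ToNegHalf_halfToL2]
    obtain ⟨hd, h2⟩ := laxSym_of_laxMap_eq h1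
    refine ⟨hd, ?_⟩
    rw [sub_eq_iff_eq_add]
    exact h2
  · obtain ⟨f, hf, hf'⟩ := laxSym_spec u x
    have h1 : l2ToNegHalf (laxSym u x - (l : ℂ) • (x : Hardy 0)) = h.equiv f := by
      rw [map_sub, map_smul, ← hf', ← hf, l2ToNegHalf_halfToL2, h.equiv_apply]
    rw [h.res_apply, h1, ContinuousLinearEquiv.symm_apply_apply, hf]

theorem FormCoercive.isCompactOperator_res {u : SobolevLog (-1 / 2)} {l : ℝ}
    (h : FormCoercive u l) : IsCompactOperator h.res :=
  isCompactOperator_halfToL2L.comp_clm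
    ((h.equiv.symm : Hardy (-1 / 2) →L[ℂ] Hardy (1 / 2)).comp l2ToNegHalfL)

/-- The isomorphism (L_u - l)⁻¹ carries L²_+, dense in H^{-1/2}_+, to a dense subspace of H^{1/2}_+.
-/
theorem FormCoercive.dense_symDomain {u : SobolevLog (-1 / 2)} {l : ℝ} (h : FormCoercive u l) :
    Dense (symDomain u : Set (Hardy (1 / 2))) := by
  have h1 : DenseRange (h.equiv.symm ∘ l2ToNegHalf) :=
    h.equiv.symm.surjective.denseRange.comp (by
      have := dense_range_l2ToNegHalf
      rwa [LinearMap.coe_range] at this) h.equiv.symm.continuous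
  refine h1.mono ?_
  rintro _ ⟨g, rfl⟩
  refine ⟨g + (l : ℂ) • halfToL2 (h.equiv.symm (l2ToNegHalf g)), ?_⟩
  rw [map_add, map_smul, l2ToNegHalf_halfToL2, Function.comp_apply, h.laxMap_equiv_symm]

/-! ### Bounds of the quadratic form -/

theorem hardy_inner_self (x : Hardy 0) : inner ℂ x x = ((‖x‖ ^ 2 : ℝ) : ℂ) :=
  inner_self_eq_ofReal x

/-- The quadratic form of `L_u`. -/
def laxForm (u : SobolevLog (-1 / 2)) (f : Hardy (1 / 2)) : ℝ := (pairing (laxMap u f) f).re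

theorem re_pairing_laxMap_sub (u : SobolevLog (-1 / 2)) (l : ℝ) (f : Hardy (1 / 2)) :
    (pairing ((laxMap u - (l : ℂ) • halfToNegHalf) f) f).re =
      laxForm u f - l * ‖halfToL2 f‖ ^ 2 := by
  rw [LinearMap.sub_apply, LinearMap.smul_apply, pairing_sub_left, pairing_smul_left,
    pairing_halfToNegHalf, hardy_inner_self, ← Complex.ofReal_mul, Complex.sub_re,
    Complex.ofReal_re]
  rfl

theorem FormCoercive.le {u : SobolevLog (-1 / 2)} {l : ℝ} (h : FormCoercive u l)
    (f : Hardy (1 / 2)) : 1 / 2 * ‖f‖ ^ 2 ≤ laxForm u f - l * ‖halfToL2 f‖ ^ 2 := by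
  rw [← re_pairing_laxMap_sub]
  exact h f

theorem laxForm_of_mem_eigenHalf {u : SobolevLog (-1 / 2)} {μ : ℝ} {f : Hardy (1 / 2)}
    (hf : f ∈ eigenHalf u μ) : laxForm u f = μ * ‖halfToL2 f‖ ^ 2 := by
  rw [laxForm, mem_eigenHalf.1 hf, pairing_smul_left, pairing_halfToNegHalf, hardy_inner_self,
    ← Complex.ofReal_mul, Complex.ofReal_re]

theorem halfToL2_ne_zero {f : Hardy (1 / 2)} (hf : f ≠ 0) : halfToL2 f ≠ 0 :=
  (map_ne_zero_iff _ halfToL2_injective).2 hf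

theorem FormCoercive.lt_of_mem_eigenHalf {u : SobolevLog (-1 / 2)} {l μ : ℝ}
    (h : FormCoercive u l) {f : Hardy (1 / 2)} (hf : f ∈ eigenHalf u μ) (h0 : f ≠ 0) : l < μ := by
  have h1 := h.le f
  rw [laxForm_of_mem_eigenHalf hf, ← sub_mul] at h1
  have h2 : 0 < 1 / 2 * ‖f‖ ^ 2 := by positivity
  exact sub_pos.1 (pos_of_mul_pos_left (h2.trans_le h1) (sq_nonneg _))

/-- The sum of the spaces of eigenfunctions for the real eigenvalues in `S`. -/
def eigenHalfSum (u : SobolevLog (-1 / 2)) (S : Set ℝ) : Submodule ℂ (Hardy (1 / 2)) :=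
  ⨆ s : S, eigenHalf u ((s : ℝ) : ℂ)

theorem eigenHalf_le_eigenHalfSum {u : SobolevLog (-1 / 2)} {S : Set ℝ} {μ : ℝ} (hμ : μ ∈ S) :
    eigenHalf u μ ≤ eigenHalfSum u S :=
  le_iSup (fun s : S => eigenHalf u ((s : ℝ) : ℂ)) ⟨μ, hμ⟩

theorem eigenHalfSum_mono {u : SobolevLog (-1 / 2)} {S T : Set ℝ} (h : S ⊆ T) :
    eigenHalfSum u S ≤ eigenHalfSum u T :=
  iSup_le fun s => eigenHalf_le_eigenHalfSum (h s.2)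

/-- Upper half of the min-max principle: orthogonality of the eigenspaces diagonalizes the form. -/
theorem laxForm_le_of_mem_eigenHalfSum (u : LogReal) {y : ℝ} {f : Hardy (1 / 2)}
    (hf : f ∈ eigenHalfSum (u : SobolevLog (-1 / 2)) (Set.Iic y)) :
    laxForm (u : SobolevLog (-1 / 2)) f ≤ y * ‖halfToL2 f‖ ^ 2 := by
  obtain ⟨g, hg, rfl⟩ := (Submodule.mem_iSup_iff_exists_finsupp _ _).1 hf
  have h1 : laxMap (u : SobolevLog (-1 / 2)) (g.sum fun _ x => x) =
      l2ToNegHalf (∑ s ∈ g.support, ((s : ℝ) : ℂ) • halfToL2 (g s)) := by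
    rw [Finsupp.sum, map_sum, map_sum]
    refine Finset.sum_congr rfl fun s _ => ?_
    rw [mem_eigenHalf.1 (hg s), map_smul, l2ToNegHalf_halfToL2]
  have h2 : halfToL2 (g.sum fun _ x => x) = ∑ s ∈ g.support, halfToL2 (g s) := by
    rw [Finsupp.sum, map_sum]
  have horth : ∀ i j, i ≠ j → inner ℂ (halfToL2 (g i)) (halfToL2 (g j)) = 0 := fun i j hij =>
    inner_eq_zero_of_mem_eigenHalf u (fun h => hij (Subtype.ext h)) (hg i) (hg j)
  rw [laxForm, h1, pairing_l2ToNegHalf, h2,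
    inner_sum_smul_of_orthogonal g.support (fun s => halfToL2 (g s)) (fun s => (s : ℝ)) horth,
    norm_sum_sq_of_orthogonal g.support (fun s => halfToL2 (g s)) horth, Complex.ofReal_re,
    Finset.mul_sum]
  exact Finset.sum_le_sum fun s _ => mul_le_mul_of_nonneg_right s.2 (sq_nonneg _)

theorem FormCoercive.res_of_mem_eigenHalf {u : SobolevLog (-1 / 2)} {l μ : ℝ}
    (h : FormCoercive u l) (hμ : μ ≠ l) {f : Hardy (1 / 2)} (hf : f ∈ eigenHalf u μ) :
    h.res (halfToL2 f) = (((μ - l)⁻¹ : ℝ) : ℂ) • halfToL2 f := by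
  have h1 := (h.isResolvent.eigen_iff (ν := μ) (by exact_mod_cast hμ) (halfToL2 f)).1
    (mem_kerPow_laxSym.2 ⟨f, hf, rfl⟩)
  rw [h1]
  push_cast
  rfl

/-- Inversion reverses the order: eigenvalues of L_u in (l, y] become eigenvalues of the resolvent
that are at least 1/(y - l), and none lie at or below l. -/
theorem FormCoercive.map_eigenHalfSum_le {u : SobolevLog (-1 / 2)} {l y : ℝ}
    (h : FormCoercive u l) :
    (eigenHalfSum u (Set.Iic y)).map halfToL2 ≤ eigenSum h.res (Set.Ici (y - l)⁻¹) := by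
  rw [eigenHalfSum, Submodule.map_iSup]
  refine iSup_le fun s => ?_
  rintro _ ⟨f, hf, rfl⟩
  by_cases h0 : f = 0
  · rw [h0, map_zero]
    exact zero_mem _
  have hl := h.lt_of_mem_eigenHalf hf h0
  have hs : (s : ℝ) ≤ y := s.2
  have h1 : ((s : ℝ) - l)⁻¹ ∈ Set.Ici (y - l)⁻¹ :=
    inv_anti₀ (sub_pos.2 hl) (by linarith)
  exact Submodule.mem_iSup_of_mem (⟨_, h1⟩ : Set.Ici (y - l)⁻¹)
    (Module.End.mem_eigenspace_iff.2 (h.res_of_mem_eigenHalf hl.ne' hf))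

theorem FormCoercive.finiteDimensional_map {u : LogReal} {l : ℝ}
    (h : FormCoercive (u : SobolevLog (-1 / 2)) l) {S : Set ℝ} {y : ℝ} (hS : S ⊆ Set.Iic y) :
    FiniteDimensional ℂ ((eigenHalfSum (u : SobolevLog (-1 / 2)) S).map halfToL2) := by
  -- Raising the bound to at least l + 1 keeps the threshold for the resolvent positive.
  have hS' : S ⊆ Set.Iic (max y (l + 1)) := hS.trans (Set.Iic_subset_Iic.2 (le_max_left _ _))
  have hpos : 0 < (max y (l + 1) - l)⁻¹ :=
    inv_pos.2 (by linarith [le_max_right y (l + 1)])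
  have := finiteDimensional_eigenSum (h.isResolvent.isSymmetric (laxSym_isFormalAdjoint u))
    h.isCompactOperator_res hpos (S := Set.Ici (max y (l + 1) - l)⁻¹) (fun s hs => hs)
  exact Submodule.finiteDimensional_of_le
    ((Submodule.map_mono (eigenHalfSum_mono hS')).trans h.map_eigenHalfSum_le)

theorem FormCoercive.finiteDimensional_eigenHalfSum {u : LogReal} {l : ℝ}
    (h : FormCoercive (u : SobolevLog (-1 / 2)) l) {S : Set ℝ} {y : ℝ} (hS : S ⊆ Set.Iic y) :
    FiniteDimensional ℂ (eigenHalfSum (u : SobolevLog (-1 / 2)) S) := by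
  have := h.finiteDimensional_map hS
  exact (Submodule.equivMapOfInjective halfToL2 halfToL2_injective
    (eigenHalfSum (u : SobolevLog (-1 / 2)) S)).symm.finiteDimensional

theorem pairing_equiv_symm {u : SobolevLog (-1 / 2)} {l : ℝ} (h : FormCoercive u l) (x : Hardy 0)
    (g : Hardy (1 / 2)) :
    pairing (h.equiv (h.equiv.symm (l2ToNegHalf x))) g = inner ℂ (halfToL2 g) x := by
  rw [ContinuousLinearEquiv.apply_symm_apply, pairing_l2ToNegHalf]

theorem FormCoercive.re_inner_res_nonneg {u : SobolevLog (-1 / 2)} {l : ℝ} (h : FormCoercive u l)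
    (x : Hardy 0) : 0 ≤ (inner ℂ x (h.res x)).re := by
  have h1 := h (h.equiv.symm (l2ToNegHalf x))
  have h2 := pairing_equiv_symm h x (h.equiv.symm (l2ToNegHalf x))
  change _ ≤ (pairing (h.equiv (h.equiv.symm (l2ToNegHalf x)))
    (h.equiv.symm (l2ToNegHalf x))).re at h1
  rw [h2, ← h.res_apply, ← inner_conj_symm, Complex.conj_re] at h1
  exact le_trans (by positivity) h1

/-- Lower half of the min-max principle. Here g is only in the form domain, so L_u g need not be in
L²_+; the bound is deduced from the bounded resolvent R instead, through ⟨Rg, g⟩ ≤ ‖g‖²/(x - l). -/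
theorem FormCoercive.mul_norm_sq_le_laxForm {u : LogReal} {l : ℝ}
    (h : FormCoercive (u : SobolevLog (-1 / 2)) l) {x : ℝ} {g : Hardy (1 / 2)}
    (hg : halfToL2 g ∈ ((eigenHalfSum (u : SobolevLog (-1 / 2)) (Set.Iio x)).map halfToL2)ᗮ) :
    x * ‖halfToL2 g‖ ^ 2 ≤ laxForm (u : SobolevLog (-1 / 2)) g := by
  rcases le_or_gt x l with hx | hx
  · have h1 := h.le g
    nlinarith [mul_le_mul_of_nonneg_right hx (sq_nonneg ‖halfToL2 g‖), sq_nonneg ‖g‖]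
  set t := (x - l)⁻¹ with ht
  have htp : 0 < t := inv_pos.2 (sub_pos.2 hx)
  have hA := laxSym_isFormalAdjoint u
  have h1 : halfToL2 g ∈ (eigenSum h.res (Set.Ioi t))ᗮ := by
    rw [eigenSum, ← Submodule.iInf_orthogonal, Submodule.mem_iInf]
    rintro ⟨s, hs⟩ y hy
    have hs0 : 0 < s := htp.trans hs
    have hy' : h.res y = (s : ℂ) • y := Module.End.mem_eigenspace_iff.1 hy
    have hne : ((l + s⁻¹ : ℝ) : ℂ) ≠ (l : ℂ) := by
      simp [hs0.ne']
    have h2 : y ∈ kerPow (laxSym (u : SobolevLog (-1 / 2))) ((l + s⁻¹ : ℝ) : ℂ) 1 := by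
      rw [h.isResolvent.eigen_iff hne, hy']
      simp
    obtain ⟨f, hf, rfl⟩ := mem_kerPow_laxSym.1 h2
    refine hg _ (Submodule.mem_map_of_mem (eigenHalf_le_eigenHalfSum ?_ hf))
    have h3 : s⁻¹ < t⁻¹ := inv_strictAnti₀ htp hs
    rw [ht, inv_inv] at h3
    exact lt_sub_iff_add_lt'.1 h3
  have h2 := inner_le_of_orthogonal_eigenSum (h.isResolvent.isSymmetric hA)
    h.isCompactOperator_res h.re_inner_res_nonneg htp.le h1
  set k := h.equiv.symm (l2ToNegHalf (halfToL2 g)) with hk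
  have hkL : halfToL2 k = h.res (halfToL2 g) := rfl
  -- With k = (L_u - l)⁻¹g and q the form of L_u - l, positivity of q at g - (x - l)k reads 0 ≤ q(g)
  -- - 2(x - l)‖g‖² + (x - l)²⟨Rg, g⟩. The last term is at most (x - l)‖g‖², so q(g) ≥ (x - l)‖g‖².
  set a : ℂ := ((-(x - l) : ℝ) : ℂ) with ha
  have h3 := h (g + a • k)
  have h4 : (laxMap (u : SobolevLog (-1 / 2)) - (l : ℂ) • halfToNegHalf) (g + a • k) =
      h.equiv g + a • h.equiv k := by
    rw [map_add, map_smul]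
    rfl
  have e1 : ∀ f, pairing (h.equiv k) f = inner ℂ (halfToL2 f) (halfToL2 g) :=
    fun f => pairing_equiv_symm h _ f
  have e2 : pairing (h.equiv g) k = inner ℂ (halfToL2 g) (halfToL2 g) := by
    have h5 : pairing (h.equiv g) k = conj (pairing (h.equiv k) g) := by
      rw [h.equiv_apply, h.equiv_apply, pairing_sub_left, pairing_sub_left, map_sub,
        pairing_laxMap_symm, pairing_smul_left, pairing_smul_left, map_mul, Complex.conj_ofReal,
        pairing_halfToNegHalf, pairing_halfToNegHalf, inner_conj_symm]
    rw [h5, e1, inner_conj_symm]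
  have e3 : (pairing (h.equiv g) g).re =
      laxForm (u : SobolevLog (-1 / 2)) g - l * ‖halfToL2 g‖ ^ 2 :=
    re_pairing_laxMap_sub _ l g
  have e4 : (inner ℂ (halfToL2 k) (halfToL2 g)).re ≤ t * ‖halfToL2 g‖ ^ 2 := by
    rw [hkL, ← inner_conj_symm, Complex.conj_re]
    exact h2
  rw [h4, pairing_add_left, pairing_smul_left, pairing_add_right, pairing_smul_right,
    pairing_add_right, pairing_smul_right, e2, e1, e1, hardy_inner_self, ha,
    Complex.conj_ofReal] at h3
  simp only [Complex.add_re, Complex.re_ofReal_mul, Complex.ofReal_re, e3] at h3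
  have h5 : 0 ≤ 1 / 2 * ‖g + ((-(x - l) : ℝ) : ℂ) • k‖ ^ 2 := by positivity
  have h6 : (x - l) * t = 1 := mul_inv_cancel₀ (sub_pos.2 hx).ne'
  have h7 : (x - l) * ((x - l) * (inner ℂ (halfToL2 k) (halfToL2 g)).re) ≤
      (x - l) * ‖halfToL2 g‖ ^ 2 := by
    refine mul_le_mul_of_nonneg_left ?_ (sub_pos.2 hx).le
    calc _ ≤ (x - l) * (t * ‖halfToL2 g‖ ^ 2) :=
          mul_le_mul_of_nonneg_left e4 (sub_pos.2 hx).le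
      _ = _ := by rw [← mul_assoc, h6, one_mul]
  linarith

end

end LaxLog

namespace LaxLog

noncomputable section

/-! ### Orthogonal complements of finite-dimensional subspaces -/

section

variable {E V : Type*} [NormedAddCommGroup E] [InnerProductSpace ℂ E] [AddCommGroup V]
  [Module ℂ V] [FiniteDimensional ℂ V]

theorem exists_ne_zero_mem_orthogonal (φ : V →ₗ[ℂ] E) (K : Submodule ℂ E) [FiniteDimensional ℂ K]
    (h : Module.finrank ℂ K < Module.finrank ℂ V) : ∃ v, v ≠ 0 ∧ φ v ∈ Kᗮ := by
  obtain ⟨p, hp, hp0⟩ := (Submodule.ne_bot_iff _).1 (LinearMap.ker_ne_bot_of_finrank_lt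
    (f := K.orthogonalProjectionOnto.toLinearMap.comp φ) h)
  exact ⟨p, hp0, Submodule.orthogonalProjectionOnto_eq_zero_iff.1 hp⟩

theorem exists_ne_zero_mem_orthogonal_of_eq_zero (φ : V →ₗ[ℂ] E) (ψ : V →ₗ[ℂ] ℂ)
    (K : Submodule ℂ E) [FiniteDimensional ℂ K]
    (h : Module.finrank ℂ K + 1 < Module.finrank ℂ V) : ∃ v, v ≠ 0 ∧ ψ v = 0 ∧ φ v ∈ Kᗮ := by
  have h1 : Module.finrank ℂ K < Module.finrank ℂ (LinearMap.ker ψ) := by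
    have h2 := ψ.finrank_range_add_finrank_ker
    have h3 := (Submodule.finrank_le (LinearMap.range ψ)).trans_eq (Module.finrank_self ℂ)
    omega
  obtain ⟨v, hv, h2⟩ :=
    exists_ne_zero_mem_orthogonal (φ.comp (LinearMap.ker ψ).subtype) K h1
  exact ⟨v, fun h0 => hv (Subtype.ext h0), v.2, h2⟩

theorem finiteDimensional_of_orthogonal_eq_bot (K : Submodule ℂ E) [FiniteDimensional ℂ K]
    (h : ∀ x ∈ Kᗮ, x = 0) : FiniteDimensional ℂ E := by
  have h1 : K = ⊤ := Submodule.orthogonal_eq_bot_iff.1 ((Submodule.eq_bot_iff _).2 h)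
  have h2 : FiniteDimensional ℂ (⊤ : Submodule ℂ E) := h1 ▸ ‹FiniteDimensional ℂ K›
  exact Submodule.topEquiv.finiteDimensional

end

/-! ### The backward shift -/

/-- The backward shift `f ↦ Π (e^{-ix} f)`. -/
def backShift : Hardy (1 / 2) →ₗ[ℂ] Hardy (1 / 2) where
  toFun f := ⟨WSobolev.mk (fun n => if 0 ≤ n then f.1 (n + 1) else 0) (by
    have h := (Equiv.addRight (1 : ℤ)).summable_iff.2 f.1.summable
    refine h.of_nonneg_of_le (fun n => mul_nonneg ((sobolevWeight _).pos n).le (sq_nonneg _))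
      fun n => ?_
    have hb := bracket_pos (n + 1)
    simp only [Function.comp_apply, Equiv.coe_addRight, sobolevWeight_half]
    split_ifs with hn
    · refine mul_le_mul_of_nonneg_right ?_ (sq_nonneg _)
      have hn' : (0 : ℝ) ≤ n := by exact_mod_cast hn
      rw [bracket, bracket]
      push_cast
      rw [abs_of_nonneg hn', abs_of_nonneg (by linarith)]
      exact max_le_max le_rfl (by linarith)
    · rw [norm_zero, zero_pow two_ne_zero, mul_zero]
      positivity), fun n hn => if_neg (not_le.2 hn)⟩
  map_add' f g := by
    refine Subtype.ext (WSobolev.ext fun n => ?_)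
    by_cases hn : 0 ≤ n <;> simp [hn]
  map_smul' c f := by
    refine Subtype.ext (WSobolev.ext fun n => ?_)
    by_cases hn : 0 ≤ n <;> simp [hn]

/-- The vanishing mean is exactly what makes the formula valid at n = -1, so that nothing is lost in
the shift. -/
theorem backShift_apply {f : Hardy (1 / 2)} (h0 : f.1 0 = 0) (n : ℤ) :
    (backShift f).1 n = f.1 (n + 1) := by
  change (if 0 ≤ n then f.1 (n + 1) else 0) = _
  split_ifs with hn
  · rfl
  · rcases eq_or_ne n (-1) with rfl | h
    · exact h0.symm
    · exact (f.2 (n + 1) (by omega)).symm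

theorem norm_halfToL2_backShift {f : Hardy (1 / 2)} (h0 : f.1 0 = 0) :
    ‖halfToL2 (backShift f)‖ = ‖halfToL2 f‖ := by
  refine (sq_eq_sq₀ (norm_nonneg _) (norm_nonneg _)).1 ?_
  refine (halfToL2 (backShift f)).1.hasSum_norm_sq.unique ?_
  have h := (Equiv.addRight (1 : ℤ)).hasSum_iff.2 (halfToL2 f).1.hasSum_norm_sq
  refine h.congr_fun fun n => ?_
  rw [halfToL2_apply, backShift_apply h0]
  simp only [Function.comp_apply, Equiv.coe_addRight, sobolevWeight_zero]
  rfl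

/-- The commutation of the Lax operator with the shift, at the level of the forms. -/
theorem laxForm_backShift (u : SobolevLog (-1 / 2)) {f : Hardy (1 / 2)} (h0 : f.1 0 = 0) :
    laxForm u f = laxForm u (backShift f) + ‖halfToL2 (backShift f)‖ ^ 2 := by
  set g := backShift f with hg
  -- The series of f is read at n + 1 and matched with that of g at n. Multiplication by u commutes
  -- with translating frequencies, and D contributes n + 1 instead of n, hence the extra ‖g‖².
  have h1 := (Equiv.addRight (1 : ℤ)).hasSum_iff.2 (hasSum_pairing (laxMap u f) f)
  have h2 := (hasSum_pairing (laxMap u g) g).add (hasSum_inner_l2 (halfToL2 g) (halfToL2 g))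
  have h3 : inner ℂ f (riesz (laxMap u f)) =
      inner ℂ g (riesz (laxMap u g)) + inner ℂ (halfToL2 g) (halfToL2 g) := by
    refine h1.unique (h2.congr_fun fun n => ?_)
    simp only [Function.comp_apply, Equiv.coe_addRight, halfToL2_apply]
    rw [← backShift_apply h0, ← hg]
    rcases lt_or_ge n 0 with hn | hn
    · simp [g.2 n hn]
    · rw [laxMap_apply u f (by omega : (0 : ℤ) ≤ n + 1), laxMap_apply u g hn,
        ← backShift_apply h0, ← hg]
      have h4 : ∑' k, u (n + 1 - k) * f.1 k = ∑' k, u (n - k) * g.1 k := by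
        rw [← (Equiv.addRight (1 : ℤ)).tsum_eq]
        refine tsum_congr fun k => ?_
        rw [hg, backShift_apply h0, Equiv.coe_addRight, add_sub_add_right_eq_sub]
      rw [h4]
      push_cast
      ring
  rw [laxForm, laxForm, pairing_eq_inner, pairing_eq_inner, h3, hardy_inner_self, Complex.add_re,
    Complex.ofReal_re]

/-! ### The gaps between the eigenvalues -/

theorem mem_eigenHalfSum_Iic {u : SobolevLog (-1 / 2)} {μ y : ℝ} (hμ : μ ≤ y) {f : Hardy (1 / 2)}
    (hf : f ∈ eigenHalf u μ) : f ∈ eigenHalfSum u (Set.Iic y) :=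
  eigenHalf_le_eigenHalfSum (Set.mem_Iic.2 hμ) hf

/-- The shift lowers the form by exactly the squared norm; a dimension count finds a vector of
energy at most ν whose shift is orthogonal to all eigenfunctions below μ. Allowing μ = ν makes the
same statement yield simplicity. -/
theorem gap_of_orthogonal {u : LogReal} {l : ℝ} (h : FormCoercive (u : SobolevLog (-1 / 2)) l)
    {μ ν : ℝ} (hμν : μ ≤ ν) {f g : Hardy (1 / 2)}
    (hf : f ∈ eigenHalf (u : SobolevLog (-1 / 2)) μ) (hf0 : f ≠ 0)
    (hg : g ∈ eigenHalf (u : SobolevLog (-1 / 2)) ν) (hg0 : g ≠ 0)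
    (hfg : inner ℂ (halfToL2 f) (halfToL2 g) = 0) : μ + 1 ≤ ν := by
  set F := eigenHalfSum (u : SobolevLog (-1 / 2)) (Set.Iio μ) with hF
  set K := F.map halfToL2 with hK
  have : FiniteDimensional ℂ F := h.finiteDimensional_eigenHalfSum Set.Iio_subset_Iic_self
  have : FiniteDimensional ℂ K := h.finiteDimensional_map Set.Iio_subset_Iic_self
  let φ : F × ℂ × ℂ →ₗ[ℂ] Hardy (1 / 2) := F.subtype.coprod
    ((LinearMap.toSpanSingleton ℂ _ f).coprod (LinearMap.toSpanSingleton ℂ _ g))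
  have hφ : ∀ p, φ p = p.1 + (p.2.1 • f + p.2.2 • g) := fun p => rfl
  let ev : Hardy (1 / 2) →ₗ[ℂ] ℂ :=
    { toFun := fun f => f.1 0, map_add' := fun _ _ => rfl, map_smul' := fun _ _ => rfl }
  -- There are dim F + 2 unknowns against dim F + 1 conditions: orthogonality of the shift to K, and
  -- zero mean.
  have hdim : Module.finrank ℂ K + 1 < Module.finrank ℂ (F × ℂ × ℂ) := by
    have h1 : Module.finrank ℂ K = Module.finrank ℂ F :=
      (Submodule.equivMapOfInjective halfToL2 halfToL2_injective F).finrank_eq.symm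
    rw [Module.finrank_prod, Module.finrank_prod, h1, Module.finrank_self]
    omega
  obtain ⟨p, hp0, hp1, hp2⟩ := exists_ne_zero_mem_orthogonal_of_eq_zero (E := Hardy 0)
    (halfToL2.comp (backShift.comp φ)) (ev.comp φ) K hdim
  replace hp1 : (φ p).1 0 = 0 := hp1
  replace hp2 : halfToL2 (backShift (φ p)) ∈ Kᗮ := hp2
  have hmem : φ p ∈ eigenHalfSum (u : SobolevLog (-1 / 2)) (Set.Iic ν) := by
    rw [hφ]
    refine add_mem (eigenHalfSum_mono ?_ p.1.2) (add_mem (Submodule.smul_mem _ _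
      (mem_eigenHalfSum_Iic hμν hf)) (Submodule.smul_mem _ _
      (mem_eigenHalfSum_Iic le_rfl hg)))
    exact (Set.Iio_subset_Iic_self).trans (Set.Iic_subset_Iic.2 hμν)
  -- f and g are orthogonal to F and to each other, so a nonzero parameter gives a nonzero vector.
  have hne : φ p ≠ 0 := by
    intro h0
    rw [hφ] at h0
    have horth : ∀ (k : Hardy (1 / 2)) (κ : ℝ), μ ≤ κ →
        k ∈ eigenHalf (u : SobolevLog (-1 / 2)) κ → ∀ x ∈ F,
          inner ℂ (halfToL2 k) (halfToL2 x) = 0 := by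
      intro k κ hκ hk x hx
      induction hx using Submodule.iSup_induction' with
      | mem s x hx =>
        exact inner_eq_zero_of_mem_eigenHalf u (s.2.trans_le hκ).ne' hk hx
      | zero => rw [map_zero, inner_zero_right]
      | add x y _ _ hx hy => rw [map_add, inner_add_right, hx, hy, add_zero]
    have h1 := congrArg (fun x => inner ℂ (halfToL2 f) (halfToL2 x)) h0
    have h2 := congrArg (fun x => inner ℂ (halfToL2 g) (halfToL2 x)) h0
    have hgf : inner ℂ (halfToL2 g) (halfToL2 f) = 0 := by
      rw [← inner_conj_symm, hfg, map_zero]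
    have hsm : ∀ (c : ℂ) (x y : Hardy 0), inner ℂ x (c • y) = c * inner ℂ x y :=
      fun c x y => inner_smul_right x y c
    simp only [map_add, map_smul, map_zero, inner_add_right, inner_zero_right, hsm, hfg, hgf,
      horth f μ le_rfl hf _ p.1.2, horth g ν hμν hg _ p.1.2, mul_zero, add_zero, zero_add] at h1 h2
    have h3 : p.2.1 = 0 :=
      (mul_eq_zero.1 h1).resolve_right (inner_self_ne_zero.2 (halfToL2_ne_zero hf0))
    have h4 : p.2.2 = 0 :=
      (mul_eq_zero.1 h2).resolve_right (inner_self_ne_zero.2 (halfToL2_ne_zero hg0))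
    rw [h3, h4, zero_smul, zero_smul, add_zero, add_zero] at h0
    exact hp0 (Prod.ext (Subtype.ext h0) (Prod.ext h3 h4))
  have h1 := laxForm_le_of_mem_eigenHalfSum u hmem
  have h2 := h.mul_norm_sq_le_laxForm hp2
  rw [laxForm_backShift _ hp1] at h1
  rw [norm_halfToL2_backShift hp1] at h1 h2
  have h3 : 0 < ‖halfToL2 (φ p)‖ ^ 2 := by
    have := norm_pos_iff.2 (halfToL2_ne_zero hne)
    positivity
  exact le_of_mul_le_mul_right (by linarith) h3

/-- The component of g orthogonal to f is again an eigenfunction for μ; were it nonzero, the gap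
estimate would give μ + 1 ≤ μ. -/
theorem eigenHalf_simple (u : LogReal) {μ : ℝ} {f : Hardy (1 / 2)}
    (hf : f ∈ eigenHalf (u : SobolevLog (-1 / 2)) μ) (hf0 : f ≠ 0) {g : Hardy (1 / 2)}
    (hg : g ∈ eigenHalf (u : SobolevLog (-1 / 2)) μ) : ∃ c : ℂ, g = c • f := by
  obtain ⟨l, h⟩ := exists_coercive u
  set c := inner ℂ (halfToL2 f) (halfToL2 g) / inner ℂ (halfToL2 f) (halfToL2 f) with hc
  refine ⟨c, ?_⟩
  by_contra hne
  have h1 := gap_of_orthogonal h le_rfl hf hf0 (sub_mem hg (Submodule.smul_mem _ c hf))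
    (sub_ne_zero.2 hne) (by
      rw [map_sub, map_smul, inner_sub_right,
        show inner ℂ (halfToL2 f) (c • halfToL2 f) = c * inner ℂ (halfToL2 f) (halfToL2 f) from
          inner_smul_right (halfToL2 f) (halfToL2 f) c, hc,
        div_mul_cancel₀ _ (inner_self_ne_zero.2 (halfToL2_ne_zero hf0)), sub_self])
  linarith

/-! ### Enumeration of the eigenvalues -/

/-- The real eigenvalues of `L_u`. -/
def eigenSet (u : SobolevLog (-1 / 2)) : Set ℝ := {μ | ∃ f ∈ eigenHalf u μ, f ≠ 0}

theorem eigenSet_gap (u : LogReal) {μ ν : ℝ} (hμ : μ ∈ eigenSet (u : SobolevLog (-1 / 2)))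
    (hν : ν ∈ eigenSet (u : SobolevLog (-1 / 2))) (h : μ < ν) : μ + 1 ≤ ν := by
  obtain ⟨l, hl⟩ := exists_coercive u
  obtain ⟨f, hf, hf0⟩ := hμ
  obtain ⟨g, hg, hg0⟩ := hν
  exact gap_of_orthogonal hl h.le hf hf0 hg hg0 (inner_eq_zero_of_mem_eigenHalf u h.ne hf hg)

/-- Finitely many eigenvalues would be bounded above, so all eigenfunctions would lie in one
finite-dimensional subspace; completeness would then make L²_+ finite-dimensional. -/
theorem eigenSet_infinite (u : LogReal) : (eigenSet (u : SobolevLog (-1 / 2))).Infinite := by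
  intro hfin
  obtain ⟨l, h⟩ := exists_coercive u
  obtain ⟨y, hy⟩ := hfin.bddAbove
  set K := (eigenHalfSum (u : SobolevLog (-1 / 2)) (Set.Iic y)).map halfToL2 with hK
  have hKf : FiniteDimensional ℂ K := FormCoercive.finiteDimensional_map h le_rfl
  refine not_finiteDimensional_l2
    (finiteDimensional_of_orthogonal_eq_bot (E := Hardy 0) K fun x hx => ?_)
  refine (FormCoercive.isResolvent h).eq_zero_of_orthogonal (laxSym_isFormalAdjoint u)
    (FormCoercive.isCompactOperator_res h) fun ν z hz => ?_
  obtain ⟨f, hf, rfl⟩ := mem_kerPow_laxSym.1 hz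
  by_cases hf0 : f = 0
  · rw [hf0, map_zero, inner_zero_left]
  · exact hx _ (Submodule.mem_map_of_mem (mem_eigenHalfSum_Iic (hy ⟨f, hf, hf0⟩) hf))

/-- Because of the unit gaps, x ↦ ⌊x - b⌋ is strictly increasing on S, which reduces the matter to
listing an infinite set of natural numbers. -/
theorem exists_strictMono_enumeration {S : Set ℝ} (hinf : S.Infinite) {b : ℝ} (hb : ∀ x ∈ S, b ≤ x)
    (hgap : ∀ x ∈ S, ∀ y ∈ S, x < y → x + 1 ≤ y) :
    ∃ a : ℕ → ℝ, StrictMono a ∧ Set.range a = S := by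
  set fl : ℝ → ℕ := fun x => ⌊x - b⌋₊ with hfl
  have hlt : ∀ x ∈ S, ∀ y ∈ S, x < y → fl x < fl y := by
    intro x hx y hy hxy
    have h1 : x - b + 1 ≤ y - b := by linarith [hgap x hx y hy hxy]
    have h2 := Nat.floor_le_floor h1
    rw [Nat.floor_add_one (by linarith [hb x hx])] at h2
    exact h2
  have hinj : Set.InjOn fl S := by
    intro x hx y hy hxy
    rcases lt_trichotomy x y with h | h | h
    · exact absurd hxy (hlt x hx y hy h).ne
    · exact h
    · exact absurd hxy (hlt y hy x hx h).ne'
  set p : ℕ → Prop := fun k => k ∈ fl '' S with hp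
  have hpinf : {k | p k}.Infinite := hinf.image hinj
  have hmem : ∀ n, ∃ x ∈ S, fl x = Nat.nth p n := fun n => Nat.nth_mem_of_infinite hpinf n
  choose a haS ha using hmem
  refine ⟨a, fun m n hmn => ?_, ?_⟩
  · by_contra hle
    have h1 : fl (a n) ≤ fl (a m) := Nat.floor_le_floor (by linarith)
    rw [ha, ha] at h1
    exact (Nat.nth_strictMono hpinf hmn).not_ge h1
  · ext x
    constructor
    · rintro ⟨n, rfl⟩
      exact haS n
    · intro hx
      have h1 : fl x ∈ Set.range (Nat.nth p) := by
        rw [Nat.range_nth_of_infinite hpinf]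
        exact ⟨x, hx, rfl⟩
      obtain ⟨n, hn⟩ := h1
      exact ⟨n, hinj (haS n) hx ((ha n).trans hn)⟩

/-- A strictly increasing sequence is determined by its range, so choosing one involves no
arbitrariness. -/
theorem exists_eigenvalue_sequence (u : LogReal) :
    ∃ a : ℕ → ℝ, StrictMono a ∧ Set.range a = eigenSet (u : SobolevLog (-1 / 2)) := by
  obtain ⟨l, h⟩ := exists_coercive u
  refine exists_strictMono_enumeration (eigenSet_infinite u) (b := l) ?_
    fun x hx y hy => eigenSet_gap u hx hy
  rintro x ⟨f, hf, hf0⟩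
  exact (FormCoercive.lt_of_mem_eigenHalf h hf hf0).le

/-- The eigenvalues `λ_n(u)` of the Lax operator, in increasing order. -/
def laxEigenvalue (n : ℕ) (u : LogReal) : ℝ := (exists_eigenvalue_sequence u).choose n

theorem laxEigenvalue_strictMono (u : LogReal) : StrictMono fun n => laxEigenvalue n u :=
  (exists_eigenvalue_sequence u).choose_spec.1

theorem range_laxEigenvalue (u : LogReal) :
    (Set.range fun n => laxEigenvalue n u) = eigenSet (u : SobolevLog (-1 / 2)) :=
  (exists_eigenvalue_sequence u).choose_spec.2

theorem laxEigenvalue_mem (n : ℕ) (u : LogReal) :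
    laxEigenvalue n u ∈ eigenSet (u : SobolevLog (-1 / 2)) :=
  range_laxEigenvalue u ▸ Set.mem_range_self n

theorem laxEigenvalue_succ (n : ℕ) (u : LogReal) :
    1 + laxEigenvalue n u ≤ laxEigenvalue (n + 1) u := by
  rw [add_comm]
  exact eigenSet_gap u (laxEigenvalue_mem n u) (laxEigenvalue_mem (n + 1) u)
    (laxEigenvalue_strictMono u (Nat.lt_succ_self n))

theorem tendsto_laxEigenvalue (u : LogReal) :
    Filter.Tendsto (fun n => laxEigenvalue n u) Filter.atTop Filter.atTop := by
  have h : ∀ n : ℕ, laxEigenvalue 0 u + n ≤ laxEigenvalue n u := by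
    intro n
    induction n with
    | zero => simp
    | succ n ih =>
      push_cast
      linarith [laxEigenvalue_succ n u]
  exact Filter.tendsto_atTop_mono h
    (Filter.tendsto_atTop_add_const_left _ _ tendsto_natCast_atTop_atTop)

/-- A choice of eigenfunctions. -/
def laxEigenfunction (n : ℕ) (u : LogReal) : Hardy (1 / 2) := (laxEigenvalue_mem n u).choose

theorem laxEigenfunction_mem (n : ℕ) (u : LogReal) :
    laxEigenfunction n u ∈ eigenHalf (u : SobolevLog (-1 / 2)) (laxEigenvalue n u) :=
  (laxEigenvalue_mem n u).choose_spec.1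

theorem laxEigenfunction_ne_zero (n : ℕ) (u : LogReal) : laxEigenfunction n u ≠ 0 :=
  (laxEigenvalue_mem n u).choose_spec.2

/-! ### Comparison of the eigenvalues of two potentials -/

/-- Below λ_n there are only λ_0, …, λ_{n-1}, and by simplicity each contributes one dimension. -/
theorem finrank_eigenHalfSum_le (u : LogReal) (n : ℕ) :
    Module.finrank ℂ (eigenHalfSum (u : SobolevLog (-1 / 2)) (Set.Iio (laxEigenvalue n u))) ≤ n := by
  have h1 : eigenHalfSum (u : SobolevLog (-1 / 2)) (Set.Iio (laxEigenvalue n u)) ≤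
      Submodule.span ℂ (Set.range fun k : Fin n => laxEigenfunction k u) := by
    refine iSup_le fun s f hf => ?_
    by_cases hf0 : f = 0
    · rw [hf0]
      exact zero_mem _
    have h2 : (s : ℝ) ∈ eigenSet (u : SobolevLog (-1 / 2)) := ⟨f, hf, hf0⟩
    rw [← range_laxEigenvalue] at h2
    obtain ⟨k, hk⟩ := h2
    have hk' : laxEigenvalue k u = s := hk
    have hs : (s : ℝ) < laxEigenvalue n u := s.2
    have hkn : k < n := by
      rw [← hk'] at hs
      exact (laxEigenvalue_strictMono u).lt_iff_lt.1 hs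
    rw [← hk'] at hf
    obtain ⟨c, rfl⟩ := eigenHalf_simple u (laxEigenfunction_mem k u)
      (laxEigenfunction_ne_zero k u) hf
    exact Submodule.smul_mem _ _ (Submodule.subset_span ⟨⟨k, hkn⟩, rfl⟩)
  have : FiniteDimensional ℂ
      (Submodule.span ℂ (Set.range fun k : Fin n => laxEigenfunction k u)) :=
    FiniteDimensional.span_of_finite ℂ (Set.finite_range _)
  have h3 := Submodule.finrank_mono h1
  refine h3.trans ((finrank_range_le_card _).trans_eq (Fintype.card_fin n))

/-- Min-max comparison: the span of the first n + 1 eigenfunctions for u contains a nonzero vector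
orthogonal to the eigenfunctions for v below λ_n(v), a space of dimension at most n. On it q_u is at
most λ_n(u) and q_v at least λ_n(v). -/
theorem laxEigenvalue_le_of_laxForm_le (u v : LogReal) {a b : ℝ} (ha : 0 ≤ a)
    (h : ∀ f, laxForm (v : SobolevLog (-1 / 2)) f ≤
      a * laxForm (u : SobolevLog (-1 / 2)) f + b * ‖halfToL2 f‖ ^ 2) (n : ℕ) :
    laxEigenvalue n v ≤ a * laxEigenvalue n u + b := by
  obtain ⟨l, hl⟩ := exists_coercive v
  set F := eigenHalfSum (v : SobolevLog (-1 / 2)) (Set.Iio (laxEigenvalue n v)) with hF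
  set K := F.map halfToL2 with hK
  have : FiniteDimensional ℂ K :=
    FormCoercive.finiteDimensional_map hl Set.Iio_subset_Iic_self
  let e : Fin (n + 1) → Hardy (1 / 2) := fun k => laxEigenfunction k u
  let φ : (Fin (n + 1) → ℂ) →ₗ[ℂ] Hardy (1 / 2) := Fintype.linearCombination ℂ e
  have hli : LinearIndependent ℂ (fun k => halfToL2 (e k)) := by
    refine linearIndependent_of_ne_zero_of_inner_eq_zero
      (fun k => halfToL2_ne_zero (laxEigenfunction_ne_zero k u)) fun i j hij => ?_
    refine inner_eq_zero_of_mem_eigenHalf u ?_ (laxEigenfunction_mem i u)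
      (laxEigenfunction_mem j u)
    exact fun h => hij (Fin.ext ((laxEigenvalue_strictMono u).injective h))
  have hinj : Function.Injective φ :=
    (linearIndependent_iff_injective_fintypeLinearCombination).1 (hli.of_comp halfToL2)
  have hdim : Module.finrank ℂ K < Module.finrank ℂ (Fin (n + 1) → ℂ) := by
    have h1 : Module.finrank ℂ K = Module.finrank ℂ F :=
      (Submodule.equivMapOfInjective halfToL2 halfToL2_injective F).finrank_eq.symm
    rw [h1, Module.finrank_fin_fun]
    exact Nat.lt_succ_of_le (finrank_eigenHalfSum_le v n)
  obtain ⟨p, hp0, hp1⟩ := exists_ne_zero_mem_orthogonal (E := Hardy 0) (halfToL2.comp φ) K hdim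
  replace hp1 : halfToL2 (φ p) ∈ Kᗮ := hp1
  have hmem : φ p ∈ eigenHalfSum (u : SobolevLog (-1 / 2)) (Set.Iic (laxEigenvalue n u)) := by
    rw [Fintype.linearCombination_apply]
    exact Submodule.sum_mem _ fun k _ => Submodule.smul_mem _ _ (mem_eigenHalfSum_Iic
      ((laxEigenvalue_strictMono u).monotone (Nat.lt_succ_iff.1 k.2)) (laxEigenfunction_mem k u))
  have hne : φ p ≠ 0 := (map_ne_zero_iff φ hinj).2 hp0
  have h1 := laxForm_le_of_mem_eigenHalfSum u hmem
  have h2 := FormCoercive.mul_norm_sq_le_laxForm hl hp1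
  have h3 := h (φ p)
  have h4 : 0 < ‖halfToL2 (φ p)‖ ^ 2 := by
    have := norm_pos_iff.2 (halfToL2_ne_zero hne)
    positivity
  have h5 := mul_le_mul_of_nonneg_left h1 ha
  exact le_of_mul_le_mul_right (by linarith) h4

end

end LaxLog

namespace LaxLog

noncomputable section

/-! ### Perturbation of a simple eigenvalue -/

section

open scoped ContDiff

variable {P X Y : Type*} [NormedAddCommGroup P] [NormedSpace ℂ P] [NormedAddCommGroup X]
  [NormedSpace ℂ X] [NormedAddCommGroup Y] [NormedSpace ℂ Y]

/-- Fredholm alternative for the compact operator K = 1 - M E⁻¹: if 1 is an eigenvalue of K, then M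
has a kernel; otherwise 1 - K = M E⁻¹ is onto. -/
theorem bijective_of_isCompactOperator [CompleteSpace Y] (E : X ≃L[ℂ] Y) (M : X →L[ℂ] Y)
    (hK : IsCompactOperator ((E : X →L[ℂ] Y) - M)) (hinj : Function.Injective M) :
    Function.Bijective M := by
  set K : Y →L[ℂ] Y := ((E : X →L[ℂ] Y) - M).comp (E.symm : Y →L[ℂ] X) with hKdef
  have hK' : IsCompactOperator K := hK.comp_clm _
  have hap : ∀ y, K y = y - M (E.symm y) := fun y => by simp [hKdef]
  refine ⟨hinj, fun y => ?_⟩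
  rcases hK'.hasEigenvalue_or_mem_resolventSet (one_ne_zero (α := ℂ)) with h | h
  · obtain ⟨z, hz⟩ := h.exists_hasEigenvector
    have h1 := hz.apply_eq_smul
    rw [ContinuousLinearMap.coe_coe, hap, one_smul, sub_eq_self, ← map_zero M] at h1
    exact absurd ((E.symm.map_eq_zero_iff).1 (hinj h1)) hz.2
  · rw [spectrum.mem_resolventSet_iff, map_one] at h
    obtain ⟨z, hz⟩ := ((ContinuousLinearMap.isUnit_iff_bijective).1 h).2 y
    refine ⟨E.symm z, ?_⟩
    rw [← hz, sub_apply, hap]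
    simp

/-- The derivative of `(x, z) ↦ (B x - z • J x, φ x)`. -/
def borderedMap (B : X →L[ℂ] Y) (y : Y) (φ : X →L[ℂ] ℂ) : X × ℂ →L[ℂ] Y × ℂ :=
  (B.comp (.fst ℂ X ℂ) - (ContinuousLinearMap.snd ℂ X ℂ).smulRight y).prod
    (φ.comp (.fst ℂ X ℂ))

theorem borderedMap_apply (B : X →L[ℂ] Y) (y : Y) (φ : X →L[ℂ] ℂ) (q : X × ℂ) :
    borderedMap B y φ q = (B q.1 - q.2 • y, φ q.1) := rfl

/-- Solving (B + φ ⊗ y)x = w gives the first component with z = -φ(x); adding a multiple of e, which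
B does not see, then adjusts φ. -/
theorem borderedMap_bijective {B : X →L[ℂ] Y} {y : Y} {φ : X →L[ℂ] ℂ} {e : X} (he : B e = 0)
    (hφ : φ e ≠ 0) (hM : Function.Bijective (B + φ.smulRight y)) :
    Function.Bijective (borderedMap B y φ) := by
  have hMap : ∀ x, (B + φ.smulRight y) x = B x + φ x • y := fun x => rfl
  constructor
  · rw [injective_iff_map_eq_zero]
    rintro ⟨x, z⟩ h
    rw [borderedMap_apply, Prod.mk_eq_zero, sub_eq_zero] at h
    obtain ⟨h1, h2⟩ := h
    have h3 : x = (z / φ e) • e := hM.1 (by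
      rw [hMap, hMap, map_smul, map_smul, h1, h2, he, smul_eq_mul, div_mul_cancel₀ _ hφ]
      simp)
    dsimp only at h2
    rw [h3, map_smul, smul_eq_mul, div_mul_cancel₀ _ hφ] at h2
    rw [h3, h2, zero_div, zero_smul]
    rfl
  · rintro ⟨w, s⟩
    obtain ⟨x, hx⟩ := hM.2 w
    rw [hMap] at hx
    refine ⟨(x + ((s - φ x) / φ e) • e, -φ x), ?_⟩
    rw [borderedMap_apply]
    simp only [map_add, map_smul, he, smul_zero, add_zero, smul_eq_mul, div_mul_cancel₀ _ hφ]
    refine Prod.ext ?_ ?_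
    · rw [← hx]
      simp
    · simp

/-- Implicit function theorem for (q, x, z) ↦ (A(q)x - zJx, φ(x)). Fixing φ(x) removes the scaling
freedom of eigenvectors and makes the partial derivative in (x, z), a bordered operator, invertible.
The equation is continued from its value at p, which is 0 in the application. -/
theorem exists_contDiffAt_eigenvalue [CompleteSpace P] [CompleteSpace X] [CompleteSpace Y]
    {A : P → X →L[ℂ] Y} (hA : ContDiff ℂ ω A) (J : X →L[ℂ] Y)
    (φ : X →L[ℂ] ℂ) {p : P} {e : X} {μ : ℂ}
    (hb : Function.Bijective (borderedMap (A p - μ • J) (J e) φ)) :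
    ∃ ψ : P → X × ℂ, ContDiffAt ℂ ω ψ p ∧ ψ p = (e, μ) ∧ ∀ᶠ q in nhds p,
      A q (ψ q).1 - (ψ q).2 • J (ψ q).1 = A p e - μ • J e ∧ φ (ψ q).1 = φ e := by
  set F : P × (X × ℂ) → Y × ℂ := fun v => (A v.1 v.2.1 - v.2.2 • J v.2.1, φ v.2.1) with hF
  have hFc : ContDiff ℂ ω F :=
    (((hA.comp contDiff_fst).clm_apply contDiff_snd.fst).sub
      (contDiff_snd.snd.smul (J.contDiff.comp contDiff_snd.fst))).prodMk
      (φ.contDiff.comp contDiff_snd.fst)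
  have hFa : ContDiffAt ℂ ω F (p, (e, μ)) := hFc.contDiffAt
  have hd : HasFDerivAt F (fderiv ℂ F (p, (e, μ))) (p, (e, μ)) :=
    (hFa.differentiableAt (by simp)).hasFDerivAt
  -- The partial derivative is computed abstractly here and explicitly in `h2`; uniqueness of
  -- derivatives identifies the two.
  have h1 := hd.comp (e, μ) (hasFDerivAt_prodMk_right p (e, μ))
  have h2 : HasFDerivAt (F ∘ fun q => (p, q)) (borderedMap (A p - μ • J) (J e) φ) (e, μ) := by
    have h3 : HasFDerivAt (fun q : X × ℂ => A p q.1)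
        ((A p).comp (.fst ℂ X ℂ)) (e, μ) := ((A p).comp (.fst ℂ X ℂ)).hasFDerivAt
    have h4 : HasFDerivAt (fun q : X × ℂ => J q.1)
        (J.comp (.fst ℂ X ℂ)) (e, μ) := (J.comp (.fst ℂ X ℂ)).hasFDerivAt
    have h5 : HasFDerivAt (fun q : X × ℂ => φ q.1)
        (φ.comp (.fst ℂ X ℂ)) (e, μ) := (φ.comp (.fst ℂ X ℂ)).hasFDerivAt
    refine ((h3.sub (hasFDerivAt_snd.smul h4)).prodMk h5).congr_fderiv ?_
    ext q <;> simp [borderedMap_apply]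
  have hinv : (fderiv ℂ F (p, (e, μ)) ∘L .inr ℂ P (X × ℂ)).IsInvertible := by
    rw [h1.unique h2]
    exact ⟨ContinuousLinearEquiv.ofBijective _ (LinearMap.ker_eq_bot.2 hb.1)
      (LinearMap.range_eq_top.2 hb.2), ContinuousLinearEquiv.coe_ofBijective _ _ _⟩
  refine ⟨hFa.implicitFunction (by simp) hinv, hFa.contDiffAt_implicitFunction _ hinv,
    hFa.implicitFunction_apply_self _ hinv, ?_⟩
  filter_upwards [hFa.eventually_apply_implicitFunction (by simp) hinv] with q hq
  exact ⟨congrArg Prod.fst hq, congrArg Prod.snd hq⟩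

end

/-! ### Continuity of the eigenvalues -/

theorem abs_laxForm_sub_le {K : ℝ} (hK : IsProductConstant K) (u v : SobolevLog (-1 / 2))
    (f : Hardy (1 / 2)) : |laxForm v f - laxForm u f| ≤ K * ‖u - v‖ * ‖f‖ ^ 2 := by
  rw [laxForm, laxForm, ← Complex.sub_re, ← pairing_sub_left, laxMap_sub_laxMap]
  refine (Complex.abs_re_le_norm _).trans ((norm_pairing_le _ _).trans ?_)
  rw [sq, ← mul_assoc]
  exact mul_le_mul_of_nonneg_right (norm_toeplitz_le hK _ f) (norm_nonneg f)

/-- Coercivity bounds ‖f‖²_{1/2} by the form of L_u - l, so the change of the form is relatively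
small: |q_v - q_u| ≤ ε(q_u - l‖·‖²). Min-max in both directions turns this into the estimate. -/
theorem FormCoercive.abs_laxEigenvalue_sub_le {u : LogReal} {l : ℝ}
    (h : FormCoercive (u : SobolevLog (-1 / 2)) l) {K : ℝ} (hK : IsProductConstant K) (v : LogReal)
    (hε : 2 * K * ‖(u : SobolevLog (-1 / 2)) - v‖ < 1) (n : ℕ) :
    |laxEigenvalue n v - laxEigenvalue n u| ≤
      2 * K * ‖(u : SobolevLog (-1 / 2)) - v‖ * (laxEigenvalue n u - l) := by
  set ε := 2 * K * ‖(u : SobolevLog (-1 / 2)) - v‖ with hεdef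
  have hε0 : 0 ≤ ε := mul_nonneg (mul_nonneg zero_le_two hK.1.le) (norm_nonneg _)
  have h1 : ∀ f, |laxForm (v : SobolevLog (-1 / 2)) f - laxForm (u : SobolevLog (-1 / 2)) f| ≤
      ε * (laxForm (u : SobolevLog (-1 / 2)) f - l * ‖halfToL2 f‖ ^ 2) := fun f =>
    calc _ ≤ K * ‖(u : SobolevLog (-1 / 2)) - v‖ * ‖f‖ ^ 2 := abs_laxForm_sub_le hK _ _ f
      _ = ε * (1 / 2 * ‖f‖ ^ 2) := by rw [hεdef]; ring
      _ ≤ _ := mul_le_mul_of_nonneg_left (h.le f) hε0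
  have h2 := laxEigenvalue_le_of_laxForm_le u v (a := 1 + ε) (b := -(ε * l)) (by linarith)
    (fun f => by linarith [(abs_le.1 (h1 f)).2]) n
  have hε1 : 0 < 1 - ε := by linarith
  -- The lower bound for q_v, solved for q_u: (1 - ε)q_u ≤ q_v - εl‖·‖².
  have h3 := laxEigenvalue_le_of_laxForm_le v u (a := (1 - ε)⁻¹) (b := (1 - ε)⁻¹ * -(ε * l))
    (inv_nonneg.2 hε1.le) (fun f => by
      rw [mul_assoc, ← mul_add, le_inv_mul_iff₀ hε1]
      linarith [(abs_le.1 (h1 f)).1]) n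
  rw [← mul_add, le_inv_mul_iff₀ hε1] at h3
  exact abs_le.2 ⟨by linarith, by linarith⟩

theorem eventually_abs_laxEigenvalue_sub_lt (u : LogReal) (n : ℕ) {δ : ℝ} (hδ : 0 < δ) :
    ∀ᶠ v in nhds u, |laxEigenvalue n v - laxEigenvalue n u| < δ := by
  obtain ⟨K, hK⟩ := exists_isProductConstant
  obtain ⟨l, h⟩ := exists_coercive u
  have hc : Continuous fun v : LogReal => 2 * K * ‖(u : SobolevLog (-1 / 2)) - v‖ :=
    continuous_const.mul (continuous_const.sub continuous_subtype_val).norm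
  have h0 : 2 * K * ‖(u : SobolevLog (-1 / 2)) - u‖ = 0 := by rw [sub_self, norm_zero, mul_zero]
  filter_upwards [hc.continuousAt.eventually_lt continuousAt_const (h0.trans_lt one_pos),
    (hc.mul continuous_const).continuousAt.eventually_lt continuousAt_const
      ((congrArg (· * (laxEigenvalue n u - l)) h0).trans_lt ((zero_mul _).trans_lt hδ))]
    with v hv1 hv2
  exact (FormCoercive.abs_laxEigenvalue_sub_le h hK v hv1 n).trans_lt hv2

/-! ### Analyticity of the eigenvalues -/

theorem contDiff_laxL {n : WithTop ℕ∞} : ContDiff ℂ n laxL :=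
  contDiff_const.sub (ContinuousLinearMap.contDiff (𝕜 := ℂ) (E := SobolevLog (-1 / 2))
    (F := Hardy (1 / 2) →L[ℂ] Hardy (-1 / 2)) toeplitzL)

/-- The inclusion of the real potentials, as a real-linear bounded operator. -/
def logInclusion : LogReal →L[ℝ] SobolevLog (-1 / 2) := Submodule.subtypeL _

/-- The operator differs from the isomorphism L_u - l by one that factors through the compact
embedding, so injectivity suffices. Pairing (L_u - μ)x + ⟨x | e⟩e = 0 with e kills the first term by
symmetry; thus x is orthogonal to e, an eigenfunction for μ, and a multiple of e by simplicity. -/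
theorem bijective_laxShift_add (u : LogReal) {μ : ℝ} {e : Hardy (1 / 2)}
    (he : e ∈ eigenHalf (u : SobolevLog (-1 / 2)) μ) (he0 : e ≠ 0) :
    Function.Bijective (laxShift (u : SobolevLog (-1 / 2)) μ +
      ((innerSL ℂ (halfToL2 e)).comp halfToL2L).smulRight (halfToNegHalfL e)) := by
  obtain ⟨l, h⟩ := exists_coercive u
  have hee : inner ℂ (halfToL2 e) (halfToL2 e) ≠ 0 := inner_self_ne_zero.2 (halfToL2_ne_zero he0)
  refine bijective_of_isCompactOperator (FormCoercive.equiv h) _ ?_ ?_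
  · set T : Hardy 0 →L[ℂ] Hardy (-1 / 2) := ((μ : ℂ) - l) • l2ToNegHalfL -
      (innerSL ℂ (halfToL2 e)).smulRight (halfToNegHalfL e) with hT
    have h1 : IsCompactOperator (T.comp halfToL2L) := isCompactOperator_halfToL2L.clm_comp T
    refine (congrArg (fun S : Hardy (1 / 2) →L[ℂ] Hardy (-1 / 2) => IsCompactOperator S)
      (ContinuousLinearMap.ext fun f => ?_)).mpr h1
    change laxMap (u : SobolevLog (-1 / 2)) f - (l : ℂ) • halfToNegHalf f -
      (laxMap (u : SobolevLog (-1 / 2)) f - (μ : ℂ) • halfToNegHalf f +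
        inner ℂ (halfToL2 e) (halfToL2 f) • halfToNegHalf e) =
      ((μ : ℂ) - l) • halfToNegHalf f - inner ℂ (halfToL2 e) (halfToL2 f) • halfToNegHalf e
    rw [sub_smul]
    abel
  · rw [injective_iff_map_eq_zero]
    intro x hx
    replace hx : laxMap (u : SobolevLog (-1 / 2)) x - (μ : ℂ) • halfToNegHalf x +
        inner ℂ (halfToL2 e) (halfToL2 x) • halfToNegHalf e = 0 := hx
    have h1 : pairing (laxMap (u : SobolevLog (-1 / 2)) x - (μ : ℂ) • halfToNegHalf x) e = 0 := by
      rw [pairing_sub_left, pairing_laxMap_symm, mem_eigenHalf.1 he, pairing_smul_left,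
        pairing_smul_left, map_mul, Complex.conj_ofReal, pairing_halfToNegHalf,
        pairing_halfToNegHalf, inner_conj_symm, sub_self]
    have h2 : inner ℂ (halfToL2 e) (halfToL2 x) = 0 := by
      have h3 := congrArg (fun y => pairing y e) hx
      have h4 : pairing 0 e = 0 := by simpa using pairing_smul_left 0 0 e
      simp only [pairing_add_left, h1, pairing_smul_left, pairing_halfToNegHalf, zero_add,
        h4] at h3
      exact (mul_eq_zero.1 h3).resolve_right hee
    rw [h2, zero_smul, add_zero, sub_eq_zero] at hx
    obtain ⟨c, rfl⟩ := eigenHalf_simple u he he0 (mem_eigenHalf.2 hx)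
    have h5 : inner ℂ (halfToL2 e) (halfToL2 (c • e)) =
        c * inner ℂ (halfToL2 e) (halfToL2 e) := by
      rw [map_smul]
      exact inner_smul_right (halfToL2 e) (halfToL2 e) c
    rw [h5] at h2
    rw [(mul_eq_zero.1 h2).resolve_right hee, zero_smul]

theorem eq_laxEigenvalue_of_abs_sub_lt {u : LogReal} {n : ℕ} {x : ℝ}
    (hx : x ∈ eigenSet (u : SobolevLog (-1 / 2))) (h : |x - laxEigenvalue n u| < 1) :
    x = laxEigenvalue n u := by
  rw [abs_lt] at h
  rcases lt_trichotomy x (laxEigenvalue n u) with h1 | h1 | h1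
  · linarith [eigenSet_gap u hx (laxEigenvalue_mem n u) h1]
  · exact h1
  · linarith [eigenSet_gap u (laxEigenvalue_mem n u) hx h1]

theorem ofReal_re_of_mem_eigenHalf (u : LogReal) {z : ℂ} {f : Hardy (1 / 2)}
    (hf : f ∈ eigenHalf (u : SobolevLog (-1 / 2)) z) (hf0 : f ≠ 0) : ((z.re : ℝ) : ℂ) = z :=
  im_eq_zero_of_isEigenvalue (laxSym_isFormalAdjoint u)
    (isEigenvalue_laxSym_iff_eigenHalf.2 ⟨f, hf, hf0⟩)

open scoped ContDiff in
-- The branch from the implicit function theorem is complex-analytic in complex potentials;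
-- restricted to real ones, its real part is real-analytic and locally equals λ_n.
theorem analyticAt_laxEigenvalue (n : ℕ) (u : LogReal) : AnalyticAt ℝ (laxEigenvalue n) u := by
  set μ := laxEigenvalue n u with hμ
  set e := laxEigenfunction n u with he_def
  have he : e ∈ eigenHalf (u : SobolevLog (-1 / 2)) μ := laxEigenfunction_mem n u
  have he0 : e ≠ 0 := laxEigenfunction_ne_zero n u
  have hLe : laxMap (u : SobolevLog (-1 / 2)) e - (μ : ℂ) • halfToNegHalf e = 0 :=
    sub_eq_zero.2 (mem_eigenHalf.1 he)
  have hee : inner ℂ (halfToL2 e) (halfToL2 e) ≠ 0 := inner_self_ne_zero.2 (halfToL2_ne_zero he0)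
  obtain ⟨ψ, hψ, hψu, hev⟩ := exists_contDiffAt_eigenvalue (contDiff_laxL (n := ω)) halfToNegHalfL
    ((innerSL ℂ (halfToL2 e)).comp halfToL2L) (p := (u : SobolevLog (-1 / 2))) (e := e) (μ := μ)
    (borderedMap_bijective hLe hee (bijective_laxShift_add u he he0))
  have hψ2 : ContDiffAt ℝ ω (fun v : LogReal => (ψ v).2.re) u :=
    Complex.reCLM.contDiff.contDiffAt.comp u
      ((hψ.restrict_scalars ℝ).comp u logInclusion.contDiff.contDiffAt).snd
  refine hψ2.analyticAt.congr ?_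
  have hval : (ψ u).2.re = μ := by rw [hψu, Complex.ofReal_re]
  -- The branch and λ_n(v) both stay within 1/2 of λ_n(u), hence at distance less than 1 from each
  -- other, below the spectral gap.
  have h1 : ∀ᶠ v : LogReal in nhds u, |(ψ v).2.re - μ| < 1 / 2 :=
    (hψ2.continuousAt.sub continuousAt_const).abs.eventually_lt continuousAt_const (by
      change |(ψ u).2.re - μ| < 1 / 2
      rw [hval, sub_self, abs_zero]
      norm_num)
  filter_upwards [h1, eventually_abs_laxEigenvalue_sub_lt u n one_half_pos,
    continuous_subtype_val.continuousAt.eventually hev] with v hv1 hv2 hv3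
  obtain ⟨hv3, hv4⟩ := hv3
  set f := (ψ v).1
  set z := (ψ v).2
  have hf : f ∈ eigenHalf (v : SobolevLog (-1 / 2)) z :=
    mem_eigenHalf.2 (sub_eq_zero.1 (hv3.trans hLe))
  -- The normalization persists along the branch, so the vector is a genuine eigenfunction.
  have hf0 : f ≠ 0 := by
    intro h0
    rw [h0, map_zero] at hv4
    exact hee hv4.symm
  rw [← ofReal_re_of_mem_eigenHalf v hf hf0] at hf
  refine eq_laxEigenvalue_of_abs_sub_lt ⟨f, hf, hf0⟩ ?_
  rw [abs_lt] at hv1 hv2 ⊢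
  constructor <;> linarith [hv1.1, hv1.2, hv2.1, hv2.2]

end

end LaxLog

namespace LaxLog

noncomputable section

/-! ### Simplicity, and bases of eigenfunctions -/

theorem exists_hilbertBasis {E : Type*} [NormedAddCommGroup E] [InnerProductSpace ℂ E]
    [CompleteSpace E] {v : ℕ → E} (hv : ∀ n, ‖v n‖ = 1) (ho : ∀ i j, i ≠ j → inner ℂ (v i) (v j) = 0)
    (ht : ∀ x, (∀ n, inner ℂ (v n) x = 0) → x = 0) :
    ∃ b : HilbertBasis ℕ ℂ E, ∀ n, b n = v n := by
  have h : Orthonormal ℂ v := ⟨hv, fun i j hij => ho i j hij⟩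
  refine ⟨HilbertBasis.mkOfOrthogonalEqBot h ((Submodule.eq_bot_iff _).2 fun x hx => ht x fun n =>
    hx (v n) (Submodule.subset_span (Set.mem_range_self n))), fun n => ?_⟩
  rw [HilbertBasis.coe_mkOfOrthogonalEqBot]

theorem finrank_rootSpace_laxSym (n : ℕ) (u : LogReal) :
    Module.finrank ℂ (rootSpace (laxSym (u : SobolevLog (-1 / 2))) (laxEigenvalue n u)) = 1 := by
  rw [rootSpace_eq_kerPow_one (laxSym_isFormalAdjoint u)]
  have he := laxEigenfunction_mem n u
  have he0 := laxEigenfunction_ne_zero n u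
  refine finrank_eq_one_iff'.2 ⟨⟨halfToL2 (laxEigenfunction n u),
    mem_kerPow_laxSym.2 ⟨_, he, rfl⟩⟩, fun h => halfToL2_ne_zero he0 (congrArg Subtype.val h), ?_⟩
  rintro ⟨x, hx⟩
  obtain ⟨f, hf, rfl⟩ := mem_kerPow_laxSym.1 hx
  obtain ⟨c, rfl⟩ := eigenHalf_simple u he he0 hf
  exact ⟨c, Subtype.ext (map_smul halfToL2 c _).symm⟩

theorem isEigenvalue_laxEigenvalue (n : ℕ) (u : LogReal) :
    IsEigenvalue (laxSym (u : SobolevLog (-1 / 2))) (laxEigenvalue n u) :=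
  isEigenvalue_laxSym_iff_eigenHalf.2 (laxEigenvalue_mem n u)

theorem isSimpleEigenvalue_laxSym (n : ℕ) (u : LogReal) :
    IsSimpleEigenvalue (laxSym (u : SobolevLog (-1 / 2))) (laxEigenvalue n u) :=
  ⟨isEigenvalue_laxEigenvalue n u, finrank_rootSpace_laxSym n u⟩

theorem isSimpleEigenvalue_laxOp (n : ℕ) (u : LogReal) :
    IsSimpleEigenvalue (laxOp (u : SobolevLog (-1 / 2))) (laxEigenvalue n u) := by
  refine ⟨(isEigenvalue_laxSym_iff _ _).1 (isEigenvalue_laxEigenvalue n u), ?_⟩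
  rw [← map_rootSpace_laxSym]
  exact (Submodule.equivMapOfInjective l2ToNegHalf l2ToNegHalf_injective
    _).finrank_eq.symm.trans (finrank_rootSpace_laxSym n u)

theorem opSpectrum_laxSym (u : LogReal) :
    opSpectrum (laxSym (u : SobolevLog (-1 / 2))) =
      Set.range (fun n => (laxEigenvalue n u : ℂ)) := by
  obtain ⟨l, h⟩ := exists_coercive u
  rw [(FormCoercive.isResolvent h).opSpectrum_eq (FormCoercive.isCompactOperator_res h)]
  ext z
  constructor
  · intro hz
    obtain ⟨f, hf, hf0⟩ := isEigenvalue_laxSym_iff_eigenHalf.1 hz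
    have hre := ofReal_re_of_mem_eigenHalf u hf hf0
    rw [← hre] at hf
    have hmem : z.re ∈ eigenSet (u : SobolevLog (-1 / 2)) := ⟨f, hf, hf0⟩
    rw [← range_laxEigenvalue] at hmem
    obtain ⟨n, hn⟩ := hmem
    exact ⟨n, (congrArg Complex.ofReal hn).trans hre⟩
  · rintro ⟨n, rfl⟩
    exact isEigenvalue_laxEigenvalue n u

/-- By simplicity every eigenfunction is a multiple of some f n, so completeness of all
eigenfunctions passes to any normalized choice. -/
theorem exists_hilbertBasis_of_eigenfunctions (u : LogReal)
    {f : ℕ → (laxSym (u : SobolevLog (-1 / 2))).domain}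
    (hf : ∀ n, ‖f n‖ = 1 ∧
      laxSym (u : SobolevLog (-1 / 2)) (f n) = (laxEigenvalue n u : ℂ) • (f n : Hardy 0)) :
    ∃ b : HilbertBasis ℕ ℂ (Hardy 0), ∀ n, b n = f n := by
  obtain ⟨l, h⟩ := exists_coercive u
  have hg : ∀ n, ∃ g ∈ eigenHalf (u : SobolevLog (-1 / 2)) (laxEigenvalue n u),
      halfToL2 g = f n := fun n => mem_kerPow_laxSym.1 (mem_kerPow_one.2 ⟨(f n).2, (hf n).2⟩)
  choose g hg hgf using hg
  refine exists_hilbertBasis (v := fun n => (f n : Hardy 0)) (fun n => (hf n).1)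
    (fun i j hij => ?_) fun x hx => ?_
  · simp only [← hgf]
    exact inner_eq_zero_of_mem_eigenHalf u
      (fun h => hij ((laxEigenvalue_strictMono u).injective h)) (hg i) (hg j)
  · refine (FormCoercive.isResolvent h).eq_zero_of_orthogonal (laxSym_isFormalAdjoint u)
      (FormCoercive.isCompactOperator_res h) fun ν y hy => ?_
    obtain ⟨k, hk, rfl⟩ := mem_kerPow_laxSym.1 hy
    by_cases hk0 : k = 0
    · rw [hk0, map_zero, inner_zero_left]
    have hmem : ν ∈ eigenSet (u : SobolevLog (-1 / 2)) := ⟨k, hk, hk0⟩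
    rw [← range_laxEigenvalue] at hmem
    obtain ⟨n, rfl⟩ := hmem
    have hgn : g n ≠ 0 := by
      intro h0
      have h1 : (f n : Hardy 0) = 0 := by rw [← hgf, h0, map_zero]
      have h2 : ‖(f n : Hardy 0)‖ = 1 := (hf n).1
      rw [h1, norm_zero] at h2
      exact zero_ne_one h2
    obtain ⟨c, rfl⟩ := eigenHalf_simple u (hg n) hgn hk
    rw [map_smul, hgf]
    have h3 : inner ℂ (c • (f n : Hardy 0)) x = conj c * inner ℂ (f n : Hardy 0) x :=
      inner_smul_left (𝕜 := ℂ) (f n : Hardy 0) x c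
    rw [h3, hx n, mul_zero]

theorem uniform_coercivity {K₀ : ℝ} (hK : IsProductConstant K₀) (u₀ : Sobolev 0) {u : LogReal}
    (hu : ‖(u : SobolevLog (-1 / 2)) - l2ToLog u₀‖ < 1 / (4 * K₀)) {lamb : ℝ}
    (hl : lamb < -(1 + eta 39 ‖u₀‖)) :
    Function.Bijective (laxMap (u : SobolevLog (-1 / 2)) - (lamb : ℂ) • halfToNegHalf) ∧
      ∀ f : Hardy (1 / 2),
        (pairing ((laxMap (u : SobolevLog (-1 / 2)) - (lamb : ℂ) • halfToNegHalf) f) f).im = 0 ∧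
        1 / 2 * ‖f‖ ^ 2 ≤
          (pairing ((laxMap (u : SobolevLog (-1 / 2)) - (lamb : ℂ) • halfToNegHalf) f) f).re ∧
        (pairing ((laxMap (u : SobolevLog (-1 / 2)) - (lamb : ℂ) • halfToNegHalf) f) f).re ≤
          (2 + K₀ * ‖l2ToLog u₀‖) * (1 + |lamb|) * ‖f‖ ^ 2 := by
  have h : FormCoercive (u : SobolevLog (-1 / 2)) lamb := half_norm_sq_le_re_pairing hK hu hl
  refine ⟨h.bijective, fun f => ⟨pairing_shift_im u lamb f, h f, (re_pairing_le hK _ _ f).trans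
    (mul_le_mul_of_nonneg_right ?_ (sq_nonneg _))⟩⟩
  -- Since K₀‖u‖ ≤ K₀‖u₀‖ + 1/4 in the log norm, 1 + K₀‖u‖ + |λ| ≤ (2 + K₀‖u₀‖)(1 + |λ|), uniformly
  -- in u.
  have hK0 := hK.1
  have h1 : K₀ * ‖(u : SobolevLog (-1 / 2)) - l2ToLog u₀‖ ≤ 1 / 4 := by
    rw [lt_div_iff₀ (by positivity)] at hu
    linarith
  have h2 : ‖(u : SobolevLog (-1 / 2))‖ ≤
      ‖l2ToLog u₀‖ + ‖(u : SobolevLog (-1 / 2)) - l2ToLog u₀‖ := norm_le_norm_add_norm_sub' _ _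
  have h3 := mul_le_mul_of_nonneg_left h2 hK0.le
  have h4 : 0 ≤ K₀ * ‖l2ToLog u₀‖ * |lamb| := by positivity
  linarith [abs_nonneg lamb]

end

end LaxLog

/-! ### Assembly of the theorem -/

theorem mainTheorem5 :
    (∃ lam : ℕ → LogReal → ℝ,
      (∀ u : LogReal,
        -- self-adjointness and density of the domain
        (IsSelfAdjoint (laxSym (u : SobolevLog (-1 / 2))) ∧
          Dense (symDomain (u : SobolevLog (-1 / 2)) : Set (Hardy (1 / 2))) ∧
          Dense ((laxSym (u : SobolevLog (-1 / 2))).domain : Set (Hardy 0))) ∧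
        -- compact resolvent, discrete simple spectrum, orthonormal basis of eigenfunctions
        (HasCompactResolvent (laxSym (u : SobolevLog (-1 / 2))) ∧
          opSpectrum (laxSym (u : SobolevLog (-1 / 2))) = Set.range (fun n => (lam n u : ℂ)) ∧
          (∀ n, IsSimpleEigenvalue (laxSym (u : SobolevLog (-1 / 2))) (lam n u)) ∧
          Filter.Tendsto (fun n => lam n u) Filter.atTop Filter.atTop ∧
          (∀ n, 1 + lam n u ≤ lam (n + 1) u) ∧
          ∀ f : ℕ → (laxSym (u : SobolevLog (-1 / 2))).domain,
            (∀ n, ‖f n‖ = 1 ∧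
              laxSym (u : SobolevLog (-1 / 2)) (f n) = (lam n u : ℂ) • (f n : Hardy 0)) →
            (∀ n, ∃ g : Hardy (1 / 2), halfToL2 g = f n) ∧
              ∃ b : HilbertBasis ℕ ℂ (Hardy 0), ∀ n, b n = f n) ∧
        -- the operators on `L²_+` and on `H^{-1/2}_+` have the same eigenvalues and root spaces
        (∀ μ : ℂ,
          (IsEigenvalue (laxSym (u : SobolevLog (-1 / 2))) μ ↔
            IsEigenvalue (laxOp (u : SobolevLog (-1 / 2))) μ) ∧
          (rootSpace (laxSym (u : SobolevLog (-1 / 2))) μ).map l2ToNegHalf =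
            rootSpace (laxOp (u : SobolevLog (-1 / 2))) μ) ∧
        ∀ n, IsSimpleEigenvalue (laxOp (u : SobolevLog (-1 / 2))) (lam n u)) ∧
      -- real-analytic dependence on the potential
      ∀ n, AnalyticOnNhd ℝ (lam n) Set.univ) ∧
    -- uniform coercivity
    ∃ C₀ : ℝ, 0 < C₀ ∧ ∀ K₀ : ℝ, IsProductConstant K₀ → ∀ u₀ : L2Real,
      ∃ c C : ℝ, 0 < c ∧ c < C ∧
        ∀ u : LogReal, ‖(u : SobolevLog (-1 / 2)) - l2ToLog u₀‖ < 1 / (4 * K₀) →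
        ∀ lamb : ℝ, lamb < -(1 + eta C₀ ‖u₀‖) →
          -- so that the domain of the symmetric operator is the inverse image of `L²_+`
          Function.Bijective
            (laxMap (u : SobolevLog (-1 / 2)) - (lamb : ℂ) • halfToNegHalf) ∧
          ∀ f : Hardy (1 / 2),
            (pairing ((laxMap (u : SobolevLog (-1 / 2)) - (lamb : ℂ) • halfToNegHalf) f) f).im
              = 0 ∧
            c * ‖f‖ ^ 2 ≤
              (pairing ((laxMap (u : SobolevLog (-1 / 2)) - (lamb : ℂ) • halfToNegHalf) f) f).re ∧
            (pairing ((laxMap (u : SobolevLog (-1 / 2)) - (lamb : ℂ) • halfToNegHalf) f) f).re ≤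
              C * (1 + |lamb|) * ‖f‖ ^ 2 := by
  refine ⟨⟨laxEigenvalue, fun u => ?_, fun n u _ => analyticAt_laxEigenvalue n u⟩, 39, by norm_num,
    fun K₀ hK u₀ => ⟨1 / 2, 2 + K₀ * ‖l2ToLog (u₀ : Sobolev 0)‖, one_half_pos, ?_, fun u hu lamb hl =>
      uniform_coercivity hK u₀ hu hl⟩⟩
  · obtain ⟨l, h⟩ := exists_coercive u
    have hR := FormCoercive.isResolvent h
    have hA := laxSym_isFormalAdjoint u
    refine ⟨⟨hR.isSelfAdjoint hA, FormCoercive.dense_symDomain h, hR.dense_domain hA⟩,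
      ⟨hR.hasCompactResolvent (FormCoercive.isCompactOperator_res h), opSpectrum_laxSym u,
        fun n => isSimpleEigenvalue_laxSym n u, tendsto_laxEigenvalue u,
        fun n => laxEigenvalue_succ n u, fun f hf => ⟨fun n => ?_,
          exists_hilbertBasis_of_eigenfunctions u hf⟩⟩,
      fun μ => ⟨isEigenvalue_laxSym_iff _ μ, map_rootSpace_laxSym _ μ⟩,
      fun n => isSimpleEigenvalue_laxOp n u⟩
    obtain ⟨g, hg, -⟩ := laxSym_spec _ (f n)
    exact ⟨g, hg⟩
  · have h1 : 0 ≤ K₀ * ‖l2ToLog (u₀ : Sobolev 0)‖ := mul_nonneg hK.1.le (norm_nonneg _)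
    linarith
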